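/- Theorem (Weyl). Let $M$ be a smooth (Hausdorff, boundaryless) manifold of dimension $n$ with a smooth torsion-free connection $\nabla$ on $TM$, with curvature $R^\nabla(X,Y)Z=\nabla_X\nabla_YZ-\nabla_Y\nabla_XZ-\nabla_{[X,Y]}Z$. Put $r^\nabla(X,Y)=\operatorname{Tr}\bigl(Z\mapsto R^\nabla(X,Z)Y\bigr)$, let $r^\nabla_+$, $r^\nabla_-$ be its symmetric and skew parts, and for $n\ge 2$ put $$Q^\nabla=\frac{1}{n-1}\,r^\nabla_+ +\frac{1}{n+1}\,r^\nabla_- .$$ The Weyl curvature $W^\nabla$ is given by $$W^\nabla(X,Y)Z=R^\nabla(X,Y)Z-Q^\nabla(X,Y)Z-Q^\nabla(X,Z)Y+Q^\nabla(Y,X)Z+Q^\nabla(Y,Z)X,$$ and $C^\nabla=d^\nabla Q^\nabla$ is the covariant exterior derivative of $Q^\nabla$ regarded as a $T^*M$-valued $1$-form $X\mapsto Q^\nabla(X,\cdot)$, that is, $$C^\nabla(X,Y)=\nabla_X\bigl(Q^\nabla(Y,\cdot)\bigr)-\nabla_Y\bigl(Q^\nabla(X,\cdot)\bigr)-Q^\nabla([X,Y],\cdot).$$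 Suppose that either $n\ge 3$ and $W^\nabla=0$, or $n=2$ and $C^\nabla=0$. Let $\nabla^{LC}$ be the Levi-Civita connection of the Fubini–Study metric on $\mathbb{R}P^n$ (the metric for which the projection $S^n\to\mathbb{R}P^n$ is a local isometry). Then every point of $M$ has an open neighbourhood $U$ with a smooth diffeomorphism $\varphi$ from $U$ onto an open subset of $\mathbb{R}P^n$ which carries $\nabla|_U$ to the restriction to $\varphi(U)$ of a connection $\nabla'$ on $\mathbb{R}P^n$ in the projective class of $\nabla^{LC}$, i.e. of the form $\nabla'_XY=\nabla^{LC}_XY+\alpha(X)Y+\alpha(Y)X$ for some smooth $1$-form $\alpha$ on $\mathbb{R}P^n$. -/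

import Mathlib

open Bundle NormedSpace Topology
open scoped Manifold ContDiff Topology

noncomputable section

/-- Real projective space `ℝPⁿ`: the lines through the origin of `ℝⁿ⁺¹`. -/
def RealProjectiveSpace (n : ℕ) : Type :=
  Projectivization ℝ (EuclideanSpace ℝ (Fin (n + 1)))

namespace RealProjectiveSpace

variable {n : ℕ}

/-- The projection `ℝⁿ⁺¹ \ {0} → ℝPⁿ`. -/
def proj (v : {v : EuclideanSpace ℝ (Fin (n + 1)) // v ≠ 0}) : RealProjectiveSpace n :=
  Projectivization.mk' ℝ v

/-- The quotient topology. -/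
instance instTopologicalSpace : TopologicalSpace (RealProjectiveSpace n) :=
  TopologicalSpace.coinduced proj inferInstance

lemma isQuotientMap_proj : IsQuotientMap (proj (n := n)) where
  eq_coinduced := rfl
  surjective := Projectivization.ind fun v hv ↦ ⟨⟨v, hv⟩, rfl⟩

lemma proj_eq_iff (v w : {v : EuclideanSpace ℝ (Fin (n + 1)) // v ≠ 0}) :
    proj v = proj w ↔ ∃ a : ℝˣ, a • w.1 = v.1 :=
  Projectivization.mk_eq_mk_iff ℝ v.1 w.1 v.2 w.2

/-- The vector of `ℝⁿ⁺¹` with `i`-th coordinate `1` and the other coordinates given by `u`. -/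
def affineLift (i : Fin (n + 1)) (u : EuclideanSpace ℝ (Fin n)) :
    EuclideanSpace ℝ (Fin (n + 1)) :=
  WithLp.toLp 2 (i.insertNth (1 : ℝ) u)

@[simp] lemma affineLift_same (i : Fin (n + 1)) (u : EuclideanSpace ℝ (Fin n)) :
    affineLift i u i = 1 := by simp [affineLift]

@[simp] lemma affineLift_succAbove (i : Fin (n + 1)) (u : EuclideanSpace ℝ (Fin n)) (j : Fin n) :
    affineLift i u (i.succAbove j) = u j := by simp [affineLift]

lemma affineLift_ne_zero (i : Fin (n + 1)) (u : EuclideanSpace ℝ (Fin n)) :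
    affineLift i u ≠ 0 := fun h ↦ by
  simpa using congrArg (fun v ↦ v.ofLp i) h

lemma contDiff_affineLift (i : Fin (n + 1)) : ContDiff ℝ ω (affineLift (n := n) i) := by
  rw [contDiff_euclidean]
  intro k
  refine Fin.succAboveCases i ?_ (fun j ↦ ?_) k
  · simpa using contDiff_const
  · simp only [affineLift_succAbove]
    fun_prop

/-- The affine coordinates `[v] ↦ (vⱼ / vᵢ)`, `j ≠ i`. -/
def affineCoord (i : Fin (n + 1)) : RealProjectiveSpace n → EuclideanSpace ℝ (Fin n) :=
  Projectivization.lift (fun v ↦ WithLp.toLp 2 fun j ↦ v.1 (i.succAbove j) / v.1 i) (by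
    rintro ⟨v, hv⟩ ⟨w, hw⟩ t rfl
    ext j
    have ht : t ≠ 0 := by rintro rfl; simp at hv
    simp [mul_div_mul_left _ _ ht])

/-- The open set of the `[v]` with `vᵢ ≠ 0`. -/
def affineDomain (i : Fin (n + 1)) : Set (RealProjectiveSpace n) :=
  {p | p.rep i ≠ 0}

@[simp] lemma affineCoord_proj (i : Fin (n + 1)) (v : {v : EuclideanSpace ℝ (Fin (n + 1)) // v ≠ 0}) :
    affineCoord i (proj v) = WithLp.toLp 2 fun j ↦ v.1 (i.succAbove j) / v.1 i := rfl

lemma proj_mem_affineDomain (i : Fin (n + 1)) (v : {v : EuclideanSpace ℝ (Fin (n + 1)) // v ≠ 0}) :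
    proj v ∈ affineDomain i ↔ v.1 i ≠ 0 := by
  obtain ⟨a, ha⟩ := Projectivization.exists_smul_eq_mk_rep ℝ v.1 v.2
  have : (proj v).rep = a • v.1 := ha.symm
  simp [affineDomain, this, Units.smul_def]

lemma isOpen_affineDomain (i : Fin (n + 1)) : IsOpen (affineDomain (n := n) i) := by
  rw [← isQuotientMap_proj.isOpen_preimage]
  have : proj ⁻¹' affineDomain (n := n) i = {v | v.1 i ≠ 0} := by
    ext v; exact proj_mem_affineDomain i v
  rw [this]
  exact isOpen_ne_fun (by fun_prop) continuous_const

/-- The `i`-th standard affine chart of `ℝPⁿ`. -/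
def affineChart (i : Fin (n + 1)) :
    OpenPartialHomeomorph (RealProjectiveSpace n) (EuclideanSpace ℝ (Fin n)) where
  toFun := affineCoord i
  invFun u := proj ⟨affineLift i u, affineLift_ne_zero i u⟩
  source := affineDomain i
  target := Set.univ
  map_source' _ _ := trivial
  map_target' u _ := by simp [proj_mem_affineDomain]
  left_inv' p hp := by
    obtain ⟨v, rfl⟩ := isQuotientMap_proj.surjective p
    rw [proj_mem_affineDomain] at hp
    rw [proj_eq_iff]
    refine ⟨(Units.mk0 _ hp)⁻¹, ?_⟩
    ext k
    refine Fin.succAboveCases i ?_ (fun j ↦ ?_) k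
    · simp [Units.smul_def, hp]
    · simp [Units.smul_def, div_eq_inv_mul]
  right_inv' u _ := by ext j; simp
  open_source := isOpen_affineDomain i
  open_target := isOpen_univ
  continuousOn_toFun := by
    rw [isQuotientMap_proj.continuousOn_isOpen_iff (isOpen_affineDomain i)]
    have h : proj ⁻¹' affineDomain (n := n) i = {v | v.1 i ≠ 0} := by
      ext v; exact proj_mem_affineDomain i v
    rw [h]
    refine (PiLp.continuous_toLp 2 _).comp_continuousOn (continuousOn_pi.2 fun j ↦ ?_)
    exact ContinuousOn.div (by fun_prop) (by fun_prop) fun v hv ↦ hv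
  continuousOn_invFun := by
    refine (isQuotientMap_proj.continuous.comp ?_).continuousOn
    exact (contDiff_affineLift i).continuous.subtype_mk _

lemma exists_mem_affineDomain (p : RealProjectiveSpace n) : ∃ i, p ∈ affineDomain i := by
  by_contra! h
  refine p.rep_nonzero ?_
  ext i
  simpa [affineDomain] using h i

/-- An index `i` such that `p` lies in the domain of the `i`-th affine chart. -/
def chartIndex (p : RealProjectiveSpace n) : Fin (n + 1) := (exists_mem_affineDomain p).choose

lemma mem_affineDomain_chartIndex (p : RealProjectiveSpace n) : p ∈ affineDomain (chartIndex p) :=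
  (exists_mem_affineDomain p).choose_spec

/-- The smooth structure given by the `n + 1` affine charts. -/
instance instChartedSpace : ChartedSpace (EuclideanSpace ℝ (Fin n)) (RealProjectiveSpace n) where
  atlas := Set.range affineChart
  chartAt p := affineChart (chartIndex p)
  mem_chart_source p := mem_affineDomain_chartIndex p
  chart_mem_atlas _ := ⟨_, rfl⟩

lemma contDiffOn_transition (i j : Fin (n + 1)) :
    ContDiffOn ℝ ω (fun u : EuclideanSpace ℝ (Fin n) ↦
      (WithLp.toLp 2 fun k ↦ affineLift i u (j.succAbove k) / affineLift i u j :
        EuclideanSpace ℝ (Fin n))) {u | affineLift i u j ≠ 0} := by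
  rw [contDiffOn_euclidean]
  intro k
  have h := contDiff_euclidean.1 (contDiff_affineLift i)
  exact (h _).contDiffOn.div (h _).contDiffOn fun u hu ↦ hu

instance instIsManifold : IsManifold (𝓡 n) ω (RealProjectiveSpace n) := by
  refine isManifold_of_contDiffOn _ _ _ ?_
  rintro _ _ ⟨i, rfl⟩ ⟨j, rfl⟩
  refine ((contDiffOn_transition i j).congr fun u _ ↦ rfl).mono ?_
  rintro u ⟨⟨-, hu⟩, -⟩
  exact (proj_mem_affineDomain j _).1 hu

/-- The derivative of `affineLift i`: it inserts `0` as `i`-th coordinate. -/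
def dAffineLift (i : Fin (n + 1)) : EuclideanSpace ℝ (Fin n) →L[ℝ] EuclideanSpace ℝ (Fin (n + 1)) :=
  LinearMap.toContinuousLinearMap
    { toFun := fun ξ ↦ WithLp.toLp 2 (i.insertNth (0 : ℝ) ξ)
      map_add' := fun ξ η ↦ by
        ext k
        refine Fin.succAboveCases i ?_ (fun j ↦ ?_) k <;> simp
      map_smul' := fun c ξ ↦ by
        ext k
        refine Fin.succAboveCases i ?_ (fun j ↦ ?_) k <;> simp }

@[simp] lemma dAffineLift_same (i : Fin (n + 1)) (ξ : EuclideanSpace ℝ (Fin n)) :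
    dAffineLift i ξ i = 0 := by simp [dAffineLift]

@[simp] lemma dAffineLift_succAbove (i : Fin (n + 1)) (ξ : EuclideanSpace ℝ (Fin n)) (j : Fin n) :
    dAffineLift i ξ (i.succAbove j) = ξ j := by simp [dAffineLift]

lemma hasFDerivAt_affineLift (i : Fin (n + 1)) (u : EuclideanSpace ℝ (Fin n)) :
    HasFDerivAt (affineLift i) (dAffineLift i) u := by
  have h : affineLift (n := n) i = fun u ↦ affineLift i 0 + dAffineLift i u := by
    ext u k
    refine Fin.succAboveCases i ?_ (fun j ↦ ?_) k <;> simp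
  rw [h]
  exact (dAffineLift i).hasFDerivAt.const_add _

/-- The Euclidean inner product of `ℝⁿ⁺¹` as a continuous bilinear form. -/
def innerForm (n : ℕ) :
    EuclideanSpace ℝ (Fin (n + 1)) →L[ℝ] EuclideanSpace ℝ (Fin (n + 1)) →L[ℝ] ℝ :=
  innerSL ℝ

@[simp] lemma innerForm_apply (a b : EuclideanSpace ℝ (Fin (n + 1))) :
    innerForm n a b = inner ℝ a b := rfl

/-- The form `(⟨s, s⟩ ⟨a, b⟩ - ⟨s, a⟩ ⟨s, b⟩) / ⟨s, s⟩²` on `ℝⁿ⁺¹`, for `s ≠ 0`: the scalar product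
of the components of `a` and `b` orthogonal to `s`, divided by `|s|²`. It is the pullback to
`ℝⁿ⁺¹ \ {0}` of the symmetric metric of `ℝPⁿ`, the one for which `Sⁿ → ℝPⁿ` is a local isometry. -/
def fubiniStudyForm (s : EuclideanSpace ℝ (Fin (n + 1))) :
    EuclideanSpace ℝ (Fin (n + 1)) →L[ℝ] EuclideanSpace ℝ (Fin (n + 1)) →L[ℝ] ℝ :=
  (‖s‖ ^ 2)⁻¹ • innerForm n - (‖s‖ ^ 4)⁻¹ • (innerForm n s).smulRight (innerForm n s)

lemma fubiniStudyForm_apply (s a b : EuclideanSpace ℝ (Fin (n + 1))) :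
    fubiniStudyForm s a b =
      (‖s‖ ^ 2)⁻¹ * inner ℝ a b - (‖s‖ ^ 4)⁻¹ * (inner ℝ s a * inner ℝ s b) := by
  simp [fubiniStudyForm]

lemma fubiniStudyForm_change (s a b : EuclideanSpace ℝ (Fin (n + 1))) (hs : s ≠ 0) {c : ℝ}
    (hc : c ≠ 0) (x y : ℝ) :
    fubiniStudyForm (c • s) (c • a + x • s) (c • b + y • s) = fubiniStudyForm s a b := by
  have h : ‖s‖ ≠ 0 := norm_ne_zero_iff.2 hs
  have h2 : ‖c • s‖ ^ 2 = c ^ 2 * ‖s‖ ^ 2 := by rw [norm_smul, mul_pow]; simp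
  have h4 : ‖c • s‖ ^ 4 = c ^ 4 * ‖s‖ ^ 4 := by
    rw [show ‖c • s‖ ^ 4 = (‖c • s‖ ^ 2) ^ 2 by ring, h2]; ring
  simp only [fubiniStudyForm_apply, h2, h4, inner_add_left, inner_add_right, real_inner_smul_left,
    real_inner_smul_right, real_inner_self_eq_norm_sq, real_inner_comm s a]
  field_simp
  ring

lemma fubiniStudyForm_pos (s a : EuclideanSpace ℝ (Fin (n + 1))) (hs : s ≠ 0)
    (ha : ∀ c : ℝ, a ≠ c • s) : 0 < fubiniStudyForm s a a := by
  have h : 0 < ‖s‖ := norm_pos_iff.2 hs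
  have key : a - (inner ℝ s a / ‖s‖ ^ 2) • s ≠ 0 := sub_ne_zero.2 (ha _)
  have h1 : fubiniStudyForm s a a =
      (‖s‖ ^ 2)⁻¹ * ‖a - (inner ℝ s a / ‖s‖ ^ 2) • s‖ ^ 2 := by
    rw [fubiniStudyForm_apply, norm_sub_sq_real, real_inner_smul_right, norm_smul, mul_pow,
      real_inner_self_eq_norm_sq, real_inner_comm s a, Real.norm_eq_abs, sq_abs]
    field_simp
    ring
  rw [h1]
  have := norm_pos_iff.2 key
  positivity

/-- The Fubini-Study inner product on `T_p ℝPⁿ`. Tangent vectors at `p` are represented in the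
preferred chart at `p`; they are lifted to `ℝⁿ⁺¹` by the derivative of the section
`u ↦ affineLift i u` of the projection. -/
def fubiniStudyInner (p : RealProjectiveSpace n) :
    TangentSpace (𝓡 n) p →L[ℝ] TangentSpace (𝓡 n) p →L[ℝ] ℝ :=
  (fubiniStudyForm (affineLift (chartIndex p) (chartAt (EuclideanSpace ℝ (Fin n)) p p))).bilinearComp
    (dAffineLift (chartIndex p)) (dAffineLift (chartIndex p))

lemma affineLift_transition (i j : Fin (n + 1)) (u : EuclideanSpace ℝ (Fin n))
    (hu : affineLift i u j ≠ 0) :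
    affineLift j (affineChart j ((affineChart i).symm u)) =
      (affineLift i u j)⁻¹ • affineLift i u := by
  have h : affineChart j ((affineChart i).symm u) =
    WithLp.toLp 2 fun k ↦ affineLift i u (j.succAbove k) / affineLift i u j := rfl
  ext k
  refine Fin.succAboveCases j ?_ (fun l ↦ ?_) k
  · simp [hu]
  · simp [h, div_eq_inv_mul]

lemma dAffineLift_coordChange (x p : RealProjectiveSpace n)
    (hp : p ∈ affineDomain (chartIndex x)) :
    ∃ c : ℝ, c ≠ 0 ∧ affineLift (chartIndex p) (affineChart (chartIndex p) p) =
        c • affineLift (chartIndex x) (affineChart (chartIndex x) p) ∧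
      ∀ v, ∃ a : ℝ, dAffineLift (chartIndex p) (tangentCoordChange (𝓡 n) x p p v) =
        c • dAffineLift (chartIndex x) v +
          a • affineLift (chartIndex x) (affineChart (chartIndex x) p) := by
  set i := chartIndex x
  set j := chartIndex p
  set u := affineChart i p with hu
  have hpj : p ∈ affineDomain j := mem_affineDomain_chartIndex p
  have hup : (affineChart i).symm u = p := (affineChart i).left_inv hp
  have hne : affineLift i u j ≠ 0 := by
    rw [← hup] at hpj
    exact (proj_mem_affineDomain j ⟨affineLift i u, affineLift_ne_zero i u⟩).1 hpj
  refine ⟨(affineLift i u j)⁻¹, inv_ne_zero hne, ?_, fun v ↦ ?_⟩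
  · rw [← affineLift_transition i j u hne, hup]
  have hT : HasFDerivAt (fun w ↦ affineChart j ((affineChart i).symm w))
      (tangentCoordChange (𝓡 n) x p p) u := by
    have h := hasFDerivWithinAt_tangentCoordChange (I := 𝓡 n) (x := x) (y := p) (z := p)
      (by rw [extChartAt_source, extChartAt_source]; exact ⟨hp, hpj⟩)
    simpa using! h
  have h1 := (hasFDerivAt_affineLift j _).comp u hT
  have hs := hasFDerivAt_affineLift i u
  have hsj : HasFDerivAt (fun w ↦ affineLift i w j)
    ((EuclideanSpace.proj j).comp (dAffineLift i)) u :=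
    (EuclideanSpace.proj (𝕜 := ℝ) j).hasFDerivAt.comp u hs
  have h2 := ((hasDerivAt_inv hne).comp_hasFDerivAt u hsj).smul hs
  have h3 : (fun w ↦ (affineLift i w j)⁻¹ • affineLift i w) =ᶠ[𝓝 u]
      affineLift j ∘ fun w ↦ affineChart j ((affineChart i).symm w) := by
    filter_upwards [hsj.continuousAt.eventually_ne hne] with w hw
    exact (affineLift_transition i j w hw).symm
  have h4 := (h1.congr_of_eventuallyEq h3).unique h2
  have h5 := congrArg (fun L ↦ L v) h4
  exact ⟨_, h5⟩

lemma fubiniStudyInner_coordChange (x p : RealProjectiveSpace n)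
    (hp : p ∈ affineDomain (chartIndex x)) (v w : EuclideanSpace ℝ (Fin n)) :
    fubiniStudyInner p (tangentCoordChange (𝓡 n) x p p v) (tangentCoordChange (𝓡 n) x p p w) =
      fubiniStudyForm (affineLift (chartIndex x) (affineChart (chartIndex x) p))
        (dAffineLift (chartIndex x) v) (dAffineLift (chartIndex x) w) := by
  obtain ⟨c, hc, h1, h2⟩ := dAffineLift_coordChange x p hp
  obtain ⟨a, ha⟩ := h2 v
  obtain ⟨b, hb⟩ := h2 w
  have h : fubiniStudyInner p (tangentCoordChange (𝓡 n) x p p v)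
      (tangentCoordChange (𝓡 n) x p p w) =
    fubiniStudyForm (affineLift (chartIndex p) (affineChart (chartIndex p) p))
      (dAffineLift (chartIndex p) (tangentCoordChange (𝓡 n) x p p v))
      (dAffineLift (chartIndex p) (tangentCoordChange (𝓡 n) x p p w)) := rfl
  rw [h, ha, hb, h1, fubiniStudyForm_change _ _ _ (affineLift_ne_zero _ _) hc]

lemma contDiffOn_fubiniStudyForm :
    ContDiffOn ℝ ω (fubiniStudyForm (n := n)) {0}ᶜ := by
  refine contDiffOn_clm_apply.2 fun a ↦ contDiffOn_clm_apply.2 fun b ↦ ?_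
  simp only [fubiniStudyForm_apply]
  have hn (k : ℕ) : ContDiffOn ℝ ω
      (fun s : EuclideanSpace ℝ (Fin (n + 1)) ↦ (‖s‖ ^ (2 * k))⁻¹) {0}ᶜ := by
    simp_rw [pow_mul]
    exact ((contDiff_norm_sq ℝ).pow k).contDiffOn.inv fun s hs ↦ by
      simpa using! fun h : s = 0 ↦ absurd h hs
  have hi (a : EuclideanSpace ℝ (Fin (n + 1))) : ContDiffOn ℝ ω
      (fun s : EuclideanSpace ℝ (Fin (n + 1)) ↦ inner ℝ s a) {0}ᶜ :=
    (contDiff_id.inner ℝ contDiff_const).contDiffOn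
  exact ((hn 1).mul contDiffOn_const).sub ((hn 2).mul ((hi a).mul (hi b)))

lemma fubiniStudyInner_pos (p : RealProjectiveSpace n) (v : TangentSpace (𝓡 n) p) (hv : v ≠ 0) :
    0 < fubiniStudyInner p v v := by
  refine fubiniStudyForm_pos _ _ (affineLift_ne_zero _ _) fun c hc ↦ hv ?_
  have h0 : c = 0 := by
    have h := congrArg (fun w ↦ w.ofLp (chartIndex p)) hc
    simpa using h.symm.trans (dAffineLift_same _ v)
  refine PiLp.ext fun j ↦ ?_
  have := congrArg (fun w ↦ w.ofLp ((chartIndex p).succAbove j)) hc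
  rw [h0] at this
  exact (dAffineLift_succAbove _ v j).symm.trans (this.trans (by simp; rfl))

lemma contMDiff_fubiniStudyInner :
    ContMDiff (𝓡 n) ((𝓡 n).prod 𝓘(ℝ, EuclideanSpace ℝ (Fin n) →L[ℝ] EuclideanSpace ℝ (Fin n) →L[ℝ] ℝ)) ∞
      (fun p : RealProjectiveSpace n ↦ TotalSpace.mk'
        (EuclideanSpace ℝ (Fin n) →L[ℝ] EuclideanSpace ℝ (Fin n) →L[ℝ] ℝ) (E := fun p ↦ TangentSpace (𝓡 n) p →L[ℝ] TangentSpace (𝓡 n) p →L[ℝ] ℝ) p (fubiniStudyInner p)) := by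
  intro x
  rw [contMDiffAt_hom_bundle]
  refine ⟨contMDiffAt_id, ?_⟩
  have hx : (chartAt (EuclideanSpace ℝ (Fin n)) x).source ∈ 𝓝 x := chart_source_mem_nhds _ x
  have h1 : ContMDiffAt (𝓡 n) 𝓘(ℝ, EuclideanSpace ℝ (Fin n) →L[ℝ] EuclideanSpace ℝ (Fin n) →L[ℝ] ℝ) ∞
      (fun p : RealProjectiveSpace n ↦
        (fubiniStudyForm (affineLift (chartIndex x) (affineChart (chartIndex x) p))).bilinearComp
          (dAffineLift (chartIndex x)) (dAffineLift (chartIndex x))) x := by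
    have h2 : ContDiff ℝ ∞ (fun u : EuclideanSpace ℝ (Fin n) ↦
        (fubiniStudyForm (affineLift (chartIndex x) u)).bilinearComp
          (dAffineLift (chartIndex x)) (dAffineLift (chartIndex x))) := by
      refine contDiff_clm_apply_iff.2 fun a ↦ contDiff_clm_apply_iff.2 fun b ↦ ?_
      have h3 := contDiffOn_clm_apply.1 (contDiffOn_clm_apply.1
        (contDiffOn_fubiniStudyForm (n := n)) (dAffineLift (chartIndex x) a))
        (dAffineLift (chartIndex x) b)
      exact ((h3.comp_contDiff (contDiff_affineLift (chartIndex x))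
        fun u ↦ affineLift_ne_zero _ u)).of_le le_top
    exact h2.contMDiff.contMDiffAt.comp x (contMDiffAt_of_mem_maximalAtlas
      (IsManifold.chart_mem_maximalAtlas x) (mem_chart_source _ x))
  refine h1.congr_of_eventuallyEq ?_
  filter_upwards [hx] with p hp
  ext v w
  rw [inCoordinates_apply_eq₂ (by simpa using hp) (by simpa using hp) (Set.mem_univ _)]
  have h4 := fubiniStudyInner_coordChange x p hp v w
  have h5 (v : EuclideanSpace ℝ (Fin n)) :
      (trivializationAt (EuclideanSpace ℝ (Fin n)) (TangentSpace (𝓡 n)) x).symm p v =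
        tangentCoordChange (𝓡 n) x p p v :=
    (Trivialization.symmL_apply (R := ℝ) _ (by simpa using hp) v).symm.trans <|
      congrArg (fun L : EuclideanSpace ℝ (Fin n) →L[ℝ] EuclideanSpace ℝ (Fin n) ↦ L v)
        (TangentBundle.symmL_trivializationAt_eq_core (I := 𝓡 n) hp)
  rw [h5, h5]
  have h6 (a : ℝ) : (trivializationAt ℝ (Bundle.Trivial (RealProjectiveSpace n) ℝ) x).linearMapAt ℝ p a
      = a := by
    simp only [Trivial.fiberBundle_trivializationAt', Trivial.linearMapAt_trivialization,
      LinearMap.id_coe, id_eq]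
  exact (h6 _).trans h4

lemma isVonNBounded_of_pos {E : Type*} [NormedAddCommGroup E] [NormedSpace ℝ E]
    [FiniteDimensional ℝ E]
    (B : E →L[ℝ] E →L[ℝ] ℝ) (hB : ∀ v, v ≠ 0 → 0 < B v v) :
    Bornology.IsVonNBounded ℝ {v : E | B v v < 1} := by
  rw [NormedSpace.isVonNBounded_iff, isBounded_iff_forall_norm_le]
  rcases (Metric.sphere (0 : E) 1).eq_empty_or_nonempty with h | h
  · refine ⟨0, fun v _ ↦ ?_⟩
    by_contra! hv
    refine Set.notMem_empty (‖v‖⁻¹ • v) (h ▸ ?_)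
    simp [norm_smul, hv.ne']
  · obtain ⟨w, hw, hmin⟩ := (isCompact_sphere (0 : E) 1).exists_isMinOn h
      (f := fun v ↦ B v v) (B.continuous.clm_apply continuous_id).continuousOn
    have hw0 : w ≠ 0 := by rintro rfl; simp at hw
    have hc := hB w hw0
    refine ⟨1 + (B w w)⁻¹, fun v (hv : B v v < 1) ↦ ?_⟩
    by_contra! hlt
    have hv0 : 0 < ‖v‖ := lt_trans (by positivity) hlt
    have h1 : B w w ≤ B (‖v‖⁻¹ • v) (‖v‖⁻¹ • v) :=
      hmin (show ‖v‖⁻¹ • v ∈ Metric.sphere (0 : E) 1 by simp [norm_smul, hv0.ne'])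
    have h2 : B w w * ‖v‖ ^ 2 ≤ B v v := by
      simp only [map_smul, _root_.smul_apply, smul_eq_mul] at h1
      calc _ ≤ (‖v‖⁻¹ * (‖v‖⁻¹ * B v v)) * ‖v‖ ^ 2 := by gcongr
        _ = B v v := by field_simp
    have h3 : 1 ≤ ‖v‖ := by linarith [inv_pos.2 hc]
    have h4 : 1 < B w w * ‖v‖ := by
      have := mul_lt_mul_of_pos_left hlt hc
      rw [mul_add, mul_inv_cancel₀ hc.ne'] at this
      linarith
    nlinarith

/-- The Fubini-Study metric, a smooth Riemannian metric on `ℝPⁿ`. -/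
def fubiniStudyMetric (n : ℕ) : ContMDiffRiemannianMetric (𝓡 n) ∞ (EuclideanSpace ℝ (Fin n))
    (fun p : RealProjectiveSpace n ↦ TangentSpace (𝓡 n) p) where
  inner := fubiniStudyInner
  symm p v w := by
    change fubiniStudyForm _ (dAffineLift (chartIndex p) v) (dAffineLift (chartIndex p) w)
      = fubiniStudyForm _ (dAffineLift (chartIndex p) w) (dAffineLift (chartIndex p) v)
    simp only [fubiniStudyForm_apply]
    rw [real_inner_comm, mul_comm (inner ℝ _ (dAffineLift (chartIndex p) v))]
  pos := fubiniStudyInner_pos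
  isVonNBounded p :=
    isVonNBounded_of_pos (E := EuclideanSpace ℝ (Fin n)) (fubiniStudyInner p) (fubiniStudyInner_pos p)
  contMDiff := contMDiff_fubiniStudyInner

end RealProjectiveSpace

/-- A connection `∇` on the tangent bundle of an `n`-manifold `M`; `cov Y x v` is `(∇_v Y)(x)`. -/
abbrev AffineConnection (n : ℕ) (M : Type*) [TopologicalSpace M]
    [ChartedSpace (EuclideanSpace ℝ (Fin n)) M] [IsManifold (𝓡 n) 1 M] : Type _ :=
  CovariantDerivative (𝓡 n) (EuclideanSpace ℝ (Fin n)) (TangentSpace (𝓡 n) : M → Type _)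

namespace AffineConnection

variable {n : ℕ} {M : Type*} [TopologicalSpace M] [ChartedSpace (EuclideanSpace ℝ (Fin n)) M]
  [IsManifold (𝓡 n) ∞ M] (cov : AffineConnection n M)

/-- The vector field `∇_X Y`. -/
def along (X Y : Π x : M, TangentSpace (𝓡 n) x) : Π x : M, TangentSpace (𝓡 n) x :=
  fun x ↦ cov Y x (X x)

/-- The vector field `R(X, Y) Z = ∇_X ∇_Y Z - ∇_Y ∇_X Z - ∇_[X, Y] Z`. -/
def curvatureField (X Y Z : Π x : M, TangentSpace (𝓡 n) x) : Π x : M, TangentSpace (𝓡 n) x :=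
  cov.along X (cov.along Y Z) - cov.along Y (cov.along X Z) -
    cov.along (VectorField.mlieBracket (𝓡 n) X Y) Z

/-- The curvature tensor `R(u, v) w` at `x`, computed with vector fields which are smooth near `x`
and extend `u`, `v`, `w`. -/
def curvature (x : M) (u v w : TangentSpace (𝓡 n) x) : TangentSpace (𝓡 n) x :=
  cov.curvatureField (FiberBundle.extend (EuclideanSpace ℝ (Fin n)) u)
    (FiberBundle.extend (EuclideanSpace ℝ (Fin n)) v)
    (FiberBundle.extend (EuclideanSpace ℝ (Fin n)) w) x

/-- The Ricci contraction `r(u, v) = Tr (z ↦ R(u, z) v)`, with the trace computed in the basis of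
`T_x M` given by the preferred chart at `x`. (This is minus the more usual Ricci tensor.) -/
def ricci (x : M) (u v : TangentSpace (𝓡 n) x) : ℝ :=
  ∑ i : Fin n, (EuclideanSpace.proj i : EuclideanSpace ℝ (Fin n) →L[ℝ] ℝ)
    (cov.curvature x u (EuclideanSpace.single i (1 : ℝ) : EuclideanSpace ℝ (Fin n)) v)

/-- The tensor `Q = r₊ / (n - 1) + r₋ / (n + 1)`, with `r₊` and `r₋` the symmetric and the skew part
of the Ricci contraction. -/
def schouten (x : M) (u v : TangentSpace (𝓡 n) x) : ℝ :=
  1 / ((n : ℝ) - 1) * ((cov.ricci x u v + cov.ricci x v u) / 2) +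
    1 / ((n : ℝ) + 1) * ((cov.ricci x u v - cov.ricci x v u) / 2)

/-- The endomorphism `[u, α] : w ↦ α(u) w + α(w) u`, for a tangent vector `u` and a covector `α`. -/
def bracket {x : M} (u : TangentSpace (𝓡 n) x) (α : TangentSpace (𝓡 n) x → ℝ)
    (w : TangentSpace (𝓡 n) x) : TangentSpace (𝓡 n) x :=
  α u • w + α w • u

/-- The curvature-type tensor `[Q ∧ Id](u, v) = [Q(u), v] - [Q(v), u]`, where `[α, u] = -[u, α]`. -/
def wedgeId {x : M} (Q : TangentSpace (𝓡 n) x → TangentSpace (𝓡 n) x → ℝ)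
    (u v w : TangentSpace (𝓡 n) x) : TangentSpace (𝓡 n) x :=
  -bracket v (Q u) w + bracket u (Q v) w

/-- The Weyl curvature `W = R + [Q ∧ Id]`, that is `W = R + [r₊ ∧ Id] / (n - 1) + [r₋ ∧ Id] / (n + 1)`:
the component of `R` in the kernel of the Ricci contraction. -/
def weyl (x : M) (u v w : TangentSpace (𝓡 n) x) : TangentSpace (𝓡 n) x :=
  cov.curvature x u v w + wedgeId (cov.schouten x) u v w

/-- The covariant exterior derivative of `Q`, seen as a `T*M`-valued `1`-form:
`(d^∇ Q)(X, Y) = ∇_X (Q(Y)) - ∇_Y (Q(X)) - Q([X, Y])`, evaluated on `Z`. -/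
def dSchoutenField (X Y Z : Π x : M, TangentSpace (𝓡 n) x) (x : M) : ℝ :=
  (mvfderiv (𝓡 n) (fun y ↦ cov.schouten y (Y y) (Z y)) x (X x)
      - cov.schouten x (Y x) (cov.along X Z x)) -
    (mvfderiv (𝓡 n) (fun y ↦ cov.schouten y (X y) (Z y)) x (Y x)
      - cov.schouten x (X x) (cov.along Y Z x)) -
    cov.schouten x (VectorField.mlieBracket (𝓡 n) X Y x) (Z x)

/-- The tensor `C = d^∇ Q` at the point `x`. -/
def cottonYork (x : M) (u v w : TangentSpace (𝓡 n) x) : ℝ :=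
  cov.dSchoutenField (FiberBundle.extend (EuclideanSpace ℝ (Fin n)) u)
    (FiberBundle.extend (EuclideanSpace ℝ (Fin n)) v)
    (FiberBundle.extend (EuclideanSpace ℝ (Fin n)) w) x

/-- `∇'` is in the projective class of `∇`: there is a smooth `1`-form `α` on `M` such that
`∇'_X Y = ∇_X Y + α(X) Y + α(Y) X`. -/
def ProjectivelyEquivalent (cov cov' : AffineConnection n M) : Prop :=
  ∃ α : Π x : M, TangentSpace (𝓡 n) x →L[ℝ] ℝ,
    ContMDiff (𝓡 n) ((𝓡 n).prod 𝓘(ℝ, EuclideanSpace ℝ (Fin n) →L[ℝ] ℝ)) ∞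
      (fun x : M ↦ TotalSpace.mk' (EuclideanSpace ℝ (Fin n) →L[ℝ] ℝ)
        (E := fun x ↦ TangentSpace (𝓡 n) x →L[ℝ] ℝ) x (α x)) ∧
    ∀ (Y : Π x : M, TangentSpace (𝓡 n) x) (x : M),
      MDifferentiableAt (𝓡 n) ((𝓡 n).prod 𝓘(ℝ, EuclideanSpace ℝ (Fin n)))
        (fun y ↦ TotalSpace.mk' (EuclideanSpace ℝ (Fin n)) y (Y y)) x →
      ∀ v : TangentSpace (𝓡 n) x, cov' Y x v = cov Y x v + bracket v (α x) (Y x)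

/-- `φ` carries `∇` to `∇'`: for every vector field `Y` on `N`, with pullback `φ^* Y`,
`dφ (∇_v (φ^* Y)) = ∇'_{dφ v} Y`. -/
def IsAffineOn {N : Type*} [TopologicalSpace N] [ChartedSpace (EuclideanSpace ℝ (Fin n)) N]
    [IsManifold (𝓡 n) ∞ N] (cov : AffineConnection n M) (cov' : AffineConnection n N)
    (φ : OpenPartialHomeomorph M N) : Prop :=
  ∀ (Y : Π y : N, TangentSpace (𝓡 n) y), ∀ x ∈ φ.source,
    MDifferentiableAt (𝓡 n) ((𝓡 n).prod 𝓘(ℝ, EuclideanSpace ℝ (Fin n)))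
      (fun y ↦ TotalSpace.mk' (EuclideanSpace ℝ (Fin n)) y (Y y)) (φ x) →
    ∀ v : TangentSpace (𝓡 n) x,
      mfderiv (𝓡 n) (𝓡 n) φ x (cov (VectorField.mpullback (𝓡 n) (𝓡 n) φ Y) x v) =
        cov' Y (φ x) (mfderiv (𝓡 n) (𝓡 n) φ x v)

/-- `∇` is the Levi-Civita connection of a Riemannian manifold: torsion-free and metric. -/
def IsLeviCivita [RiemannianBundle (fun x : M ↦ TangentSpace (𝓡 n) x)]
    [IsContMDiffRiemannianBundle (𝓡 n) 1 (EuclideanSpace ℝ (Fin n))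
      (fun x : M ↦ TangentSpace (𝓡 n) x)] (cov : AffineConnection n M) : Prop :=
  cov.torsion = 0 ∧ CovariantDerivative.IsMetricCompatible cov

end AffineConnection

/-- The Riemannian structure of `ℝPⁿ` given by the Fubini-Study metric. -/
instance RealProjectiveSpace.instRiemannianBundle (n : ℕ) :
    RiemannianBundle (fun p : RealProjectiveSpace n ↦ TangentSpace (𝓡 n) p) :=
  ⟨(RealProjectiveSpace.fubiniStudyMetric n).toRiemannianMetric⟩

instance RealProjectiveSpace.instIsContMDiffRiemannianBundle (n : ℕ) :
    IsContMDiffRiemannianBundle (𝓡 n) 1 (EuclideanSpace ℝ (Fin n))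
      (fun p : RealProjectiveSpace n ↦ TangentSpace (𝓡 n) p) :=
  inferInstance

end

/-!
The proof is a local argument about a flat linear system, followed by a translation between
manifolds and coordinates.

**Coordinates.** On an open subset of `ℝⁿ` a torsion-free connection is `D + Γ` with `Γ` symmetric.
Let `τ = Tr Γ / (n + 1)`, and consider pairs `(s, m)` of a density `s` and a covector-valued density
`m`, subject to the linear system `∇s = m`, `∇m = Q s`, in which `∇` acts on densities through `τ`.
This is the projective tractor connection `tractorConnection`. If `W = 0`, then its curvature is
`(s, m) ↦ (0, C s)` (`linearCurvature_tractorConnection`); the weight of the densities is chosen such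
that the skew part of `Q` cancels against `dτ` (`localSchouten_skew`). So it is flat if `W = 0` and
`C = 0`. For `n ≥ 3` the condition `C = 0` follows from `W = 0`: the Bianchi identity
`linearCurvature_bianchi`, applied to a section `(0, m)`, gives `C(a, b) m(c) = 0` whenever
`m(a) = m(b) = 0`, and such an `m` need not vanish at `c` (`localCotton_eq_zero`). For `n = 2` the
tensor `W` vanishes for algebraic reasons (`localWeyl_eq_zero_of_two`).

A flat linear system `dF = A F` has local solutions with arbitrary initial values
(`exists_solution_of_linearCurvature_eq_zero`): the solution is obtained by parallel transport along
the rays from a point, and flatness makes it parallel in all directions. Take a density `f` and an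
`n`-tuple `s` of densities which solve the tractor system, with initial values `f = 1`, `Df = -τ`,
`s = 0`, `Ds = id`. All of them satisfy the same second order equation, and the quotient `ψ = s / f`
therefore satisfies `D²ψ(v, w) = Dψ(Γ(v, w)) - β(v) Dψ(w) - β(w) Dψ(v)` with a `1`-form `β`. In the
coordinates `ψ` the Christoffel symbols are thus of the form `(v, w) ↦ β(v) w + β(w) v`: the
connection is projectively equivalent to the flat one (`exists_projective_coordinates`).

**Charts.** The predicate `HasChristoffelAt` expresses a connection on a manifold through its
Christoffel symbols in a chart. In these terms the invariantly defined tensors become the ones above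
(`chartDeriv_weyl`, `cottonYork_eq_localCotton`), and `HasChristoffelAt.change` describes a change of
coordinates. This gives `exists_projectivelyFlat_chart`.

**Projective space.** Let `s` be the affine section of `ℝⁿ⁺¹ ∖ {0} → ℝPⁿ` over an affine chart. The
connection with Christoffel symbols `α₀(v) w + α₀(w) v`, where `α₀ = -⟨s, ds⟩ / |s|²`, is torsion-free
and preserves the Fubini-Study metric (`fderiv_localFubiniStudy`), and these local connections agree
because transition maps are projective (`fderiv_fderiv_transition`, `fubiniStudyOneForm_transition`).
So this is the Levi-Civita connection, and affine charts are projectively flat for it.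

**Conclusion.** Compose a projectively flat chart of `M` with the inverse of an affine chart of `ℝPⁿ`.
The given connection is carried to the Levi-Civita connection changed by `α = β - α₀`, and near the
point this `1`-form is the restriction of a global one (`exists_contMDiff_oneForm_eq`).
-/

noncomputable section

set_option maxSynthPendingDepth 3

local notation:max "𝔼" k:max => EuclideanSpace ℝ (Fin k)

/-! ### Flat linear systems -/

section Frobenius

variable {E V : Type*} [NormedAddCommGroup E] [NormedSpace ℝ E]
  [NormedAddCommGroup V] [NormedSpace ℝ V]

/-- A crude form of Grönwall's inequality on `[0, 1]`, with growth constant `1`. -/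
lemma norm_le_of_norm_deriv_le {f f' : ℝ → V} {δ ε : ℝ} (hδ : 0 ≤ δ) (hε : 0 ≤ ε)
    (hf : ∀ t ∈ Set.Icc (0 : ℝ) 1, HasDerivWithinAt f (f' t) (Set.Icc 0 1) t)
    (h0 : ‖f 0‖ ≤ δ) (hf' : ∀ t ∈ Set.Icc (0 : ℝ) 1, ‖f' t‖ ≤ ‖f t‖ + ε) :
    ∀ t ∈ Set.Icc (0 : ℝ) 1, ‖f t‖ ≤ 3 * (δ + ε) := by
  intro t ht
  have h := norm_le_gronwallBound_of_norm_deriv_right_le (f := f) (f' := f') (K := 1) (ε := ε)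
    (fun s hs ↦ (hf s hs).continuousWithinAt)
    (fun s hs ↦ (hf s ⟨hs.1, hs.2.le⟩).mono_of_mem_nhdsWithin (Icc_mem_nhdsGE_of_mem hs)) h0
    (fun s hs ↦ by simpa using hf' s ⟨hs.1, hs.2.le⟩) t ht
  rw [gronwallBound_of_K_ne_0 one_ne_zero] at h
  have h1 : Real.exp (1 * (t - 0)) ≤ 3 := by
    refine (Real.exp_le_exp.2 (by linarith [ht.2])).trans
      (Real.exp_one_lt_d9.le.trans (by norm_num))
  have h2 := mul_le_mul_of_nonneg_left h1 hδ
  have h3 := mul_le_mul_of_nonneg_left h1 hε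
  simp only [div_one] at h
  nlinarith

/-- Parallel transport from `x₀` along the rays of a ball, for the linear system `dF = A F`. -/
lemma exists_radial_solution [CompleteSpace V] {A : E → E →L[ℝ] V →L[ℝ] V} {x₀ : E} {r C : ℝ}
    (p : V) (hr : 0 < r) (hA : ContinuousOn A (Metric.ball x₀ r))
    (hC : ∀ x ∈ Metric.ball x₀ r, ‖A x‖ ≤ C) (hCr : C * r * (‖p‖ + 1) ≤ 1) :
    ∃ F : E → V, F x₀ = p ∧ ∀ h : E, ‖h‖ < r → ∀ t ∈ Set.Icc (0 : ℝ) 1,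
      HasDerivWithinAt (fun s : ℝ ↦ F (x₀ + s • h)) (A (x₀ + t • h) h (F (x₀ + t • h)))
        (Set.Icc 0 1) t := by
  have hC0 : 0 ≤ C := (norm_nonneg _).trans (hC x₀ (Metric.mem_ball_self hr))
  have hmem (h : E) (hh : ‖h‖ < r) (t : ℝ) (ht : t ∈ Set.Icc (0 : ℝ) 1) :
      x₀ + t • h ∈ Metric.ball x₀ r := by
    rw [Metric.mem_ball, dist_eq_norm, add_sub_cancel_left, norm_smul, Real.norm_eq_abs,
      abs_of_nonneg ht.1]
    exact (mul_le_of_le_one_left (norm_nonneg _) ht.2).trans_lt hh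
  have hbd (h : E) (hh : ‖h‖ < r) (t : ℝ) (ht : t ∈ Set.Icc (0 : ℝ) 1) :
      ‖A (x₀ + t • h) h‖ ≤ C * r :=
    (ContinuousLinearMap.le_opNorm _ _).trans
      (mul_le_mul (hC _ (hmem h hh t ht)) hh.le (norm_nonneg _) hC0)
  have key (h : E) (hh : ‖h‖ < r) : ∃ y : ℝ → V, y 0 = p ∧ ∀ t ∈ Set.Icc (0 : ℝ) 1,
      HasDerivWithinAt y (A (x₀ + t • h) h (y t)) (Set.Icc 0 1) t := by
    have hCr0 : 0 ≤ C * r := by positivity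
    have hPL : IsPicardLindelof (fun t y ↦ A (x₀ + t • h) h y) (tmin := 0) (tmax := 1)
        ⟨0, by simp⟩ p 1 0 1 ⟨C * r, hCr0⟩ := by
      constructor
      · intro t ht
        refine LipschitzWith.lipschitzOnWith ?_
        exact (A (x₀ + t • h) h).lipschitz.weaken (hbd h hh t ht)
      · intro y _
        have h1 : ContinuousOn (fun t : ℝ ↦ A (x₀ + t • h)) (Set.Icc 0 1) :=
          hA.comp (by fun_prop) (fun t ht ↦ hmem h hh t ht)
        exact (h1.clm_apply continuousOn_const).clm_apply continuousOn_const
      · intro t ht y hy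
        have hy' : ‖y‖ ≤ ‖p‖ + 1 := by
          have h2 : ‖y - p‖ ≤ 1 := by simpa [dist_eq_norm] using hy
          have h3 := norm_add_le p (y - p)
          rw [add_sub_cancel] at h3
          linarith
        refine (ContinuousLinearMap.le_opNorm _ _).trans ?_
        refine (mul_le_mul (hbd h hh t ht) hy' (norm_nonneg _) hCr0).trans ?_
        simpa using hCr
      · simp
    exact hPL.exists_eq_forall_mem_Icc_hasDerivWithinAt₀
  choose! y hy0 hy using key
  refine ⟨fun x ↦ y (x - x₀) 1, ?_, ?_⟩
  · -- for `h = 0` the solution is constant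
    have h0 : ‖(0 : E)‖ < r := by simpa using hr
    have h1 := constant_of_has_deriv_right_zero (f := y 0) (a := 0) (b := 1)
      (fun t ht ↦ (hy 0 h0 t ht).continuousWithinAt)
      (fun t ht ↦ by
        have := (hy 0 h0 t ⟨ht.1, ht.2.le⟩).mono_of_mem_nhdsWithin (Icc_mem_nhdsGE_of_mem ht)
        simpa using this)
    simpa [hy0 0 h0] using h1 1 (by simp)
  · -- rescaling the time: the solutions in the directions `s • h` and `h` agree
    have hres (h : E) (hh : ‖h‖ < r) (s : ℝ) (hs : s ∈ Set.Icc (0 : ℝ) 1) : y (s • h) 1 = y h s := by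
      have hsh : ‖s • h‖ < r := by
        simpa [dist_eq_norm] using hmem h hh s hs
      have h2 : Set.EqOn (y (s • h)) (fun t ↦ y h (s * t)) (Set.Icc 0 1) := by
        have hmaps : ∀ t ∈ Set.Icc (0 : ℝ) 1, s * t ∈ Set.Icc (0 : ℝ) 1 := fun t ht ↦
          ⟨mul_nonneg hs.1 ht.1, mul_le_one₀ hs.2 ht.1 ht.2⟩
        have hd : ∀ t ∈ Set.Icc (0 : ℝ) 1, HasDerivWithinAt (fun t ↦ y h (s * t))
            (A (x₀ + t • s • h) (s • h) (y h (s * t))) (Set.Icc 0 1) t := by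
          intro t ht
          have := (hy h hh (s * t) (hmaps t ht)).scomp t
            (((hasDerivAt_id t).const_mul s).hasDerivWithinAt (s := Set.Icc 0 1)) hmaps
          refine this.congr_deriv ?_
          simp [smul_smul, mul_comm s t]
        refine ODE_solution_unique_of_mem_Icc_right (s := fun _ ↦ Set.univ)
          (v := fun t y ↦ A (x₀ + t • s • h) (s • h) y) (K := ⟨C * r, by positivity⟩)
          ?_ ?_ ?_ ?_ ?_ ?_ ?_ ?_
        · intro t ht
          exact ((A (x₀ + t • s • h) (s • h)).lipschitz.weaken
            (hbd _ hsh t ⟨ht.1, ht.2.le⟩)).lipschitzOnWith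
        · exact fun t ht ↦ (hy _ hsh t ht).continuousWithinAt
        · exact fun t ht ↦ (hy _ hsh t ⟨ht.1, ht.2.le⟩).mono_of_mem_nhdsWithin
            (Icc_mem_nhdsGE_of_mem ht)
        · simp
        · exact fun t ht ↦ (hd t ht).continuousWithinAt
        · exact fun t ht ↦ (hd t ⟨ht.1, ht.2.le⟩).mono_of_mem_nhdsWithin
            (Icc_mem_nhdsGE_of_mem ht)
        · simp
        · simp [hy0 _ hsh, hy0 _ hh]
      simpa using h2 (Set.right_mem_Icc.2 zero_le_one)
    intro h hh t ht
    have h3 := hy h hh t ht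
    simp only [add_sub_cancel_left]
    rw [hres h hh t ht]
    exact h3.congr (fun s hs ↦ hres h hh s hs) (hres h hh t ht)

set_option maxHeartbeats 1000000 in
/-- The function `F`, parallel along the rays from `x₀`, solves `dF = A F` if the connection `d - A` is flat. The error
`G t = F (x₀ + t (h + k)) - F (x₀ + t h) - t A (x₀ + t h) k F (x₀ + t h)` satisfies, by flatness, a
linear differential equation along the ray up to terms of order `‖k‖²`, so it is of that order. -/
lemma hasFDerivAt_of_radial {A : E → E →L[ℝ] V →L[ℝ] V} {A' : E → E →L[ℝ] E →L[ℝ] V →L[ℝ] V}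
    {F : E → V} {x₀ : E} {r C : ℝ} (hr : 0 < r)
    (hA : ∀ x ∈ Metric.ball x₀ r, HasFDerivAt A (A' x) x)
    (hC : ∀ x ∈ Metric.ball x₀ r, ‖A x‖ ≤ C) (hC' : ∀ x ∈ Metric.ball x₀ r, ‖A' x‖ ≤ C)
    (hC'' : ∀ x ∈ Metric.ball x₀ r, ∀ y ∈ Metric.ball x₀ r, ‖A' y - A' x‖ ≤ C * ‖y - x‖)
    (hCr : C * r ≤ 1)
    (hflat : ∀ x ∈ Metric.ball x₀ r, ∀ a b p,
      A' x a b p - A' x b a p + A x b (A x a p) - A x a (A x b p) = 0)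
    (hF : ∀ h : E, ‖h‖ < r → ∀ t ∈ Set.Icc (0 : ℝ) 1,
      HasDerivWithinAt (fun s : ℝ ↦ F (x₀ + s • h)) (A (x₀ + t • h) h (F (x₀ + t • h)))
        (Set.Icc 0 1) t) :
    ∀ x ∈ Metric.ball x₀ r, HasFDerivAt F ((A x).flip (F x)) x := by
  have hC0 : 0 ≤ C := (norm_nonneg _).trans (hC x₀ (Metric.mem_ball_self hr))
  have hmem (h : E) (hh : ‖h‖ < r) (t : ℝ) (ht : t ∈ Set.Icc (0 : ℝ) 1) :
      x₀ + t • h ∈ Metric.ball x₀ r := by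
    rw [Metric.mem_ball, dist_eq_norm, add_sub_cancel_left, norm_smul, Real.norm_eq_abs,
      abs_of_nonneg ht.1]
    exact (mul_le_of_le_one_left (norm_nonneg _) ht.2).trans_lt hh
  have hbd (h : E) (hh : ‖h‖ < r) (t : ℝ) (ht : t ∈ Set.Icc (0 : ℝ) 1) (p : V) :
      ‖A (x₀ + t • h) h p‖ ≤ ‖p‖ := by
    refine (ContinuousLinearMap.le_opNorm₂ _ _ _).trans
      (mul_le_of_le_one_left (norm_nonneg _) ?_)
    exact (mul_le_mul (hC _ (hmem h hh t ht)) hh.le (norm_nonneg _) hC0).trans hCr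
  set M : ℝ := 3 * ‖F x₀‖ with hM
  have hM0 : 0 ≤ M := by positivity
  have hFM (h : E) (hh : ‖h‖ < r) (t : ℝ) (ht : t ∈ Set.Icc (0 : ℝ) 1) :
      ‖F (x₀ + t • h)‖ ≤ M := by
    have := norm_le_of_norm_deriv_le (norm_nonneg (F x₀)) le_rfl (hF h hh) (by simp)
      (fun t ht ↦ by simpa using hbd h hh t ht _) t ht
    simpa [hM] using this
  -- Lipschitz and second order Taylor estimates for `A`
  have hLip : ∀ x ∈ Metric.ball x₀ r, ∀ y ∈ Metric.ball x₀ r, ‖A y - A x‖ ≤ C * ‖y - x‖ :=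
    fun x hx y hy ↦ Convex.norm_image_sub_le_of_norm_hasFDerivWithin_le
      (fun z hz ↦ (hA z hz).hasFDerivWithinAt) hC' (convex_ball x₀ r) hx hy
  have hTay : ∀ x ∈ Metric.ball x₀ r, ∀ y ∈ Metric.ball x₀ r,
      ‖A y - A x - A' x (y - x)‖ ≤ C * ‖y - x‖ * ‖y - x‖ := by
    intro x hx y hy
    have h1 := Convex.norm_image_sub_le_of_norm_hasFDerivWithin_le
      (f := fun z ↦ A z - A' x z) (f' := fun z ↦ A' z - A' x) (C := C * ‖y - x‖)
      (s := segment ℝ x y)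
      (fun z hz ↦ ((hA z ((convex_ball x₀ r).segment_subset hx hy hz)).sub
        (A' x).hasFDerivAt).hasFDerivWithinAt)
      (fun z hz ↦ by
        refine (hC'' x hx z ((convex_ball x₀ r).segment_subset hx hy hz)).trans ?_
        exact mul_le_mul_of_nonneg_left (norm_sub_le_of_mem_segment hz) hC0)
      (convex_segment x y) (left_mem_segment ℝ x y) (right_mem_segment ℝ x y)
    refine le_trans (le_of_eq ?_) h1
    congr 1
    rw [map_sub]
    abel
  intro x hx
  obtain ⟨h, rfl⟩ : ∃ h, x = x₀ + h := ⟨x - x₀, by abel⟩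
  have hh : ‖h‖ < r := by simpa [dist_eq_norm] using hx
  -- `K ‖k‖` bounds `F (x₀ + t (h + k)) - F (x₀ + t h)`, and `K' ‖k‖²` bounds the error `G`
  set K : ℝ := 3 * ((C + 1) * M) with hK
  set K' : ℝ := 3 * (M + K + C * M + C * K) with hK'
  have main (k : E) (hk : ‖h + k‖ < r) :
      ‖F (x₀ + h + k) - F (x₀ + h) - A (x₀ + h) k (F (x₀ + h))‖ ≤ K' * (‖k‖ * ‖k‖) := by
    have hz (t : ℝ) : x₀ + t • (h + k) - (x₀ + t • h) = t • k := by rw [smul_add]; abel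
    have htk (t : ℝ) (ht : t ∈ Set.Icc (0 : ℝ) 1) : ‖t • k‖ ≤ ‖k‖ := by
      rw [norm_smul, Real.norm_eq_abs, abs_of_nonneg ht.1]
      exact mul_le_of_le_one_left (norm_nonneg _) ht.2
    have hCh : C * ‖h‖ ≤ 1 := (mul_le_mul_of_nonneg_left hh.le hC0).trans hCr
    have hAdiff (t : ℝ) (ht : t ∈ Set.Icc (0 : ℝ) 1) :
        ‖A (x₀ + t • (h + k)) - A (x₀ + t • h)‖ ≤ C * ‖k‖ := by
      refine (hLip _ (hmem h hh t ht) _ (hmem _ hk t ht)).trans ?_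
      rw [hz]
      exact mul_le_mul_of_nonneg_left (htk t ht) hC0
    have hH (t : ℝ) (ht : t ∈ Set.Icc (0 : ℝ) 1) :
        ‖F (x₀ + t • (h + k)) - F (x₀ + t • h)‖ ≤ K * ‖k‖ := by
      have := norm_le_of_norm_deriv_le (δ := 0) (ε := (C + 1) * M * ‖k‖) le_rfl (by positivity)
        (fun t ht ↦ (hF (h + k) hk t ht).sub (hF h hh t ht)) (by simp) (fun t ht ↦ ?_) t ht
      · refine this.trans (le_of_eq ?_)
        rw [hK]; ring
      · simp only [Pi.sub_apply]
        set F₁ := F (x₀ + t • h)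
        set F₂ := F (x₀ + t • (h + k))
        have e : A (x₀ + t • (h + k)) (h + k) F₂ - A (x₀ + t • h) h F₁ =
            A (x₀ + t • h) h (F₂ - F₁) + (A (x₀ + t • (h + k)) k F₂ +
              (A (x₀ + t • (h + k)) - A (x₀ + t • h)) h F₂) := by
          simp only [map_add, map_sub, add_apply, sub_apply]
          abel
        rw [e]
        refine (norm_add_le _ _).trans (add_le_add (hbd h hh t ht _) ((norm_add_le _ _).trans ?_))
        have b1 : ‖A (x₀ + t • (h + k)) k F₂‖ ≤ C * ‖k‖ * M :=
          (ContinuousLinearMap.le_opNorm₂ _ _ _).trans (mul_le_mul (mul_le_mul_of_nonneg_right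
            (hC _ (hmem _ hk t ht)) (norm_nonneg _)) (hFM _ hk t ht) (norm_nonneg _)
            (by positivity))
        have b2 : ‖(A (x₀ + t • (h + k)) - A (x₀ + t • h)) h F₂‖ ≤ C * ‖k‖ * ‖h‖ * M :=
          (ContinuousLinearMap.le_opNorm₂ _ _ _).trans (mul_le_mul (mul_le_mul_of_nonneg_right
            (hAdiff t ht) (norm_nonneg _)) (hFM _ hk t ht) (norm_nonneg _)
            (by positivity))
        have b3 : C * ‖h‖ * (‖k‖ * M) ≤ 1 * (‖k‖ * M) :=
          mul_le_mul_of_nonneg_right hCh (by positivity)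
        linarith
    -- the derivative of the error `G`
    have hG : ∀ t ∈ Set.Icc (0 : ℝ) 1, HasDerivWithinAt
        (fun t : ℝ ↦ F (x₀ + t • (h + k)) - F (x₀ + t • h) - t • A (x₀ + t • h) k (F (x₀ + t • h)))
        (A (x₀ + t • (h + k)) (h + k) (F (x₀ + t • (h + k)))
          - A (x₀ + t • h) h (F (x₀ + t • h))
          - (t • (A' (x₀ + t • h) h k (F (x₀ + t • h)) +
              A (x₀ + t • h) k (A (x₀ + t • h) h (F (x₀ + t • h)))) +
            A (x₀ + t • h) k (F (x₀ + t • h)))) (Set.Icc 0 1) t := by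
      intro t ht
      have d1 : HasDerivAt (fun t : ℝ ↦ x₀ + t • h) h t := by
        simpa using ((hasDerivAt_id t).smul_const h).const_add x₀
      have d2 : HasDerivAt (fun t : ℝ ↦ A (x₀ + t • h) k) (A' (x₀ + t • h) h k) t :=
        ((hA _ (hmem h hh t ht)).comp_hasDerivAt t d1).clm_apply (hasDerivAt_const t k) |>.congr_deriv
          (by simp)
      have d3 := d2.hasDerivWithinAt.clm_apply (hF h hh t ht)
      have d4 := (hasDerivAt_id t).hasDerivWithinAt.smul d3
      exact (((hF (h + k) hk t ht).sub (hF h hh t ht)).sub d4).congr_deriv (by simp)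
    have hfin := norm_le_of_norm_deriv_le (δ := 0)
      (ε := (M + K + C * M + C * K) * (‖k‖ * ‖k‖)) le_rfl (by positivity) hG (by simp)
      (fun t ht ↦ ?_) 1 (by simp)
    · simp only [one_smul, zero_add, ← mul_assoc] at hfin
      rw [add_assoc x₀ h k]
      refine hfin.trans (le_of_eq ?_)
      rw [hK']; ring
    · set F₁ := F (x₀ + t • h)
      set F₂ := F (x₀ + t • (h + k))
      set z := x₀ + t • h
      set z' := x₀ + t • (h + k)
      have hfl := hflat z (hmem h hh t ht) h k F₁
      have e : A z' (h + k) F₂ - A z h F₁ - (t • (A' z h k F₁ + A z k (A z h F₁)) + A z k F₁) =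
          A z h (F₂ - F₁ - t • A z k F₁) + ((A z' - A z - A' z (z' - z)) h F₂ +
            (A' z (z' - z) h (F₂ - F₁) + ((A z' - A z) k F₂ + A z k (F₂ - F₁)))) := by
        -- flatness exchanges `h` and `k` here
        have e1 : A' z h k F₁ + A z k (A z h F₁) = A' z k h F₁ + A z h (A z k F₁) := by
          rw [← sub_eq_zero, ← hfl]; abel
        rw [e1, hz]
        simp only [map_add, map_sub, map_smul, add_apply, sub_apply, smul_apply, smul_add]
        abel
      rw [e]
      refine (norm_add_le _ _).trans (add_le_add (hbd h hh t ht _) ?_)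
      have hzz : ‖z' - z‖ ≤ ‖k‖ := by rw [hz]; exact htk t ht
      have b1 : ‖(A z' - A z - A' z (z' - z)) h F₂‖ ≤ C * ‖k‖ * ‖k‖ * ‖h‖ * M := by
        refine (ContinuousLinearMap.le_opNorm₂ _ _ _).trans (mul_le_mul (mul_le_mul_of_nonneg_right
            ((hTay z (hmem h hh t ht) z' (hmem _ hk t ht)).trans ?_) (norm_nonneg _))
            (hFM _ hk t ht) (norm_nonneg _) (by positivity))
        gcongr
      have b2 : ‖A' z (z' - z) h (F₂ - F₁)‖ ≤ C * ‖k‖ * ‖h‖ * (K * ‖k‖) := by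
        refine (ContinuousLinearMap.le_opNorm₂ _ _ _).trans (mul_le_mul (mul_le_mul_of_nonneg_right
            ((ContinuousLinearMap.le_opNorm _ _).trans ?_) (norm_nonneg _))
            (hH t ht) (norm_nonneg _) (by positivity))
        exact mul_le_mul (hC' z (hmem h hh t ht)) hzz (norm_nonneg _) hC0
      have b3 : ‖(A z' - A z) k F₂‖ ≤ C * ‖k‖ * ‖k‖ * M :=
        (ContinuousLinearMap.le_opNorm₂ _ _ _).trans (mul_le_mul (mul_le_mul_of_nonneg_right
            (hAdiff t ht) (norm_nonneg _)) (hFM _ hk t ht) (norm_nonneg _)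
            (by positivity))
      have b4 : ‖A z k (F₂ - F₁)‖ ≤ C * ‖k‖ * (K * ‖k‖) :=
        (ContinuousLinearMap.le_opNorm₂ _ _ _).trans (mul_le_mul (mul_le_mul_of_nonneg_right
            (hC z (hmem h hh t ht)) (norm_nonneg _)) (hH t ht) (norm_nonneg _)
            (by positivity))
      have b5 : C * ‖h‖ * (‖k‖ * ‖k‖ * M) ≤ 1 * (‖k‖ * ‖k‖ * M) :=
        mul_le_mul_of_nonneg_right hCh (by positivity)
      have b6 : C * ‖h‖ * (‖k‖ * (K * ‖k‖)) ≤ 1 * (‖k‖ * (K * ‖k‖)) :=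
        mul_le_mul_of_nonneg_right hCh (by positivity)
      refine (norm_add_le _ _).trans ?_
      refine (add_le_add_right ((norm_add_le _ _).trans
        (add_le_add_right (norm_add_le _ _) _)) _).trans ?_
      linarith
  rw [hasFDerivAt_iff_isLittleO_nhds_zero]
  have hO : (fun k ↦ F (x₀ + h + k) - F (x₀ + h) - (A (x₀ + h)).flip (F (x₀ + h)) k)
      =O[𝓝 0] fun k : E ↦ ‖k‖ * ‖k‖ := by
    refine Asymptotics.IsBigO.of_bound K' ?_
    have : ∀ᶠ k : E in 𝓝 0, ‖h + k‖ < r :=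
      (continuous_const.add continuous_id).norm.continuousAt.eventually_lt continuousAt_const
        (by simpa using hh)
    filter_upwards [this] with k hk
    simpa using main k hk
  refine hO.trans_isLittleO ?_
  have h2 : (fun k : E ↦ ‖k‖ * ‖k‖) =o[𝓝 0] fun k : E ↦ (1 : ℝ) * ‖k‖ := by
    refine Asymptotics.IsLittleO.mul_isBigO ?_ (Asymptotics.isBigO_refl _ _)
    rw [Asymptotics.isLittleO_one_iff]
    exact (continuous_norm.tendsto' (0 : E) 0 norm_zero)
  simp only [one_mul] at h2
  exact Asymptotics.isLittleO_norm_right.1 h2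

/-- The curvature of the connection `d - A` on a trivial vector bundle, with the sign for which it is
the obstruction to the symmetry of the second derivatives of the solutions of `dF = A F`. -/
def linearCurvature (A : E → E →L[ℝ] V →L[ℝ] V) (x a b : E) : V →L[ℝ] V :=
  fderiv ℝ A x a b - fderiv ℝ A x b a + A x b * A x a - A x a * A x b

/-- A flat linear system `dF = A F` has, near each point, a smooth solution with any given initial
value. -/
theorem exists_solution_of_linearCurvature_eq_zero [CompleteSpace V]
    {A : E → E →L[ℝ] V →L[ℝ] V} {Ω : Set E} (hΩ : IsOpen Ω) (hA : ContDiffOn ℝ ∞ A Ω)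
    (hflat : ∀ x ∈ Ω, ∀ a b, linearCurvature A x a b = 0) {x₀ : E} (hx₀ : x₀ ∈ Ω) (p : V) :
    ∃ F : E → V, ∃ U : Set E, IsOpen U ∧ x₀ ∈ U ∧ U ⊆ Ω ∧ F x₀ = p ∧ ContDiffOn ℝ ∞ F U ∧
      ∀ x ∈ U, HasFDerivAt F ((A x).flip (F x)) x := by
  have hAx : ContDiffAt ℝ ∞ A x₀ := hA.contDiffAt (hΩ.mem_nhds hx₀)
  have hA'x : ContDiffAt ℝ ∞ (fderiv ℝ A) x₀ := hAx.fderiv_right (m := ∞) (by simp)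
  obtain ⟨K, t, ht, hK⟩ := (hA'x.of_le (by exact_mod_cast le_top :
    (1 : WithTop ℕ∞) ≤ ∞)).exists_lipschitzOnWith
  set C : ℝ := max (max (‖A x₀‖ + 1) (‖fderiv ℝ A x₀‖ + 1)) K with hCdef
  have hC0 : 0 < C := lt_of_lt_of_le (by positivity : 0 < ‖A x₀‖ + 1)
    ((le_max_left _ _).trans (le_max_left _ _))
  have e1 : ∀ᶠ x in 𝓝 x₀, ‖A x‖ < ‖A x₀‖ + 1 :=
    hAx.continuousAt.norm.eventually_lt continuousAt_const (by simp)
  have e2 : ∀ᶠ x in 𝓝 x₀, ‖fderiv ℝ A x‖ < ‖fderiv ℝ A x₀‖ + 1 :=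
    hA'x.continuousAt.norm.eventually_lt continuousAt_const (by simp)
  obtain ⟨r₁, hr₁, hball⟩ := Metric.eventually_nhds_iff_ball.1
    (((e1.and e2).and ht).and (hΩ.mem_nhds hx₀))
  -- the radius for which the Picard-Lindelöf theorem applies up to time one along every ray
  set r := min r₁ (C * (‖p‖ + 1))⁻¹ with hr
  have hr0 : 0 < r := lt_min hr₁ (by positivity)
  have hsub : ∀ x ∈ Metric.ball x₀ r, x ∈ Metric.ball x₀ r₁ := fun x hx ↦
    Metric.ball_subset_ball (min_le_left _ _) hx
  have hCr : C * r * (‖p‖ + 1) ≤ 1 := by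
    have h1 : r * (C * (‖p‖ + 1)) ≤ (C * (‖p‖ + 1))⁻¹ * (C * (‖p‖ + 1)) :=
      mul_le_mul_of_nonneg_right (min_le_right _ _) (by positivity)
    rw [inv_mul_cancel₀ (by positivity)] at h1
    linarith
  have hCr' : C * r ≤ 1 := by
    refine le_trans ?_ hCr
    exact le_mul_of_one_le_right (by positivity) (by linarith [norm_nonneg p])
  have hΩr : Metric.ball x₀ r ⊆ Ω := fun x hx ↦ (hball x (hsub x hx)).2
  have hbA : ∀ x ∈ Metric.ball x₀ r, ‖A x‖ ≤ C := fun x hx ↦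
    (hball x (hsub x hx)).1.1.1.le.trans ((le_max_left _ _).trans (le_max_left _ _))
  obtain ⟨F, hF0, hF⟩ := exists_radial_solution p hr0 (hA.continuousOn.mono hΩr) hbA hCr
  have hder : ∀ x ∈ Metric.ball x₀ r, HasFDerivAt F ((A x).flip (F x)) x := by
    refine hasFDerivAt_of_radial (A' := fderiv ℝ A) hr0 (fun x hx ↦ ?_) hbA (fun x hx ↦ ?_)
      (fun x hx y hy ↦ ?_) hCr' (fun x hx a b q ↦ ?_) hF
    · exact ((hA.contDiffAt (hΩ.mem_nhds (hΩr hx))).differentiableAt (by simp)).hasFDerivAt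
    · exact (hball x (hsub x hx)).1.1.2.le.trans ((le_max_right _ _).trans (le_max_left _ _))
    · have := hK.norm_sub_le (hball y (hsub y hy)).1.2 (hball x (hsub x hx)).1.2
      exact this.trans (mul_le_mul_of_nonneg_right (le_max_right _ _) (norm_nonneg _))
    · exact congrArg (fun L ↦ L q) (hflat x (hΩr hx) a b)
  refine ⟨F, Metric.ball x₀ r, Metric.isOpen_ball, Metric.mem_ball_self hr0, hΩr, hF0, ?_, hder⟩
  -- the equation `dF = A F` improves the regularity of `F` step by step
  rw [contDiffOn_infty]
  intro m
  induction m with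
  | zero =>
    exact contDiffOn_zero.2 fun x hx ↦ (hder x hx).continuousAt.continuousWithinAt
  | succ m ih =>
    push_cast
    rw [contDiffOn_succ_iff_fderiv_of_isOpen Metric.isOpen_ball]
    refine ⟨fun x hx ↦ (hder x hx).differentiableAt.differentiableWithinAt, by simp, ?_⟩
    have h1 : ContDiffOn ℝ m (fun x ↦ (A x).flip (F x)) (Metric.ball x₀ r) := by
      refine ContDiffOn.clm_apply ?_ ih
      have h2 : ContDiffOn ℝ m A (Metric.ball x₀ r) :=
        (hA.mono hΩr).of_le (by exact_mod_cast le_top)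
      exact (ContinuousLinearMap.flipₗᵢ ℝ E V V).toContinuousLinearEquiv.contDiff.comp_contDiffOn h2
    exact h1.congr fun x hx ↦ (hder x hx).fderiv

/-- The Bianchi identity for a connection on a trivial vector bundle. -/
theorem linearCurvature_bianchi {A : E → E →L[ℝ] V →L[ℝ] V} {x : E} (hA : ContDiffAt ℝ 2 A x)
    (a b c : E) :
    (fderiv ℝ (fun y ↦ linearCurvature A y a b) x c
        - (A x c * linearCurvature A x a b - linearCurvature A x a b * A x c)) +
      (fderiv ℝ (fun y ↦ linearCurvature A y b c) x a
        - (A x a * linearCurvature A x b c - linearCurvature A x b c * A x a)) +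
      (fderiv ℝ (fun y ↦ linearCurvature A y c a) x b
        - (A x b * linearCurvature A x c a - linearCurvature A x c a * A x b)) = 0 := by
  have hA1 : HasFDerivAt A (fderiv ℝ A x) x := (hA.differentiableAt (by simp)).hasFDerivAt
  have hA2 : HasFDerivAt (fderiv ℝ A) (fderiv ℝ (fderiv ℝ A) x) x :=
    ((hA.fderiv_right (m := 1) (by norm_num)).differentiableAt (by simp)).hasFDerivAt
  have hsymm : IsSymmSndFDerivAt ℝ A x := hA.isSymmSndFDerivAt (by simp)
  have d1 (a b : E) : HasFDerivAt (fun y ↦ fderiv ℝ A y a b)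
      ((fderiv ℝ (fderiv ℝ A) x).flip a |>.flip b) x :=
    ((hA2.clm_apply (hasFDerivAt_const a x)).clm_apply (hasFDerivAt_const b x)).congr_fderiv
      (by ext; simp)
  have d2 (a : E) : HasFDerivAt (fun y ↦ A y a) ((fderiv ℝ A x).flip a) x :=
    (hA1.clm_apply (hasFDerivAt_const a x)).congr_fderiv (by ext; simp)
  have d3 (a b c : E) : fderiv ℝ (fun y ↦ linearCurvature A y a b) x c =
      fderiv ℝ (fderiv ℝ A) x c a b - fderiv ℝ (fderiv ℝ A) x c b a +
        (A x b * fderiv ℝ A x c a + fderiv ℝ A x c b * A x a) -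
        (A x a * fderiv ℝ A x c b + fderiv ℝ A x c a * A x b) := by
    have h := (((d1 a b).sub (d1 b a)).add ((d2 b).mul' (d2 a))).sub ((d2 a).mul' (d2 b))
    have h' := h.fderiv
    have h'' := congrArg (fun L ↦ L c) h'
    refine Eq.trans ?_ (h''.trans ?_)
    · rfl
    · simp
  rw [d3, d3, d3, hsymm.eq c a, hsymm.eq a b, hsymm.eq b c]
  simp only [linearCurvature]
  noncomm_ring

end Frobenius

/-! ### Curvature of a connection in coordinates -/

variable {n : ℕ}


/-- The curvature of the connection `D + Γ` on an open subset of `ℝⁿ`. -/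
def localCurvature (Γ : 𝔼 n → 𝔼 n →L[ℝ] 𝔼 n →L[ℝ] 𝔼 n) (x : 𝔼 n) :
    𝔼 n →L[ℝ] 𝔼 n →L[ℝ] 𝔼 n →L[ℝ] 𝔼 n :=
  fderiv ℝ Γ x - (fderiv ℝ Γ x).flip +
    (ContinuousLinearMap.compL ℝ 𝔼 n 𝔼 n 𝔼 n).bilinearComp (Γ x) (Γ x) -
    ((ContinuousLinearMap.compL ℝ 𝔼 n 𝔼 n 𝔼 n).bilinearComp (Γ x) (Γ x)).flip

lemma localCurvature_apply (Γ : 𝔼 n → 𝔼 n →L[ℝ] 𝔼 n →L[ℝ] 𝔼 n) (x a b c : 𝔼 n) :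
    localCurvature Γ x a b c = fderiv ℝ Γ x a b c - fderiv ℝ Γ x b a c + Γ x a (Γ x b c) -
      Γ x b (Γ x a c) := by
  simp [localCurvature]

lemma localCurvature_swap (Γ : 𝔼 n → 𝔼 n →L[ℝ] 𝔼 n →L[ℝ] 𝔼 n) (x a b c : 𝔼 n) :
    localCurvature Γ x a b c = -localCurvature Γ x b a c := by
  simp only [localCurvature_apply]; abel

/-- The Ricci contraction `(a, b) ↦ Tr (z ↦ R(a, z) b)` in coordinates. -/
def localRicci (Γ : 𝔼 n → 𝔼 n →L[ℝ] 𝔼 n →L[ℝ] 𝔼 n) (x : 𝔼 n) : 𝔼 n →L[ℝ] 𝔼 n →L[ℝ] ℝ :=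
  ∑ i : Fin n, (ContinuousLinearMap.compL ℝ 𝔼 n 𝔼 n ℝ (EuclideanSpace.proj i)).comp
    ((localCurvature Γ x).flip (EuclideanSpace.single i 1))

lemma localRicci_apply (Γ : 𝔼 n → 𝔼 n →L[ℝ] 𝔼 n →L[ℝ] 𝔼 n) (x a b : 𝔼 n) :
    localRicci Γ x a b = ∑ i : Fin n, localCurvature Γ x a (EuclideanSpace.single i 1) b i := by
  simp [localRicci]

/-- The tensor `Q` in coordinates. For `n = 1` the coefficient of the symmetric part is the junk
value `1 / 0 = 0`. -/
def localSchouten (Γ : 𝔼 n → 𝔼 n →L[ℝ] 𝔼 n →L[ℝ] 𝔼 n) (x : 𝔼 n) : 𝔼 n →L[ℝ] 𝔼 n →L[ℝ] ℝ :=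
  (1 / ((n : ℝ) - 1) / 2) • (localRicci Γ x + (localRicci Γ x).flip) +
    (1 / ((n : ℝ) + 1) / 2) • (localRicci Γ x - (localRicci Γ x).flip)

lemma localSchouten_apply (Γ : 𝔼 n → 𝔼 n →L[ℝ] 𝔼 n →L[ℝ] 𝔼 n) (x a b : 𝔼 n) :
    localSchouten Γ x a b =
      1 / ((n : ℝ) - 1) * ((localRicci Γ x a b + localRicci Γ x b a) / 2) +
        1 / ((n : ℝ) + 1) * ((localRicci Γ x a b - localRicci Γ x b a) / 2) := by
  simp [localSchouten]; ring

/-- The Weyl curvature in coordinates. -/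
def localWeyl (Γ : 𝔼 n → 𝔼 n →L[ℝ] 𝔼 n →L[ℝ] 𝔼 n) (x a b c : 𝔼 n) : 𝔼 n :=
  localCurvature Γ x a b c - localSchouten Γ x a b • c - localSchouten Γ x a c • b +
    localSchouten Γ x b a • c + localSchouten Γ x b c • a

/-- The covariant exterior derivative of `Q` in coordinates, for a symmetric `Γ`. -/
def localCotton (Γ : 𝔼 n → 𝔼 n →L[ℝ] 𝔼 n →L[ℝ] 𝔼 n) (x a b c : 𝔼 n) : ℝ :=
  fderiv ℝ (localSchouten Γ) x a b c - fderiv ℝ (localSchouten Γ) x b a c +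
    localSchouten Γ x a (Γ x b c) - localSchouten Γ x b (Γ x a c)

/-- The trace `b ↦ Tr (z ↦ Γ(b, z))` of the Christoffel symbols, which is the connection form of
the bundle of densities up to a constant. -/
def christoffelTrace (Γ : 𝔼 n → 𝔼 n →L[ℝ] 𝔼 n →L[ℝ] 𝔼 n) (x : 𝔼 n) : 𝔼 n →L[ℝ] ℝ :=
  ∑ i : Fin n, (EuclideanSpace.proj i : 𝔼 n →L[ℝ] ℝ).comp
    ((Γ x).flip (EuclideanSpace.single i 1))

lemma christoffelTrace_apply (Γ : 𝔼 n → 𝔼 n →L[ℝ] 𝔼 n →L[ℝ] 𝔼 n) (x b : 𝔼 n) :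
    christoffelTrace Γ x b = ∑ i : Fin n, Γ x b (EuclideanSpace.single i 1) i := by
  simp [christoffelTrace]

section Smooth

variable {Γ : 𝔼 n → 𝔼 n →L[ℝ] 𝔼 n →L[ℝ] 𝔼 n} {Ω : Set (EuclideanSpace ℝ (Fin n))}

lemma contDiffOn_localCurvature (hΩ : IsOpen Ω) (hΓ : ContDiffOn ℝ ∞ Γ Ω) :
    ContDiffOn ℝ ∞ (localCurvature Γ) Ω := by
  have h' : ContDiffOn ℝ ∞ (fderiv ℝ Γ) Ω := hΓ.fderiv_of_isOpen hΩ (by simp)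
  refine contDiffOn_clm_apply.2 fun a ↦ contDiffOn_clm_apply.2 fun b ↦
    contDiffOn_clm_apply.2 fun c ↦ ?_
  simp only [localCurvature_apply]
  have h1 (a b c : 𝔼 n) : ContDiffOn ℝ ∞ (fun x ↦ fderiv ℝ Γ x a b c) Ω :=
    ((h'.clm_apply contDiffOn_const).clm_apply contDiffOn_const).clm_apply contDiffOn_const
  have h2 (a b : 𝔼 n) : ContDiffOn ℝ ∞ (fun x ↦ Γ x a b) Ω :=
    (hΓ.clm_apply contDiffOn_const).clm_apply contDiffOn_const
  have h3 (a b c : 𝔼 n) : ContDiffOn ℝ ∞ (fun x ↦ Γ x a (Γ x b c)) Ω :=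
    (hΓ.clm_apply contDiffOn_const).clm_apply (h2 b c)
  exact (((h1 a b c).sub (h1 b a c)).add (h3 a b c)).sub (h3 b a c)

lemma contDiffOn_localRicci (hΩ : IsOpen Ω) (hΓ : ContDiffOn ℝ ∞ Γ Ω) :
    ContDiffOn ℝ ∞ (localRicci Γ) Ω := by
  refine contDiffOn_clm_apply.2 fun a ↦ contDiffOn_clm_apply.2 fun b ↦ ?_
  simp only [localRicci_apply]
  refine ContDiffOn.sum fun i _ ↦ ?_
  have h := contDiffOn_localCurvature hΩ hΓ
  exact contDiffOn_euclidean.1 (((h.clm_apply contDiffOn_const).clm_apply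
    contDiffOn_const).clm_apply contDiffOn_const) i

lemma contDiffOn_localSchouten (hΩ : IsOpen Ω) (hΓ : ContDiffOn ℝ ∞ Γ Ω) :
    ContDiffOn ℝ ∞ (localSchouten Γ) Ω := by
  have h := contDiffOn_localRicci hΩ hΓ
  have h1 (a b : 𝔼 n) : ContDiffOn ℝ ∞ (fun x ↦ localRicci Γ x a b) Ω :=
    (h.clm_apply contDiffOn_const).clm_apply contDiffOn_const
  refine contDiffOn_clm_apply.2 fun a ↦ contDiffOn_clm_apply.2 fun b ↦ ?_
  simp only [localSchouten_apply]
  exact (contDiffOn_const.mul (((h1 a b).add (h1 b a)).div_const 2)).add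
    (contDiffOn_const.mul (((h1 a b).sub (h1 b a)).div_const 2))

lemma contDiffOn_christoffelTrace (hΓ : ContDiffOn ℝ ∞ Γ Ω) :
    ContDiffOn ℝ ∞ (christoffelTrace Γ) Ω := by
  refine contDiffOn_clm_apply.2 fun a ↦ ?_
  simp only [christoffelTrace_apply]
  exact ContDiffOn.sum fun i _ ↦ contDiffOn_euclidean.1 ((hΓ.clm_apply contDiffOn_const).clm_apply
    contDiffOn_const) i

end Smooth

lemma sum_smul_single_apply (v : 𝔼 n) : ∑ i : Fin n, v i • EuclideanSpace.single i (1 : ℝ) = v := by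
  ext j
  simp [Pi.single_apply]

/-- `Tr (u ∘ v) = Tr (v ∘ u)`. -/
lemma sum_comp_single_comm (u v : 𝔼 n →L[ℝ] 𝔼 n) :
    ∑ i : Fin n, u (v (EuclideanSpace.single i 1)) i =
      ∑ i : Fin n, v (u (EuclideanSpace.single i 1)) i := by
  have h3 (u v : 𝔼 n →L[ℝ] 𝔼 n) : ∑ i : Fin n, u (v (EuclideanSpace.single i 1)) i =
      ∑ i : Fin n, ∑ j : Fin n, v (EuclideanSpace.single i 1) j *
        u (EuclideanSpace.single j 1) i := by
    refine Finset.sum_congr rfl fun i _ ↦ ?_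
    conv_lhs => rw [← sum_smul_single_apply (v (EuclideanSpace.single i 1))]
    simp
  rw [h3, h3, Finset.sum_comm]
  simp only [mul_comm]

/-- The trace of the curvature is the exterior derivative of the trace of the connection. -/
lemma sum_localCurvature {Γ : 𝔼 n → 𝔼 n →L[ℝ] 𝔼 n →L[ℝ] 𝔼 n} {x : 𝔼 n} (hΓ : DifferentiableAt ℝ Γ x)
    (a b : 𝔼 n) :
    ∑ i : Fin n, localCurvature Γ x a b (EuclideanSpace.single i 1) i =
      fderiv ℝ (christoffelTrace Γ) x a b - fderiv ℝ (christoffelTrace Γ) x b a := by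
  have h1 (a b : 𝔼 n) : fderiv ℝ (christoffelTrace Γ) x a b =
      ∑ i : Fin n, fderiv ℝ Γ x a b (EuclideanSpace.single i 1) i := by
    let L : (𝔼 n →L[ℝ] 𝔼 n →L[ℝ] 𝔼 n) →L[ℝ] (𝔼 n →L[ℝ] ℝ) := ∑ i : Fin n,
      (ContinuousLinearMap.compL ℝ 𝔼 n 𝔼 n ℝ (EuclideanSpace.proj i)).comp
        ((ContinuousLinearMap.apply ℝ (𝔼 n →L[ℝ] 𝔼 n) (EuclideanSpace.single i 1)).comp
          (ContinuousLinearMap.flipₗᵢ ℝ 𝔼 n 𝔼 n 𝔼 n).toContinuousLinearEquiv.toContinuousLinearMap)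
    have e : christoffelTrace Γ = fun y ↦ L (Γ y) := by
      ext y v
      simp [L, christoffelTrace_apply]
    have h2 := (L.hasFDerivAt.comp x hΓ.hasFDerivAt).fderiv
    rw [e]
    refine (congrArg (fun f ↦ f a b) h2).trans ?_
    simp [L]
  have h2 : ∑ i : Fin n, Γ x a (Γ x b (EuclideanSpace.single i 1)) i =
      ∑ i : Fin n, Γ x b (Γ x a (EuclideanSpace.single i 1)) i := sum_comp_single_comm _ _
  simp only [localCurvature_apply, h1, PiLp.add_apply, PiLp.sub_apply, Finset.sum_add_distrib,
    Finset.sum_sub_distrib, h2]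
  ring

/-- If the Weyl curvature vanishes, the skew part of `Q` is determined by the exterior derivative
of the trace of the connection: trace the expression of `R(a, b) c` through `Q` over `c`. -/
lemma localSchouten_skew {Γ : 𝔼 n → 𝔼 n →L[ℝ] 𝔼 n →L[ℝ] 𝔼 n} {x : 𝔼 n} (hΓ : DifferentiableAt ℝ Γ x)
    (hW : ∀ a b c, localWeyl Γ x a b c = 0) (a b : 𝔼 n) :
    localSchouten Γ x a b - localSchouten Γ x b a = 1 / ((n : ℝ) + 1) *
      (fderiv ℝ (christoffelTrace Γ) x a b - fderiv ℝ (christoffelTrace Γ) x b a) := by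
  rw [← sum_localCurvature hΓ]
  set Q := localSchouten Γ x
  have h1 (c : 𝔼 n) : localCurvature Γ x a b c = Q a b • c + Q a c • b - Q b a • c - Q b c • a := by
    have := hW a b c
    simp only [localWeyl] at this
    rw [← sub_eq_zero, ← this]
    abel
  have h2 (L : 𝔼 n →L[ℝ] ℝ) (v : 𝔼 n) : ∑ i : Fin n, L (EuclideanSpace.single i 1) * v i = L v := by
    conv_rhs => rw [← sum_smul_single_apply v]
    simp [mul_comm]
  have h3 : ∑ i : Fin n, localCurvature Γ x a b (EuclideanSpace.single i 1) i =
      (n + 1) * (Q a b - Q b a) := by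
    simp only [h1, PiLp.sub_apply, PiLp.add_apply, PiLp.smul_apply, smul_eq_mul,
      Finset.sum_sub_distrib, Finset.sum_add_distrib, h2, PiLp.single_apply]
    simp
    ring
  rw [h3]
  field_simp

/-! ### The projective tractor connection -/

section Tractor

variable {n : ℕ} {T : Type*} [NormedAddCommGroup T] [NormedSpace ℝ T]

/-- The connection form of the projective (co)tractor connection, twisted by `T`: the system
`dF = A F` for `F = (s, m)` reads `∇s = m`, `∇m = Q s`, where `∇` acts on densities through the
`1`-form `τ` and on covectors through `Γ`. The space `T` of values of `s` allows for several
solutions at once. -/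
def tractorForm (Γ : 𝔼 n →L[ℝ] 𝔼 n →L[ℝ] 𝔼 n) (τ : 𝔼 n →L[ℝ] ℝ) (Q : 𝔼 n →L[ℝ] 𝔼 n →L[ℝ] ℝ) :
    𝔼 n →L[ℝ] (T × (𝔼 n →L[ℝ] T)) →L[ℝ] (T × (𝔼 n →L[ℝ] T)) :=
  LinearMap.toContinuousLinearMap
    { toFun := fun a ↦
        ((ContinuousLinearMap.apply ℝ T a).comp (ContinuousLinearMap.snd ℝ T (𝔼 n →L[ℝ] T)) -
          τ a • ContinuousLinearMap.fst ℝ T (𝔼 n →L[ℝ] T)).prod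
        (((ContinuousLinearMap.compL ℝ 𝔼 n 𝔼 n T).flip (Γ a)).comp
            (ContinuousLinearMap.snd ℝ T (𝔼 n →L[ℝ] T)) -
          τ a • ContinuousLinearMap.snd ℝ T (𝔼 n →L[ℝ] T) +
          (ContinuousLinearMap.smulRightL ℝ 𝔼 n T (Q a)).comp
            (ContinuousLinearMap.fst ℝ T (𝔼 n →L[ℝ] T)))
      map_add' := fun a b ↦ by
        refine ContinuousLinearMap.ext fun p ↦ Prod.ext ?_ (ContinuousLinearMap.ext fun d ↦ ?_)
        · simp; module
        · simp; module
      map_smul' := fun t a ↦ by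
        refine ContinuousLinearMap.ext fun p ↦ Prod.ext ?_ (ContinuousLinearMap.ext fun d ↦ ?_)
        · simp; module
        · simp; module }

@[simp] lemma tractorForm_fst (Γ : 𝔼 n →L[ℝ] 𝔼 n →L[ℝ] 𝔼 n) (τ : 𝔼 n →L[ℝ] ℝ)
    (Q : 𝔼 n →L[ℝ] 𝔼 n →L[ℝ] ℝ) (a : 𝔼 n) (p : T × (𝔼 n →L[ℝ] T)) :
    (tractorForm Γ τ Q a p).1 = p.2 a - τ a • p.1 := by
  simp [tractorForm]

@[simp] lemma tractorForm_snd (Γ : 𝔼 n →L[ℝ] 𝔼 n →L[ℝ] 𝔼 n) (τ : 𝔼 n →L[ℝ] ℝ)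
    (Q : 𝔼 n →L[ℝ] 𝔼 n →L[ℝ] ℝ) (a d : 𝔼 n) (p : T × (𝔼 n →L[ℝ] T)) :
    (tractorForm Γ τ Q a p).2 d = p.2 (Γ a d) - τ a • p.2 d + Q a d • p.1 := by
  simp [tractorForm]

variable (T) in
/-- The tractor connection form of the connection `D + Γ`. -/
def tractorConnection (Γ : 𝔼 n → 𝔼 n →L[ℝ] 𝔼 n →L[ℝ] 𝔼 n) (x : 𝔼 n) :
    𝔼 n →L[ℝ] (T × (𝔼 n →L[ℝ] T)) →L[ℝ] (T × (𝔼 n →L[ℝ] T)) :=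
  tractorForm (Γ x) ((1 / ((n : ℝ) + 1)) • christoffelTrace Γ x) (localSchouten Γ x)

variable {Γ : 𝔼 n → 𝔼 n →L[ℝ] 𝔼 n →L[ℝ] 𝔼 n} {Ω : Set (EuclideanSpace ℝ (Fin n))}

lemma contDiffOn_tractorConnection [FiniteDimensional ℝ T] (hΩ : IsOpen Ω)
    (hΓ : ContDiffOn ℝ ∞ Γ Ω) : ContDiffOn ℝ ∞ (tractorConnection T Γ) Ω := by
  have h1 := contDiffOn_localSchouten hΩ hΓ
  have h2 := contDiffOn_christoffelTrace hΓ
  refine contDiffOn_clm_apply.2 fun a ↦ contDiffOn_clm_apply.2 fun p ↦ ContDiffOn.prodMk ?_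
    (contDiffOn_clm_apply.2 fun d ↦ ?_)
  · exact contDiffOn_const.sub (((h2.const_smul _).clm_apply contDiffOn_const).smul
      contDiffOn_const)
  · change ContDiffOn ℝ ∞ (fun x ↦ (tractorConnection T Γ x a p).2 d) Ω
    simp only [tractorConnection, tractorForm_snd]
    exact ((p.2.contDiff.comp_contDiffOn ((hΓ.clm_apply contDiffOn_const).clm_apply
      contDiffOn_const)).sub (((h2.const_smul _).clm_apply contDiffOn_const).smul
      contDiffOn_const)).add (((h1.clm_apply contDiffOn_const).clm_apply contDiffOn_const).smul
      contDiffOn_const)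

lemma fderiv_tractorConnection [FiniteDimensional ℝ T] (hΩ : IsOpen Ω)
    (hΓ : ContDiffOn ℝ ∞ Γ Ω) {x : 𝔼 n} (hx : x ∈ Ω) (a b : 𝔼 n) (p : T × (𝔼 n →L[ℝ] T)) :
    (fderiv ℝ (tractorConnection T Γ) x a b p).1 =
        -((1 / ((n : ℝ) + 1)) * fderiv ℝ (christoffelTrace Γ) x a b) • p.1 ∧
      ∀ d, (fderiv ℝ (tractorConnection T Γ) x a b p).2 d = p.2 (fderiv ℝ Γ x a b d) -
        ((1 / ((n : ℝ) + 1)) * fderiv ℝ (christoffelTrace Γ) x a b) • p.2 d +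
        fderiv ℝ (localSchouten Γ) x a b d • p.1 := by
  have hn := hΩ.mem_nhds hx
  have hA := ((contDiffOn_tractorConnection (T := T) hΩ hΓ).contDiffAt hn).differentiableAt
    (by simp) |>.hasFDerivAt
  have hQ := ((contDiffOn_localSchouten hΩ hΓ).contDiffAt hn).differentiableAt
    (by simp) |>.hasFDerivAt
  have hτ := ((contDiffOn_christoffelTrace hΓ).contDiffAt hn).differentiableAt
    (by simp) |>.hasFDerivAt
  have hG := (hΓ.contDiffAt hn).differentiableAt (by simp) |>.hasFDerivAt
  have h0 := (hA.clm_apply (hasFDerivAt_const b x)).clm_apply (hasFDerivAt_const p x)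
  have hτb := ((hτ.const_smul (1 / ((n : ℝ) + 1))).clm_apply (hasFDerivAt_const b x))
  constructor
  · have h1 := h0.fst
    have h2 := (hτb.smul (hasFDerivAt_const p.1 x)).const_sub (p.2 b)
    have h3 := h1.congr_of_eventuallyEq (f₁ := fun y ↦ p.2 b -
      ((1 / ((n : ℝ) + 1)) • christoffelTrace Γ y) b • p.1)
      (Filter.Eventually.of_forall fun y ↦ by simp [tractorConnection]) |>.unique h2
    have h4 := congrArg (fun L ↦ L a) h3
    simpa using h4
  · intro d
    have h1 := h0.snd.clm_apply (hasFDerivAt_const d x)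
    have hGd := p.2.hasFDerivAt.comp x ((hG.clm_apply (hasFDerivAt_const b x)).clm_apply
      (hasFDerivAt_const d x))
    have hQd := (((hQ.clm_apply (hasFDerivAt_const b x)).clm_apply
      (hasFDerivAt_const d x))).smul (hasFDerivAt_const p.1 x)
    have h2 := (hGd.sub (hτb.smul (hasFDerivAt_const (p.2 d) x))).add hQd
    have h3 := h1.unique (h2.congr_of_eventuallyEq
      (Filter.Eventually.of_forall fun y ↦ by simp [tractorConnection]))
    have h4 := congrArg (fun L ↦ L a) h3
    simpa using h4

/-- The tractor curvature of a connection with vanishing Weyl curvature is given by the tensor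
`C = d^∇ Q`. -/
lemma linearCurvature_tractorConnection [FiniteDimensional ℝ T] (hΩ : IsOpen Ω)
    (hΓ : ContDiffOn ℝ ∞ Γ Ω) {x : 𝔼 n} (hx : x ∈ Ω) (hsymm : ∀ u v, Γ x u v = Γ x v u)
    (hW : ∀ a b c, localWeyl Γ x a b c = 0) (a b : 𝔼 n) (p : T × (𝔼 n →L[ℝ] T)) :
    (linearCurvature (tractorConnection T Γ) x a b p).1 = 0 ∧
      ∀ d, (linearCurvature (tractorConnection T Γ) x a b p).2 d =
        localCotton Γ x a b d • p.1 := by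
  have hsk := localSchouten_skew ((hΓ.contDiffAt (hΩ.mem_nhds hx)).differentiableAt (by simp)) hW a b
  obtain ⟨h1, h2⟩ := fderiv_tractorConnection (T := T) hΩ hΓ hx a b p
  obtain ⟨h1', h2'⟩ := fderiv_tractorConnection (T := T) hΩ hΓ hx b a p
  have hR (c : 𝔼 n) : fderiv ℝ Γ x a b c = fderiv ℝ Γ x b a c - Γ x a (Γ x b c) + Γ x b (Γ x a c) +
      (localSchouten Γ x a b • c + localSchouten Γ x a c • b - localSchouten Γ x b a • c -
        localSchouten Γ x b c • a) := by
    have := hW a b c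
    simp only [localWeyl, localCurvature_apply] at this
    rw [← sub_eq_zero, ← this]
    abel
  have hs : localSchouten Γ x a b = localSchouten Γ x b a + 1 / ((n : ℝ) + 1) *
      (fderiv ℝ (christoffelTrace Γ) x a b - fderiv ℝ (christoffelTrace Γ) x b a) := by
    rw [← hsk]; ring
  constructor
  · simp only [linearCurvature, add_apply, sub_apply, mul_apply_eq_comp,
      Prod.fst_add, Prod.fst_sub, h1, h1']
    simp only [tractorConnection, tractorForm_fst, tractorForm_snd, hs, smul_apply, smul_eq_mul,
      hsymm b a]
    module
  · intro d
    simp only [linearCurvature, add_apply, sub_apply, mul_apply_eq_comp,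
      Prod.snd_add, Prod.snd_sub, h2, h2', hR d]
    simp only [tractorConnection, tractorForm_fst, tractorForm_snd, hs, smul_apply, smul_eq_mul,
      localCotton, map_add, map_sub, map_smul]
    module

lemma differentiableAt_linearCurvature {E V : Type*} [NormedAddCommGroup E] [NormedSpace ℝ E]
    [NormedAddCommGroup V] [NormedSpace ℝ V] {A : E → E →L[ℝ] V →L[ℝ] V} {x : E}
    (hA : ContDiffAt ℝ 2 A x) (a b : E) :
    DifferentiableAt ℝ (fun y ↦ linearCurvature A y a b) x := by
  have h1 : DifferentiableAt ℝ A x := hA.differentiableAt (by simp)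
  have h2 : DifferentiableAt ℝ (fderiv ℝ A) x :=
    (hA.fderiv_right (m := 1) (by norm_num)).differentiableAt (by simp)
  have h3 (a b : E) : DifferentiableAt ℝ (fun y ↦ fderiv ℝ A y a b) x :=
    (h2.clm_apply (differentiableAt_const a)).clm_apply (differentiableAt_const b)
  have h4 (a : E) : DifferentiableAt ℝ (fun y ↦ A y a) x := h1.clm_apply (differentiableAt_const a)
  exact (((h3 a b).sub (h3 b a)).add ((h4 b).mul (h4 a))).sub ((h4 a).mul (h4 b))

/-- In dimension at least three, the vanishing of the Weyl curvature implies that of `C`: this is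
contained in the Bianchi identity for the tractor connection. -/
lemma localCotton_eq_zero (hn : 3 ≤ n) (hΩ : IsOpen Ω) (hΓ : ContDiffOn ℝ ∞ Γ Ω)
    (hsymm : ∀ x ∈ Ω, ∀ u v, Γ x u v = Γ x v u)
    (hW : ∀ x ∈ Ω, ∀ a b c, localWeyl Γ x a b c = 0) {x : 𝔼 n} (hx : x ∈ Ω) (a b d : 𝔼 n) :
    localCotton Γ x a b d = 0 := by
  -- a covector `m` with `m a = m b = 0` and `m c ≠ 0` for some `c`
  obtain ⟨c, hc⟩ : ∃ c : 𝔼 n, c ∉ Submodule.span ℝ {a, b} := by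
    by_contra! h
    have h1 : Submodule.span ℝ {a, b} = ⊤ := Submodule.eq_top_iff'.2 h
    have h2 := finrank_span_le_card (R := ℝ) ({a, b} : Set 𝔼 n)
    rw [h1, finrank_top, finrank_euclideanSpace_fin] at h2
    have h3 : ({a, b} : Set 𝔼 n).toFinset.card ≤ 2 := by
      rw [Set.toFinset_insert, Set.toFinset_singleton]
      exact Finset.card_le_two
    omega
  obtain ⟨f, hfc, hf⟩ := Submodule.exists_dual_map_eq_bot_of_notMem hc inferInstance
  set m : 𝔼 n →L[ℝ] ℝ := LinearMap.toContinuousLinearMap f with hm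
  have hma : ∀ v ∈ Submodule.span ℝ {a, b}, m v = 0 := fun v hv ↦ by
    have : f v ∈ (Submodule.span ℝ {a, b}).map f := Submodule.mem_map_of_mem hv
    rw [hf] at this
    exact (Submodule.mem_bot ℝ).1 this
  have ha := hma a (Submodule.subset_span (by simp))
  have hb := hma b (Submodule.subset_span (by simp))
  have hmc : m c ≠ 0 := hfc
  have hn := hΩ.mem_nhds hx
  have hA := (contDiffOn_tractorConnection (T := ℝ) hΩ hΓ)
  have hB := linearCurvature_bianchi ((hA.contDiffAt hn).of_le (by norm_cast)) a b c
  set A := tractorConnection ℝ Γ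
  -- the curvature annihilates `(0, m)` identically, hence so does its derivative
  have hK0 (a b : 𝔼 n) : ∀ y ∈ Ω, linearCurvature A y a b (0, m) = 0 := fun y hy ↦ by
    obtain ⟨e1, e2⟩ := linearCurvature_tractorConnection (T := ℝ) hΩ hΓ hy (hsymm y hy)
      (hW y hy) a b (0, m)
    refine Prod.ext e1 (ContinuousLinearMap.ext fun d ↦ ?_)
    rw [e2]; simp
  have hKdiff (a b : 𝔼 n) : DifferentiableAt ℝ (fun y ↦ linearCurvature A y a b) x :=
    differentiableAt_linearCurvature ((hA.contDiffAt hn).of_le (by norm_cast)) a b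
  have hD (a b c : 𝔼 n) : fderiv ℝ (fun y ↦ linearCurvature A y a b) x c (0, m) = 0 := by
    have h1 := (hKdiff a b).hasFDerivAt.clm_apply (hasFDerivAt_const ((0, m) : ℝ × (𝔼 n →L[ℝ] ℝ)) x)
    have h2 : (fun y ↦ linearCurvature A y a b (0, m)) =ᶠ[𝓝 x] fun _ ↦ 0 := by
      filter_upwards [hn] with y hy using hK0 a b y hy
    have h3 := (h1.congr_of_eventuallyEq h2.symm).unique (hasFDerivAt_const 0 x)
    simpa using congrArg (fun L ↦ L c) h3
  -- the terms of the Bianchi identity that remain are `C(a, b, d) m(c)` and its cyclic permutations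
  have hfin := congrArg (fun L ↦ (L (0, m)).2 d) hB
  have hC (a b c : 𝔼 n) : (linearCurvature A x a b (A x c (0, m))).2 d =
      localCotton Γ x a b d * m c := by
    rw [(linearCurvature_tractorConnection (T := ℝ) hΩ hΓ hx (hsymm x hx)
      (hW x hx) a b _).2]
    simp [A, tractorConnection]
  simp only [add_apply, sub_apply, mul_apply_eq_comp, hD, hK0 _ _ x hx, map_zero,
    Prod.snd_add, Prod.snd_sub, Prod.snd_zero, hC, ha, hb, zero_apply] at hfin
  simpa [hmc] using hfin

end Tractor

/-! ### Projective coordinates -/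

/-- In dimension two the Weyl curvature vanishes identically. -/
lemma localWeyl_eq_zero_of_two (Γ : 𝔼 2 → 𝔼 2 →L[ℝ] 𝔼 2 →L[ℝ] 𝔼 2) (x a b c : 𝔼 2) :
    localWeyl Γ x a b c = 0 := by
  have hx (v : 𝔼 2) : v = v 0 • EuclideanSpace.single 0 1 + v 1 • EuclideanSpace.single 1 1 := by
    conv_lhs => rw [← sum_smul_single_apply v]
    simp
  set R := localCurvature Γ x with hR
  -- everything is determined by the two vectors `R(e₀, e₁) e₀` and `R(e₀, e₁) e₁`
  set e₀ : 𝔼 2 := EuclideanSpace.single 0 1 with he₀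
  set e₁ : 𝔼 2 := EuclideanSpace.single 1 1 with he₁
  have h00 (c : 𝔼 2) : R e₀ e₀ c = 0 := by
    have h : (2 : ℝ) • R e₀ e₀ c = 0 := by
      rw [two_smul]
      exact add_eq_zero_iff_eq_neg.2 (localCurvature_swap Γ x e₀ e₀ c)
    simpa using h
  have h11 (c : 𝔼 2) : R e₁ e₁ c = 0 := by
    have h : (2 : ℝ) • R e₁ e₁ c = 0 := by
      rw [two_smul]
      exact add_eq_zero_iff_eq_neg.2 (localCurvature_swap Γ x e₁ e₁ c)
    simpa using h
  have h10 (c : 𝔼 2) : R e₁ e₀ c = -R e₀ e₁ c := localCurvature_swap Γ x e₁ e₀ c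
  have hric (u v : 𝔼 2) : localRicci Γ x u v = R u e₀ v 0 + R u e₁ v 1 := by
    rw [localRicci_apply, Fin.sum_univ_two]
  have hQ (u v : 𝔼 2) := localSchouten_apply Γ x u v
  simp only [hric] at hQ
  have hQ00 : localSchouten Γ x e₀ e₀ = R e₀ e₁ e₀ 1 := by
    rw [hQ]; simp [h00]; ring
  have hQ11 : localSchouten Γ x e₁ e₁ = -R e₀ e₁ e₁ 0 := by
    rw [hQ]; simp [h11, h10]; ring
  have hQ01 : localSchouten Γ x e₀ e₁ = (2 * R e₀ e₁ e₁ 1 - R e₀ e₁ e₀ 0) / 3 := by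
    rw [hQ]; simp [h00, h11, h10]; ring
  have hQ10 : localSchouten Γ x e₁ e₀ = (R e₀ e₁ e₁ 1 - 2 * R e₀ e₁ e₀ 0) / 3 := by
    rw [hQ]; simp [h00, h11, h10]; ring
  rw [localWeyl, ← hR, hx a, hx b, hx c]
  simp only [map_add, map_smul, add_apply, smul_apply, h00, h11, h10, hQ00, hQ11, hQ01, hQ10]
  rw [hx (R e₀ e₁ e₀), hx (R e₀ e₁ e₁)]
  simp only [smul_eq_mul]
  have g00 : e₀ 0 = 1 := by simp [he₀]
  have g01 : e₀ 1 = 0 := by simp [he₀]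
  have g10 : e₁ 0 = 0 := by simp [he₁]
  have g11 : e₁ 1 = 1 := by simp [he₁]
  simp only [PiLp.add_apply, PiLp.smul_apply, g00, g01, g10, g11, smul_eq_mul, mul_one, mul_zero,
    add_zero, zero_add]
  module

variable {n : ℕ}

/-- If `s` and the scalar function `f` satisfy the same second order linear equation
`D² u(v, w) = Du(Γ(v, w)) - τ(v) Du(w) - τ(w) Du(v) + q u`, then the quotient `ψ = s / f` satisfies
`D² ψ(v, w) = Dψ(Γ(v, w)) - β(v) Dψ(w) - β(w) Dψ(v)` with `β = τ + df / f`. -/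
lemma fderiv_fderiv_of_quotient {E F : Type*} [NormedAddCommGroup E] [NormedSpace ℝ E]
    [NormedAddCommGroup F] [NormedSpace ℝ F] {f : E → ℝ} {s ψ : E → F} {x : E}
    (hf : ContDiffAt ℝ 2 f x) (hψ : ContDiffAt ℝ 2 ψ x) (hs : s =ᶠ[𝓝 x] fun y ↦ f y • ψ y)
    (hfx : f x ≠ 0) (v w g : E) (tv tw q : ℝ)
    (h1 : fderiv ℝ (fderiv ℝ f) x v w = fderiv ℝ f x g - tv * fderiv ℝ f x w -
      tw * fderiv ℝ f x v + q * f x)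
    (h2 : fderiv ℝ (fderiv ℝ s) x v w = fderiv ℝ s x g - tv • fderiv ℝ s x w -
      tw • fderiv ℝ s x v + q • s x) :
    fderiv ℝ (fderiv ℝ ψ) x v w = fderiv ℝ ψ x g -
      ((tv + (f x)⁻¹ * fderiv ℝ f x v) • fderiv ℝ ψ x w +
        (tw + (f x)⁻¹ * fderiv ℝ f x w) • fderiv ℝ ψ x v) := by
  have e1 : fderiv ℝ s =ᶠ[𝓝 x] fun y ↦ f y • fderiv ℝ ψ y + (fderiv ℝ f y).smulRight (ψ y) := by
    have hf' : ∀ᶠ y in 𝓝 x, ContDiffAt ℝ 2 f y := hf.eventually (by simp)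
    have hψ' : ∀ᶠ y in 𝓝 x, ContDiffAt ℝ 2 ψ y := hψ.eventually (by simp)
    filter_upwards [hf', hψ', hs.eventuallyEq_nhds] with y hfy hψy hsy
    rw [hsy.fderiv_eq]
    exact ((hfy.differentiableAt (by simp)).hasFDerivAt.smul
      (hψy.differentiableAt (by simp)).hasFDerivAt).fderiv
  have df := (hf.differentiableAt (by simp)).hasFDerivAt
  have dψ := (hψ.differentiableAt (by simp)).hasFDerivAt
  have ddf := ((hf.fderiv_right (m := 1) (by norm_num)).differentiableAt (by simp)).hasFDerivAt
  have ddψ := ((hψ.fderiv_right (m := 1) (by norm_num)).differentiableAt (by simp)).hasFDerivAt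
  have e2 : fderiv ℝ (fderiv ℝ s) x v w = f x • fderiv ℝ (fderiv ℝ ψ) x v w +
      fderiv ℝ f x v • fderiv ℝ ψ x w + (fderiv ℝ f x w • fderiv ℝ ψ x v +
        fderiv ℝ (fderiv ℝ f) x v w • ψ x) := by
    have hds : HasFDerivAt (fderiv ℝ s) (fderiv ℝ (fderiv ℝ s) x) x := by
      refine DifferentiableAt.hasFDerivAt ?_
      exact (((hf.smul hψ).congr_of_eventuallyEq hs).fderiv_right (m := 1)
        (by norm_num)).differentiableAt (by simp)
    have a1 := hds.clm_apply (hasFDerivAt_const w x)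
    have a2 := (df.smul (ddψ.clm_apply (hasFDerivAt_const w x))).add
      ((ddf.clm_apply (hasFDerivAt_const w x)).smul dψ)
    have a3 : (fun y ↦ fderiv ℝ s y w) =ᶠ[𝓝 x] fun y ↦ f y • fderiv ℝ ψ y w +
        fderiv ℝ f y w • ψ y := by
      filter_upwards [e1] with y hy
      rw [hy]; simp
    have a4 := congrArg (fun L ↦ L v) ((a1.congr_of_eventuallyEq a3.symm).unique a2)
    simpa using a4
  have e3 (u : E) : fderiv ℝ s x u = f x • fderiv ℝ ψ x u + fderiv ℝ f x u • ψ x := by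
    rw [e1.eq_of_nhds]; simp
  rw [e2, h1, hs.eq_of_nhds, e3, e3, e3] at h2
  have h3 : f x • fderiv ℝ (fderiv ℝ ψ) x v w = f x • (fderiv ℝ ψ x g -
      ((tv + (f x)⁻¹ * fderiv ℝ f x v) • fderiv ℝ ψ x w +
        (tw + (f x)⁻¹ * fderiv ℝ f x w) • fderiv ℝ ψ x v)) := by
    have h4 := sub_eq_zero.2 h2
    rw [← sub_eq_zero, ← h4]
    simp only [smul_sub, smul_add, smul_smul, mul_add, mul_inv_cancel_left₀ hfx]
    module
  exact smul_right_injective F hfx h3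

variable {Γ : 𝔼 n → 𝔼 n →L[ℝ] 𝔼 n →L[ℝ] 𝔼 n} {Ω : Set 𝔼 n}

/-- A smooth map with invertible derivative at a point restricts to a diffeomorphism between open
sets. -/
lemma exists_openPartialHomeomorph_of_contDiffOn {ψ : 𝔼 n → 𝔼 n} {U : Set 𝔼 n} (hU : IsOpen U)
    (hψ : ContDiffOn ℝ ∞ ψ U) {x₀ : 𝔼 n} (hx₀ : x₀ ∈ U) (L : 𝔼 n ≃L[ℝ] 𝔼 n)
    (hL : fderiv ℝ ψ x₀ = L) :
    ∃ φ : OpenPartialHomeomorph 𝔼 n 𝔼 n, (∀ x, φ x = ψ x) ∧ x₀ ∈ φ.source ∧ φ.source ⊆ U ∧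
      ContDiffOn ℝ ∞ φ φ.source ∧ ContDiffOn ℝ ∞ φ.symm φ.target := by
  have hc : ContDiffAt ℝ ∞ ψ x₀ := hψ.contDiffAt (hU.mem_nhds hx₀)
  have hd : HasFDerivAt ψ (L : 𝔼 n →L[ℝ] 𝔼 n) x₀ := by
    rw [← hL]; exact (hc.differentiableAt (by simp)).hasFDerivAt
  set φ₀ := hc.toOpenPartialHomeomorph ψ hd (by simp) with hφ₀
  have hφ₀c : (φ₀ : 𝔼 n → 𝔼 n) = ψ := hc.toOpenPartialHomeomorph_coe hd (by simp)
  have hsrc : x₀ ∈ φ₀.source := hc.mem_toOpenPartialHomeomorph_source hd (by simp)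
  -- the open set where the derivative is invertible
  set S : Set 𝔼 n := U ∩ fderiv ℝ ψ ⁻¹' Set.range ((↑) : (𝔼 n ≃L[ℝ] 𝔼 n) → 𝔼 n →L[ℝ] 𝔼 n) with hS
  have hSo : IsOpen S := (hψ.continuousOn_fderiv_of_isOpen hU (by simp)).isOpen_inter_preimage hU
    ContinuousLinearEquiv.isOpen
  have hxS : x₀ ∈ S := ⟨hx₀, L, hL.symm⟩
  refine ⟨φ₀.restrOpen S hSo, fun x ↦ ?_, ?_, ?_, ?_, ?_⟩
  · change φ₀ x = ψ x
    rw [hφ₀c]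
  · exact ⟨hsrc, hxS⟩
  · exact fun x hx ↦ hx.2.1
  · refine (hψ.mono (fun x hx ↦ hx.2.1)).congr fun x hx ↦ ?_
    change φ₀ x = ψ x
    rw [hφ₀c]
  · intro y hy
    set φ := φ₀.restrOpen S hSo
    have hφc : (φ : 𝔼 n → 𝔼 n) = ψ := hφ₀c
    have hx : φ.symm y ∈ φ.source := φ.map_target hy
    obtain ⟨L', hL'⟩ := hx.2.2
    have hcx : ContDiffAt ℝ ∞ ψ (φ.symm y) := hψ.contDiffAt (hU.mem_nhds hx.2.1)
    refine (φ.contDiffAt_symm (f₀' := L') hy ?_ ?_).contDiffWithinAt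
    · rw [hφc, hL']
      exact (hcx.differentiableAt (by simp)).hasFDerivAt
    · rw [hφc]; exact hcx

set_option maxHeartbeats 1000000 in
/-- **Projective coordinates.** If the tensors `W` and `C` of a symmetric connection `D + Γ` vanish,
there are local coordinates `ψ` in which the connection is projectively equivalent to the flat one.
They are the quotients of solutions of the flat tractor connection. -/
theorem exists_projective_coordinates (hΩ : IsOpen Ω) (hΓ : ContDiffOn ℝ ∞ Γ Ω)
    (hsymm : ∀ x ∈ Ω, ∀ u v, Γ x u v = Γ x v u)
    (hW : ∀ x ∈ Ω, ∀ a b c, localWeyl Γ x a b c = 0)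
    (hC : ∀ x ∈ Ω, ∀ a b c, localCotton Γ x a b c = 0) {x₀ : 𝔼 n} (hx₀ : x₀ ∈ Ω) :
    ∃ ψ : OpenPartialHomeomorph 𝔼 n 𝔼 n, x₀ ∈ ψ.source ∧ ψ.source ⊆ Ω ∧
      ContDiffOn ℝ ∞ ψ ψ.source ∧ ContDiffOn ℝ ∞ ψ.symm ψ.target ∧
      ∃ β : 𝔼 n → 𝔼 n →L[ℝ] ℝ, ContDiffOn ℝ ∞ β ψ.source ∧ ∀ x ∈ ψ.source, ∀ v w,
        fderiv ℝ (fderiv ℝ ψ) x v w =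
          fderiv ℝ ψ x (Γ x v w) - (β x v • fderiv ℝ ψ x w + β x w • fderiv ℝ ψ x v) := by
  have hA := contDiffOn_tractorConnection (T := ℝ × 𝔼 n) hΩ hΓ
  have hflat : ∀ x ∈ Ω, ∀ a b, linearCurvature (tractorConnection (ℝ × 𝔼 n) Γ) x a b = 0 := by
    intro x hx a b
    refine ContinuousLinearMap.ext fun p ↦ ?_
    obtain ⟨e1, e2⟩ := linearCurvature_tractorConnection (T := ℝ × 𝔼 n) hΩ hΓ hx (hsymm x hx)
      (hW x hx) a b p
    refine Prod.ext e1 (ContinuousLinearMap.ext fun d ↦ ?_)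
    rw [e2, hC x hx, zero_smul]
    rfl
  -- one density with initial value `1` and `n` densities with initial value `0`, whose covariant
  -- derivatives at `x₀` are zero and the coordinate forms
  obtain ⟨F, U, hU, hxU, hUΩ, hF0, hFs, hF⟩ := exists_solution_of_linearCurvature_eq_zero hΩ hA
    hflat hx₀ (((1, 0), ContinuousLinearMap.inr ℝ ℝ 𝔼 n) :
      (ℝ × 𝔼 n) × (𝔼 n →L[ℝ] ℝ × 𝔼 n))
  set τ : 𝔼 n → 𝔼 n →L[ℝ] ℝ := fun x ↦ (1 / ((n : ℝ) + 1)) • christoffelTrace Γ x with hτdef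
  have hτ : ContDiffOn ℝ ∞ τ Ω := (contDiffOn_christoffelTrace hΓ).const_smul _
  -- the equations satisfied by the components of the parallel section
  have hd1 : ∀ x ∈ U, ∀ w, fderiv ℝ (fun y ↦ (F y).1) x w = (F x).2 w - τ x w • (F x).1 := by
    intro x hx w
    have h := congrArg (fun L ↦ L w) (hF x hx).fst.fderiv
    simpa [tractorConnection, hτdef] using! h
  have hd2 : ∀ x ∈ U, ∀ v w, fderiv ℝ (fun y ↦ (F y).2 w) x v =
      (F x).2 (Γ x v w) - τ x v • (F x).2 w + localSchouten Γ x v w • (F x).1 := by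
    intro x hx v w
    have h := congrArg (fun L ↦ L v) ((hF x hx).snd.clm_apply (hasFDerivAt_const w x)).fderiv
    simpa [tractorConnection, hτdef] using! h
  have hF1 : ContDiffOn ℝ ∞ (fun y ↦ (F y).1) U := hFs.fst
  -- the second order equation
  have hdd : ∀ x ∈ U, ∀ v w, fderiv ℝ (fderiv ℝ (fun y ↦ (F y).1)) x v w =
      fderiv ℝ (fun y ↦ (F y).1) x (Γ x v w) - τ x v • fderiv ℝ (fun y ↦ (F y).1) x w -
        τ x w • fderiv ℝ (fun y ↦ (F y).1) x v + (τ x (Γ x v w) - τ x v * τ x w +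
          localSchouten Γ x v w - fderiv ℝ τ x v w) • (F x).1 := by
    intro x hx v w
    have hn := hU.mem_nhds hx
    have c1 := ((((hF1.contDiffAt hn).fderiv_right (m := ∞) (by simp)).differentiableAt
      (by simp)).hasFDerivAt).clm_apply (hasFDerivAt_const w x)
    have c2 : (fun y ↦ fderiv ℝ (fun y ↦ (F y).1) y w) =ᶠ[𝓝 x]
        fun y ↦ (F y).2 w - τ y w • (F y).1 := by
      filter_upwards [hn] with y hy using hd1 y hy w
    have hτx := ((hτ.contDiffAt (hΩ.mem_nhds (hUΩ hx))).differentiableAt (by simp)).hasFDerivAt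
    have c3 := (((hF x hx).snd.clm_apply (hasFDerivAt_const w x)).differentiableAt.hasFDerivAt).sub
      ((hτx.clm_apply (hasFDerivAt_const w x)).smul (hF x hx).fst.differentiableAt.hasFDerivAt)
    have c4 := congrArg (fun L ↦ L v) ((c1.congr_of_eventuallyEq c2.symm).unique c3)
    have c5 : fderiv ℝ (fderiv ℝ (fun y ↦ (F y).1)) x v w =
        fderiv ℝ (fun y ↦ (F y).2 w) x v - (τ x w • fderiv ℝ (fun y ↦ (F y).1) x v +
          fderiv ℝ τ x v w • (F x).1) := by
      simpa using c4
    rw [c5, hd2 x hx, hd1 x hx, hd1 x hx, hd1 x hx]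
    module
  -- quotients of the components
  set f : 𝔼 n → ℝ := fun y ↦ (F y).1.1 with hfdef
  set s : 𝔼 n → 𝔼 n := fun y ↦ (F y).1.2 with hsdef
  have hf : ContDiffOn ℝ ∞ f U := hF1.fst
  have hs : ContDiffOn ℝ ∞ s U := hF1.snd
  have hf0 : f x₀ = 1 := by simp [hfdef, hF0]
  have hs0 : s x₀ = 0 := by simp [hsdef, hF0]
  set U' : Set 𝔼 n := U ∩ f ⁻¹' {0}ᶜ with hU'
  have hU'o : IsOpen U' := hf.continuousOn.isOpen_inter_preimage hU isOpen_compl_singleton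
  have hxU' : x₀ ∈ U' := ⟨hxU, by simp [hf0]⟩
  set ψ : 𝔼 n → 𝔼 n := fun y ↦ (f y)⁻¹ • s y with hψdef
  have hψ : ContDiffOn ℝ ∞ ψ U' := ((hf.mono fun x hx ↦ hx.1).inv fun x hx ↦ hx.2).smul
    (hs.mono fun x hx ↦ hx.1)
  have hfst : ∀ x ∈ U, ∀ u, fderiv ℝ f x u = (fderiv ℝ (fun y ↦ (F y).1) x u).1 := by
    intro x hx u
    have h := congrArg (fun L ↦ L u) ((((hF1.contDiffAt (hU.mem_nhds hx)).differentiableAt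
      (by simp)).hasFDerivAt).fst).fderiv
    simpa using! h
  have hsnd : ∀ x ∈ U, ∀ u, fderiv ℝ s x u = (fderiv ℝ (fun y ↦ (F y).1) x u).2 := by
    intro x hx u
    have h := congrArg (fun L ↦ L u) ((((hF1.contDiffAt (hU.mem_nhds hx)).differentiableAt
      (by simp)).hasFDerivAt).snd).fderiv
    simpa using! h
  have hDψ : fderiv ℝ ψ x₀ = (ContinuousLinearEquiv.refl ℝ 𝔼 n : 𝔼 n →L[ℝ] 𝔼 n) := by
    refine ContinuousLinearMap.ext fun u ↦ ?_
    have dfx := ((hf.contDiffAt (hU.mem_nhds hxU)).differentiableAt (by simp)).hasFDerivAt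
    have dsx := ((hs.contDiffAt (hU.mem_nhds hxU)).differentiableAt (by simp)).hasFDerivAt
    have h1 := (((hasDerivAt_inv (by simp [hf0])).comp_hasFDerivAt x₀ dfx).smul dsx).fderiv
    have h2 := congrArg (fun L ↦ L u) h1
    have h3 : fderiv ℝ s x₀ u = u := by
      rw [hsnd x₀ hxU, hd1 x₀ hxU, hF0]; simp
    refine Eq.trans (by rfl) (h2.trans ?_)
    simp [hf0, hs0, h3]
  obtain ⟨φ, hφψ, hφx, hφU, hφs, hφs'⟩ :=
    exists_openPartialHomeomorph_of_contDiffOn hU'o hψ hxU' _ hDψ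
  have hφψ' : (φ : 𝔼 n → 𝔼 n) = ψ := funext hφψ
  refine ⟨φ, hφx, fun x hx ↦ hUΩ (hφU hx).1, hφs, hφs',
    fun x ↦ τ x + (f x)⁻¹ • fderiv ℝ f x, ?_, ?_⟩
  · have h1 := ((hf.mono fun x hx ↦ (hφU hx).1).inv fun x hx ↦ (hφU hx).2).smul
      ((hf.fderiv_of_isOpen hU (m := ∞) (by simp)).mono fun x hx ↦ (hφU hx).1)
    exact (hτ.mono fun x hx ↦ hUΩ (hφU hx).1).add h1
  · intro x hx v w
    rw [hφψ']
    have hxU := (hφU hx).1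
    have hfx : f x ≠ 0 := (hφU hx).2
    have hn := hU'o.mem_nhds (hφU hx)
    have ddfst : ∀ v w, fderiv ℝ (fderiv ℝ f) x v w =
        (fderiv ℝ (fderiv ℝ (fun y ↦ (F y).1)) x v w).1 := by
      intro v w
      have c1 := (((((hF1.contDiffAt (hU.mem_nhds hxU)).fderiv_right (m := ∞)
        (by simp)).differentiableAt (by simp)).hasFDerivAt).clm_apply (hasFDerivAt_const w x)).fst
      have c2 := (((((hf.contDiffAt (hU.mem_nhds hxU)).fderiv_right (m := ∞)
        (by simp)).differentiableAt (by simp)).hasFDerivAt).clm_apply (hasFDerivAt_const w x))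
      have c3 : (fun y ↦ (fderiv ℝ (fun y ↦ (F y).1) y w).1) =ᶠ[𝓝 x] fun y ↦ fderiv ℝ f y w := by
        filter_upwards [hU.mem_nhds hxU] with y hy using (hfst y hy w).symm
      have c4 := congrArg (fun L ↦ L v) ((c1.congr_of_eventuallyEq c3.symm).unique c2)
      simpa using c4.symm
    have ddsnd : ∀ v w, fderiv ℝ (fderiv ℝ s) x v w =
        (fderiv ℝ (fderiv ℝ (fun y ↦ (F y).1)) x v w).2 := by
      intro v w
      have c1 := (((((hF1.contDiffAt (hU.mem_nhds hxU)).fderiv_right (m := ∞)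
        (by simp)).differentiableAt (by simp)).hasFDerivAt).clm_apply (hasFDerivAt_const w x)).snd
      have c2 := (((((hs.contDiffAt (hU.mem_nhds hxU)).fderiv_right (m := ∞)
        (by simp)).differentiableAt (by simp)).hasFDerivAt).clm_apply (hasFDerivAt_const w x))
      have c3 : (fun y ↦ (fderiv ℝ (fun y ↦ (F y).1) y w).2) =ᶠ[𝓝 x] fun y ↦ fderiv ℝ s y w := by
        filter_upwards [hU.mem_nhds hxU] with y hy using (hsnd y hy w).symm
      have c4 := congrArg (fun L ↦ L v) ((c1.congr_of_eventuallyEq c3.symm).unique c2)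
      simpa using c4.symm
    have hle : (2 : WithTop ℕ∞) ≤ ∞ := by norm_cast
    refine (fderiv_fderiv_of_quotient (f := f) (s := s) (ψ := ψ)
      ((hf.contDiffAt (hU.mem_nhds hxU)).of_le hle) ((hψ.contDiffAt hn).of_le hle) ?_ hfx v w
      (Γ x v w) (τ x v) (τ x w) (τ x (Γ x v w) - τ x v * τ x w + localSchouten Γ x v w -
        fderiv ℝ τ x v w) ?_ ?_).trans ?_
    · filter_upwards [hn] with y hy
      exact (smul_inv_smul₀ hy.2 _).symm
    · rw [ddfst, hdd x hxU, hfst x hxU, hfst x hxU, hfst x hxU]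
      simp [hfdef]
    · rw [ddsnd, hdd x hxU, hsnd x hxU, hsnd x hxU, hsnd x hxU]
      simp [hsdef]
    · simp

/-! ### Vector fields in charts -/

section Charts

variable {n : ℕ} {M : Type*} [TopologicalSpace M] [ChartedSpace (EuclideanSpace ℝ (Fin n)) M]
  [IsManifold (𝓡 n) ∞ M]

/-- The vector field `Y` is differentiable at `x`. -/
abbrev IsMDiffFieldAt (Y : Π x : M, TangentSpace (𝓡 n) x) (x : M) : Prop :=
  MDifferentiableAt (𝓡 n) ((𝓡 n).prod 𝓘(ℝ, EuclideanSpace ℝ (Fin n)))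
    (fun y ↦ TotalSpace.mk' (EuclideanSpace ℝ (Fin n)) y (Y y)) x

/-- The vector field `Y` is smooth at `x`. -/
abbrev IsSmoothFieldAt (Y : Π x : M, TangentSpace (𝓡 n) x) (x : M) : Prop :=
  ContMDiffAt (𝓡 n) ((𝓡 n).prod 𝓘(ℝ, EuclideanSpace ℝ (Fin n))) ∞
    (fun y ↦ TotalSpace.mk' (EuclideanSpace ℝ (Fin n)) y (Y y)) x

/-- A chart of `M`, smooth in both directions, with values in the model space. -/
structure IsSmoothChart (e : OpenPartialHomeomorph M (𝔼 n)) : Prop where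
  contMDiffOn : ContMDiffOn (𝓡 n) (𝓡 n) ∞ e e.source
  contMDiffOn_symm : ContMDiffOn (𝓡 n) (𝓡 n) ∞ e.symm e.target

lemma isSmoothChart_of_mem_atlas {e : OpenPartialHomeomorph M (𝔼 n)}
    (he : e ∈ atlas (𝔼 n) M) : IsSmoothChart e where
  contMDiffOn := contMDiffOn_of_mem_maximalAtlas (IsManifold.subset_maximalAtlas he)
  contMDiffOn_symm := contMDiffOn_symm_of_mem_maximalAtlas (IsManifold.subset_maximalAtlas he)

/-- The derivative at `y` of the chart `e`. -/
def chartDeriv (e : OpenPartialHomeomorph M (𝔼 n)) (y : M) :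
    TangentSpace (𝓡 n) y →L[ℝ] 𝔼 n := mfderiv (𝓡 n) (𝓡 n) e y

/-- The expression of a vector field in a chart. -/
def coordField (e : OpenPartialHomeomorph M (𝔼 n)) (Y : Π x : M, TangentSpace (𝓡 n) x)
    (u : 𝔼 n) : 𝔼 n := chartDeriv e (e.symm u) (Y (e.symm u))

/-- The vector field with a given expression in a chart. Outside the domain of the chart it has no
meaning. -/
def fieldOfCoord (e : OpenPartialHomeomorph M (𝔼 n)) (Z : 𝔼 n → 𝔼 n) (y : M) :
    TangentSpace (𝓡 n) y := (chartDeriv e y).inverse (Z (e y))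

variable {e : OpenPartialHomeomorph M (𝔼 n)} {y : M}

omit [IsManifold (𝓡 n) ∞ M]

namespace IsSmoothChart

lemma mdifferentiable (he : IsSmoothChart e) : e.MDifferentiable (𝓡 n) (𝓡 n) :=
  ⟨he.contMDiffOn.mdifferentiableOn (by simp), he.contMDiffOn_symm.mdifferentiableOn (by simp)⟩

lemma contMDiffAt (he : IsSmoothChart e) (hy : y ∈ e.source) :
    ContMDiffAt (𝓡 n) (𝓡 n) ∞ e y :=
  he.contMDiffOn.contMDiffAt (e.open_source.mem_nhds hy)

lemma contMDiffAt_symm (he : IsSmoothChart e) {u : 𝔼 n} (hu : u ∈ e.target) :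
    ContMDiffAt (𝓡 n) (𝓡 n) ∞ e.symm u :=
  he.contMDiffOn_symm.contMDiffAt (e.open_target.mem_nhds hu)

lemma isInvertible (he : IsSmoothChart e) (hy : y ∈ e.source) :
    (chartDeriv e y).IsInvertible :=
  ⟨he.mdifferentiable.mfderiv hy, rfl⟩

lemma chartDeriv_inverse (he : IsSmoothChart e) (hy : y ∈ e.source) (v : 𝔼 n) :
    chartDeriv e y ((chartDeriv e y).inverse v) = v :=
  (he.isInvertible hy).self_apply_inverse v

lemma inverse_chartDeriv (he : IsSmoothChart e) (hy : y ∈ e.source) (v : TangentSpace (𝓡 n) y) :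
    (chartDeriv e y).inverse (chartDeriv e y v) = v :=
  (he.isInvertible hy).inverse_apply_self v

lemma chartDeriv_injective (he : IsSmoothChart e) (hy : y ∈ e.source) :
    Function.Injective (chartDeriv e y) :=
  Function.LeftInverse.injective (he.inverse_chartDeriv hy)

lemma mfderiv_symm_eq (he : IsSmoothChart e) {u : 𝔼 n} (hu : u ∈ e.target) :
    (mfderiv (𝓡 n) (𝓡 n) e.symm u).inverse = chartDeriv e (e.symm u) := by
  have h : mfderiv (𝓡 n) (𝓡 n) e.symm u =
      ((he.mdifferentiable.symm.mfderiv hu : TangentSpace (𝓡 n) u ≃L[ℝ] TangentSpace (𝓡 n) (e.symm u)) :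
        TangentSpace (𝓡 n) u →L[ℝ] TangentSpace (𝓡 n) (e.symm u)) := rfl
  rw [h, ContinuousLinearMap.inverse_equiv]
  rfl

lemma isInvertible_symm (he : IsSmoothChart e) {u : 𝔼 n} (hu : u ∈ e.target) :
    (mfderiv (𝓡 n) (𝓡 n) e.symm u).IsInvertible :=
  ⟨he.mdifferentiable.symm.mfderiv hu, rfl⟩

lemma coordField_eq (he : IsSmoothChart e) (Y : Π x : M, TangentSpace (𝓡 n) x) {u : 𝔼 n}
    (hu : u ∈ e.target) :
    coordField e Y u = VectorField.mpullback (𝓡 n) (𝓡 n) e.symm Y u := by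
  rw [VectorField.mpullback_apply, he.mfderiv_symm_eq hu]
  rfl

lemma coordField_eventuallyEq (he : IsSmoothChart e) (Y : Π x : M, TangentSpace (𝓡 n) x) {u : 𝔼 n}
    (hu : u ∈ e.target) :
    coordField e Y =ᶠ[𝓝 u] VectorField.mpullback (𝓡 n) (𝓡 n) e.symm Y := by
  filter_upwards [e.open_target.mem_nhds hu] with w hw using he.coordField_eq Y hw

end IsSmoothChart

lemma coordField_apply (hy : y ∈ e.source) (Y : Π x : M, TangentSpace (𝓡 n) x) :
    coordField e Y (e y) = chartDeriv e y (Y y) := by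
  rw [coordField, e.left_inv hy]

omit [ChartedSpace (EuclideanSpace ℝ (Fin n)) M] in
lemma tendsto_symm (hy : y ∈ e.source) : Filter.Tendsto e.symm (𝓝 (e y)) (𝓝 y) := by
  have := e.continuousAt_symm (e.map_source hy)
  rwa [ContinuousAt, e.left_inv hy] at this

lemma coordField_congr (hy : y ∈ e.source) {Y Z : Π x : M, TangentSpace (𝓡 n) x}
    (h : ∀ᶠ x in 𝓝 y, Y x = Z x) : coordField e Y =ᶠ[𝓝 (e y)] coordField e Z := by
  filter_upwards [(tendsto_symm hy).eventually h] with u hu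
  simp only [coordField, hu]

lemma coordField_fieldOfCoord (he : IsSmoothChart e) (Z : 𝔼 n → 𝔼 n) {u : 𝔼 n}
    (hu : u ∈ e.target) : coordField e (fieldOfCoord e Z) u = Z u := by
  rw [coordField, fieldOfCoord, he.chartDeriv_inverse (e.map_target hu), e.right_inv hu]

lemma fieldOfCoord_coordField (he : IsSmoothChart e) (Y : Π x : M, TangentSpace (𝓡 n) x)
    (hy : y ∈ e.source) : fieldOfCoord e (coordField e Y) y = Y y := by
  rw [fieldOfCoord, coordField_apply hy, he.inverse_chartDeriv hy]

variable [IsManifold (𝓡 n) ∞ M]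

lemma isSmoothFieldAt_fieldOfCoord (he : IsSmoothChart e) {Z : 𝔼 n → 𝔼 n} (hy : y ∈ e.source)
    (hZ : ContDiffAt ℝ ∞ Z (e y)) : IsSmoothFieldAt (fieldOfCoord e Z) y := by
  have : IsManifold (𝓡 n) (∞ + 1) M := ‹IsManifold (𝓡 n) ∞ M›
  have h := contMDiffAt_vectorSpace_iff_contDiffAt.2 hZ
  have h2 := ContMDiffAt.mpullback_vectorField_preimage (n := ∞) (m := ∞) h
    (he.contMDiffAt hy) (he.isInvertible hy) (by norm_cast)
  exact h2

lemma isMDiffFieldAt_fieldOfCoord (he : IsSmoothChart e) {Z : 𝔼 n → 𝔼 n} (hy : y ∈ e.source)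
    (hZ : DifferentiableAt ℝ Z (e y)) : IsMDiffFieldAt (fieldOfCoord e Z) y := by
  have : IsManifold (𝓡 n) 2 M := IsManifold.of_le (n := ∞) (by norm_cast)
  have h : IsMDiffFieldAt (M := 𝔼 n) Z (e y) := by
    refine (mdifferentiableAt_totalSpace _ _).2 ?_
    refine ⟨mdifferentiableAt_id, ?_⟩
    convert! hZ.mdifferentiableAt with y
    simp
  exact h.mpullback_vectorField (he.contMDiffAt hy) (he.isInvertible hy)
    (by norm_cast)

lemma contDiffAt_coordField (he : IsSmoothChart e) {Y : Π x : M, TangentSpace (𝓡 n) x}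
    (hy : y ∈ e.source) (hY : IsSmoothFieldAt Y y) : ContDiffAt ℝ ∞ (coordField e Y) (e y) := by
  have : IsManifold (𝓡 n) (∞ + 1) M := ‹IsManifold (𝓡 n) ∞ M›
  have hu := e.map_source hy
  rw [← e.left_inv hy] at hY
  have h2 := ContMDiffAt.mpullback_vectorField_preimage (n := ∞) (m := ∞) hY
    (he.contMDiffAt_symm hu) (he.isInvertible_symm hu) (by norm_cast)
  exact (contMDiffAt_vectorSpace_iff_contDiffAt.1 h2).congr_of_eventuallyEq
    (he.coordField_eventuallyEq Y hu)

lemma differentiableAt_coordField (he : IsSmoothChart e) {Y : Π x : M, TangentSpace (𝓡 n) x}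
    (hy : y ∈ e.source) (hY : IsMDiffFieldAt Y y) : DifferentiableAt ℝ (coordField e Y) (e y) := by
  have : IsManifold (𝓡 n) 2 M := IsManifold.of_le (n := ∞) (by norm_cast)
  have hu := e.map_source hy
  rw [← e.left_inv hy] at hY
  have h2 := MDifferentiableAt.mpullback_vectorField hY
    (he.contMDiffAt_symm hu) (he.isInvertible_symm hu) (by norm_cast)
  have h3 := (contMDiff_snd_tangentBundle_modelSpace (n := 1) (𝔼 n) 𝓘(ℝ, 𝔼 n)).contMDiffAt.mdifferentiableAt
    one_ne_zero |>.comp _ h2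
  exact h3.differentiableAt.congr_of_eventuallyEq (he.coordField_eventuallyEq Y hu)

lemma isMDiffFieldAt_iff (he : IsSmoothChart e) {Y : Π x : M, TangentSpace (𝓡 n) x}
    (hy : y ∈ e.source) : IsMDiffFieldAt Y y ↔ DifferentiableAt ℝ (coordField e Y) (e y) := by
  refine ⟨differentiableAt_coordField he hy, fun h ↦ ?_⟩
  refine (isMDiffFieldAt_fieldOfCoord he hy h).congr_of_eventuallyEq ?_
  filter_upwards [e.open_source.mem_nhds hy] with z hz
  rw [fieldOfCoord_coordField he Y hz]

/-- The Lie bracket of vector fields, in a chart. -/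
lemma chartDeriv_mlieBracket (he : IsSmoothChart e) {X Y : Π x : M, TangentSpace (𝓡 n) x}
    (hy : y ∈ e.source) (hX : IsMDiffFieldAt X y) (hY : IsMDiffFieldAt Y y) :
    chartDeriv e y (VectorField.mlieBracket (𝓡 n) X Y y) =
      fderiv ℝ (coordField e Y) (e y) (chartDeriv e y (X y)) -
        fderiv ℝ (coordField e X) (e y) (chartDeriv e y (Y y)) := by
  have : IsManifold (𝓡 n) 2 M := IsManifold.of_le (n := ∞) (by norm_cast)
  have : IsManifold (𝓡 n) (minSmoothness ℝ 2) M := by simpa using this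
  have hu := e.map_source hy
  rw [← coordField_apply hy, ← coordField_apply hy, ← coordField_apply hy, he.coordField_eq _ hu]
  rw [← e.left_inv hy] at hX hY
  have := VectorField.mpullback_mlieBracket hX hY (he.contMDiffAt_symm hu)
    (by simp; norm_cast)
  rw [this, (((he.coordField_eventuallyEq X hu).symm).mlieBracket_vectorField_eq
    ((he.coordField_eventuallyEq Y hu).symm))]
  have h (A B : Π x : 𝔼 n, TangentSpace (𝓡 n) x) : VectorField.mlieBracket (𝓡 n) A B =
      VectorField.lieBracket ℝ A B := by
    rw [← VectorField.mlieBracketWithin_univ, VectorField.mlieBracketWithin_eq_lieBracketWithin]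
    exact VectorField.lieBracketWithin_univ
  exact congrFun (h (coordField e X) (coordField e Y)) (e y)

end Charts

/-! ### Christoffel symbols -/

section Christoffel

variable {n : ℕ} {M : Type*} [TopologicalSpace M] [ChartedSpace (EuclideanSpace ℝ (Fin n)) M]
  [IsManifold (𝓡 n) ∞ M] {e : OpenPartialHomeomorph M (𝔼 n)} {y : M}

omit [IsManifold (𝓡 n) ∞ M] in
/-- The derivative of a function, in a chart. -/
lemma mvfderiv_eq_fderiv_comp_symm (he : IsSmoothChart e) (hy : y ∈ e.source) {g : M → ℝ}
    (hg : MDifferentiableAt (𝓡 n) 𝓘(ℝ, ℝ) g y) (v : TangentSpace (𝓡 n) y) :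
    mvfderiv (𝓡 n) g y v = fderiv ℝ (g ∘ e.symm) (e y) (chartDeriv e y v) := by
  have hu := e.map_source hy
  have h1 : MDifferentiableAt (𝓡 n) 𝓘(ℝ, ℝ) (g ∘ e.symm) (e y) := by
    rw [← e.left_inv hy] at hg
    exact hg.comp _ (he.mdifferentiable.mdifferentiableAt_symm hu)
  have h2 := mfderiv_comp y h1 (he.mdifferentiable.mdifferentiableAt hy)
  have h3 : (g ∘ e.symm) ∘ e =ᶠ[𝓝 y] g := by
    filter_upwards [e.open_source.mem_nhds hy] with z hz
    simp [e.left_inv hz]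
  rw [h3.mfderiv_eq, mfderiv_eq_fderiv] at h2
  exact congrArg (fun L : 𝔼 n →L[ℝ] ℝ ↦ L v) h2

omit [IsManifold (𝓡 n) ∞ M] in
lemma differentiableAt_comp_symm (he : IsSmoothChart e) (hy : y ∈ e.source) {g : M → ℝ}
    (hg : MDifferentiableAt (𝓡 n) 𝓘(ℝ, ℝ) g y) : DifferentiableAt ℝ (g ∘ e.symm) (e y) := by
  rw [← e.left_inv hy] at hg
  exact (hg.comp _ (he.mdifferentiable.mdifferentiableAt_symm (e.map_source hy))).differentiableAt

/-- The connection operator `cov` has the Christoffel symbols `G` at the point `y` in the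
chart `e`: with `Ŷ` the expression of `Y` in the chart, `∇_v Y` is represented by
`DŶ(v) + G(v, Ŷ)`. The first argument of `G` is the direction of differentiation. -/
def HasChristoffelAt (e : OpenPartialHomeomorph M (𝔼 n))
    (cov : (Π x : M, TangentSpace (𝓡 n) x) →
      Π x : M, TangentSpace (𝓡 n) x →L[ℝ] TangentSpace (𝓡 n) x)
    (y : M) (G : 𝔼 n →L[ℝ] 𝔼 n →L[ℝ] 𝔼 n) : Prop :=
  ∀ Y : Π x : M, TangentSpace (𝓡 n) x, IsMDiffFieldAt Y y → ∀ v : TangentSpace (𝓡 n) y,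
    chartDeriv e y (cov Y y v) = fderiv ℝ (coordField e Y) (e y) (chartDeriv e y v) +
      G (chartDeriv e y v) (chartDeriv e y (Y y))

/-- The connection on the domain of a chart with given Christoffel symbols. -/
def chartConnection (e : OpenPartialHomeomorph M (𝔼 n)) (Γ : 𝔼 n → 𝔼 n →L[ℝ] 𝔼 n →L[ℝ] 𝔼 n)
    (Y : Π x : M, TangentSpace (𝓡 n) x) (y : M) :
    TangentSpace (𝓡 n) y →L[ℝ] TangentSpace (𝓡 n) y :=
  (chartDeriv e y).inverse ∘L
    (fderiv ℝ (coordField e Y) (e y) + (Γ (e y)).flip (chartDeriv e y (Y y))) ∘L chartDeriv e y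

omit [IsManifold (𝓡 n) ∞ M] in
lemma chartDeriv_chartConnection (he : IsSmoothChart e) (hy : y ∈ e.source)
    (Γ : 𝔼 n → 𝔼 n →L[ℝ] 𝔼 n →L[ℝ] 𝔼 n) (Y : Π x : M, TangentSpace (𝓡 n) x)
    (v : TangentSpace (𝓡 n) y) :
    chartDeriv e y (chartConnection e Γ Y y v) =
      fderiv ℝ (coordField e Y) (e y) (chartDeriv e y v) +
        Γ (e y) (chartDeriv e y v) (chartDeriv e y (Y y)) :=
  he.chartDeriv_inverse hy _

lemma isCovariantDerivativeOn_chartConnection (he : IsSmoothChart e)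
    (Γ : 𝔼 n → 𝔼 n →L[ℝ] 𝔼 n →L[ℝ] 𝔼 n) :
    IsCovariantDerivativeOn (𝔼 n) (chartConnection e Γ) e.source where
  add {σ σ' x} hσ hσ' hx := by
    ext1 v
    apply he.chartDeriv_injective hx
    have h1 := differentiableAt_coordField he hx hσ
    have h2 := differentiableAt_coordField he hx hσ'
    have h3 : coordField e (σ + σ') = coordField e σ + coordField e σ' := by
      ext1 u; simp [coordField]
    change _ = chartDeriv e x (chartConnection e Γ σ x v + chartConnection e Γ σ' x v)
    rw [map_add (chartDeriv e x), chartDeriv_chartConnection he hx,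
      chartDeriv_chartConnection he hx, chartDeriv_chartConnection he hx, h3, fderiv_add h1 h2,
      add_apply, Pi.add_apply, map_add, map_add]
    abel
  leibniz {σ g x} hσ hg hx := by
    ext1 v
    apply he.chartDeriv_injective hx
    have h1 := differentiableAt_coordField he hx hσ
    have h2 := differentiableAt_comp_symm he hx hg
    have h3 : coordField e (g • σ) = (g ∘ e.symm) • coordField e σ := by
      ext1 u; simp [coordField]
    change _ = chartDeriv e x (g x • chartConnection e Γ σ x v + mvfderiv (𝓡 n) g x v • σ x)
    rw [map_add (chartDeriv e x), map_smul (chartDeriv e x), map_smul (chartDeriv e x),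
      chartDeriv_chartConnection he hx, chartDeriv_chartConnection he hx, h3, fderiv_smul h2 h1,
      mvfderiv_eq_fderiv_comp_symm he hx hg, coordField_apply hx, Pi.smul_apply', map_smul,
      map_smul, Function.comp_apply, e.left_inv hx, add_apply, smul_apply,
      ContinuousLinearMap.smulRight_apply]
    module

/-- A connection differs on the domain of a chart from the flat connection of the chart by a tensor,
which is the family of its Christoffel symbols. -/
lemma exists_hasChristoffelAt (he : IsSmoothChart e) (cov : AffineConnection n M) :
    ∃ Γ : 𝔼 n → 𝔼 n →L[ℝ] 𝔼 n →L[ℝ] 𝔼 n, ∀ y ∈ e.source, HasChristoffelAt e cov y (Γ (e y)) := by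
  have h1 := isCovariantDerivativeOn_chartConnection he 0
  have h2 := cov.isCovariantDerivativeOn (s := e.source)
  let B (y : M) : 𝔼 n →L[ℝ] 𝔼 n →L[ℝ] 𝔼 n := h2.difference h1 y
  let L (y : M) : 𝔼 n →L[ℝ] 𝔼 n := chartDeriv e y
  let L' (y : M) : 𝔼 n →L[ℝ] 𝔼 n := (chartDeriv e y).inverse
  refine ⟨fun u ↦ (((ContinuousLinearMap.compL ℝ (𝔼 n) (𝔼 n) (𝔼 n)) (L (e.symm u))).comp
    ((B (e.symm u)).bilinearComp (L' (e.symm u)) (L' (e.symm u)))).flip, fun y hy Y hY v ↦ ?_⟩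
  have h3 := congrArg (fun A ↦ A v) (h2.difference_apply h1 hy hY)
  have h4 : cov Y y v = chartConnection e 0 Y y v + h2.difference h1 y (Y y) v := by
    rw [h3]; simp
  rw [h4, map_add, chartDeriv_chartConnection he hy]
  simp only [Pi.zero_apply, zero_apply, add_zero, e.left_inv hy]
  congr 1
  change _ = chartDeriv e y (h2.difference h1 y ((chartDeriv e y).inverse (chartDeriv e y (Y y)))
    ((chartDeriv e y).inverse (chartDeriv e y v)))
  rw [he.inverse_chartDeriv hy, he.inverse_chartDeriv hy]

/-- The Christoffel symbols are the covariant derivatives of the fields which are constant in the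
chart. -/
lemma HasChristoffelAt.apply_eq {G : 𝔼 n →L[ℝ] 𝔼 n →L[ℝ] 𝔼 n}
    {cov : (Π x : M, TangentSpace (𝓡 n) x) →
      Π x : M, TangentSpace (𝓡 n) x →L[ℝ] TangentSpace (𝓡 n) x}
    (h : HasChristoffelAt e cov y G) (he : IsSmoothChart e) (hy : y ∈ e.source)
    {Y : Π x : M, TangentSpace (𝓡 n) x} (hY : IsMDiffFieldAt Y y) {w : 𝔼 n}
    (hYw : coordField e Y =ᶠ[𝓝 (e y)] fun _ ↦ w) (v : 𝔼 n) :
    G v w = chartDeriv e y (cov Y y ((chartDeriv e y).inverse v)) := by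
  rw [h Y hY, he.chartDeriv_inverse hy, hYw.fderiv_eq, ← coordField_apply hy, hYw.eq_of_nhds]
  simp

lemma HasChristoffelAt.symmetric_of_torsion_eq_zero {G : 𝔼 n →L[ℝ] 𝔼 n →L[ℝ] 𝔼 n}
    {cov : AffineConnection n M} (h : HasChristoffelAt e cov y G) (he : IsSmoothChart e)
    (hy : y ∈ e.source) (hcov : cov.torsion = 0) (v w : 𝔼 n) : G v w = G w v := by
  have hf (a : 𝔼 n) : IsMDiffFieldAt (fieldOfCoord e fun _ ↦ a) y :=
    isMDiffFieldAt_fieldOfCoord he hy (differentiableAt_const a)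
  have h1 (a : 𝔼 n) : coordField e (fieldOfCoord e fun _ ↦ a) =ᶠ[𝓝 (e y)] fun _ ↦ a := by
    filter_upwards [e.open_target.mem_nhds (e.map_source hy)] with u hu
    rw [coordField_fieldOfCoord he _ hu]
  have h2 := (CovariantDerivative.torsion_eq_zero_iff _).1 hcov (hf v) (hf w)
  have h3 := congrArg (chartDeriv e y) h2
  rw [chartDeriv_mlieBracket he hy (hf v) (hf w), (h1 v).fderiv_eq, (h1 w).fderiv_eq, map_sub] at h3
  simp only [fderiv_fun_const, Pi.zero_apply, zero_apply, sub_zero] at h3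
  rw [h.apply_eq he hy (hf w) (h1 w), h.apply_eq he hy (hf v) (h1 v)]
  exact sub_eq_zero.1 h3

lemma torsion_eq_zero_of_symmetric {cov : AffineConnection n M}
    (h : ∀ y : M, ∃ e : OpenPartialHomeomorph M (𝔼 n), IsSmoothChart e ∧ y ∈ e.source ∧
      ∃ G, HasChristoffelAt e cov y G ∧ ∀ v w, G v w = G w v) : cov.torsion = 0 := by
  refine (CovariantDerivative.torsion_eq_zero_iff _).2 fun {X Y y} hX hY ↦ ?_
  obtain ⟨e, he, hy, G, hG, hs⟩ := h y
  apply he.chartDeriv_injective hy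
  rw [chartDeriv_mlieBracket he hy hX hY, map_sub, hG Y hY, hG X hX, hs]
  abel

omit [IsManifold (𝓡 n) ∞ M] in
lemma chartDeriv_change (he : IsSmoothChart e) (hy : y ∈ e.source)
    {e' : OpenPartialHomeomorph M (𝔼 n)} (he' : IsSmoothChart e') (hy' : y ∈ e'.source)
    (v : TangentSpace (𝓡 n) y) :
    chartDeriv e' y v = fderiv ℝ (e' ∘ e.symm) (e y) (chartDeriv e y v) := by
  have hu := e.map_source hy
  have h4 : (e' ∘ e.symm) ∘ e =ᶠ[𝓝 y] e' := by
    filter_upwards [e.open_source.mem_nhds hy] with z hz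
    simp [e.left_inv hz]
  have h5 : MDifferentiableAt (𝓡 n) (𝓡 n) (e' ∘ e.symm) (e y) := by
    refine MDifferentiableAt.comp _ ?_ (he.mdifferentiable.mdifferentiableAt_symm hu)
    rw [e.left_inv hy]
    exact he'.mdifferentiable.mdifferentiableAt hy'
  have h6 := mfderiv_comp y h5 (he.mdifferentiable.mdifferentiableAt hy)
  rw [h4.mfderiv_eq, mfderiv_eq_fderiv] at h6
  exact congrArg (fun L : 𝔼 n →L[ℝ] 𝔼 n ↦ L v) h6

omit [IsManifold (𝓡 n) ∞ M] in
lemma contDiffAt_transition (he : IsSmoothChart e) (hy : y ∈ e.source)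
    {e' : OpenPartialHomeomorph M (𝔼 n)} (he' : IsSmoothChart e') (hy' : y ∈ e'.source) :
    ContDiffAt ℝ ∞ (e' ∘ e.symm) (e y) :=
  (ContMDiffAt.comp (e y) (by rw [e.left_inv hy]; exact he'.contMDiffAt hy')
    (he.contMDiffAt_symm (e.map_source hy))).contDiffAt

/-- Transformation of the Christoffel symbols under a change of chart. The transition map `T` need
only be given near the point. -/
lemma HasChristoffelAt.change {G G' : 𝔼 n →L[ℝ] 𝔼 n →L[ℝ] 𝔼 n}
    {cov : (Π x : M, TangentSpace (𝓡 n) x) →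
      Π x : M, TangentSpace (𝓡 n) x →L[ℝ] TangentSpace (𝓡 n) x}
    (h : HasChristoffelAt e cov y G) (he : IsSmoothChart e) (hy : y ∈ e.source)
    {e' : OpenPartialHomeomorph M (𝔼 n)} (he' : IsSmoothChart e') (hy' : y ∈ e'.source)
    {T : 𝔼 n → 𝔼 n} (hT : T =ᶠ[𝓝 (e y)] e' ∘ e.symm)
    (hG : ∀ v w, G' (fderiv ℝ T (e y) v) (fderiv ℝ T (e y) w) =
      fderiv ℝ T (e y) (G v w) - fderiv ℝ (fderiv ℝ T) (e y) v w) :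
    HasChristoffelAt e' cov y G' := by
  have hu := e.map_source hy
  have hTs : ContDiffAt ℝ ∞ T (e y) :=
    (contDiffAt_transition he hy he' hy').congr_of_eventuallyEq hT
  have hsource : ∀ᶠ u in 𝓝 (e y), e.symm u ∈ e'.source :=
    (tendsto_symm hy).eventually (e'.open_source.mem_nhds hy')
  have hD : ∀ᶠ u in 𝓝 (e y), ∀ v : TangentSpace (𝓡 n) (e.symm u),
      chartDeriv e' (e.symm u) v = fderiv ℝ T u (chartDeriv e (e.symm u) v) := by
    filter_upwards [hsource, e.open_target.mem_nhds hu, hT.eventuallyEq_nhds] with u h1 h2 h3 v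
    rw [chartDeriv_change he (e.map_target h2) he' h1, e.right_inv h2, h3.fderiv_eq]
  have hDy (v : TangentSpace (𝓡 n) y) : chartDeriv e' y v = fderiv ℝ T (e y) (chartDeriv e y v) := by
    have := hD.self_of_nhds
    rw [e.left_inv hy] at this
    exact this v
  intro Y hY v
  have hTy : T (e y) = e' y := by rw [hT.eq_of_nhds]; simp [e.left_inv hy]
  -- the expressions of `Y` in the two charts are related by the derivative of the transition map
  have hrel : coordField e' Y ∘ T =ᶠ[𝓝 (e y)] fun u ↦ fderiv ℝ T u (coordField e Y u) := by
    filter_upwards [hsource, hD, hT] with u h1 h2 h3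
    rw [Function.comp_apply, h3, Function.comp_apply, coordField_apply h1, h2]
    rfl
  have hdY := differentiableAt_coordField he hy hY
  have hdY' := differentiableAt_coordField he' hy' hY
  have hd2 : DifferentiableAt ℝ (fderiv ℝ T) (e y) :=
    (hTs.fderiv_right (m := ∞) (by norm_cast)).differentiableAt (by simp)
  have h8 := hrel.fderiv_eq (𝕜 := ℝ)
  have hcomp : fderiv ℝ (coordField e' Y ∘ T) (e y) =
      fderiv ℝ (coordField e' Y) (e' y) ∘L fderiv ℝ T (e y) := by
    rw [← hTy] at hdY' ⊢
    exact fderiv_comp _ hdY' (hTs.differentiableAt (by simp))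
  rw [hcomp, fderiv_clm_apply hd2 hdY] at h8
  have h9 : fderiv ℝ (coordField e' Y) (e' y) (fderiv ℝ T (e y) (chartDeriv e y v)) =
      fderiv ℝ T (e y) (fderiv ℝ (coordField e Y) (e y) (chartDeriv e y v)) +
        fderiv ℝ (fderiv ℝ T) (e y) (chartDeriv e y v) (coordField e Y (e y)) :=
    congrArg (fun L : 𝔼 n →L[ℝ] 𝔼 n ↦ L (chartDeriv e y v)) h8
  rw [coordField_apply hy] at h9
  rw [hDy, hDy, hDy, h9, h Y hY, hG, map_add]
  abel

end Christoffel

section ChristoffelSmooth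

variable {n : ℕ} {M : Type*} [TopologicalSpace M] [ChartedSpace (EuclideanSpace ℝ (Fin n)) M]
  [IsManifold (𝓡 n) ∞ M] {e : OpenPartialHomeomorph M (𝔼 n)} {y : M}

omit [IsManifold (𝓡 n) ∞ M] in
lemma coordField_fieldOfCoord_eventuallyEq (he : IsSmoothChart e) (hy : y ∈ e.source)
    (Z : 𝔼 n → 𝔼 n) : coordField e (fieldOfCoord e Z) =ᶠ[𝓝 (e y)] Z := by
  filter_upwards [e.open_target.mem_nhds (e.map_source hy)] with u hu
  rw [coordField_fieldOfCoord he _ hu]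

/-- A vector field given by its smooth expression in a chart agrees near a point of the domain
with a smooth vector field on the whole manifold. -/
lemma exists_contMDiff_coordField_eventuallyEq [T2Space M] (he : IsSmoothChart e)
    (hy : y ∈ e.source) {Z : 𝔼 n → 𝔼 n} (hZ : ContDiff ℝ ∞ Z) :
    ∃ Y : Π x : M, TangentSpace (𝓡 n) x, (∀ x, IsSmoothFieldAt Y x) ∧
      coordField e Y =ᶠ[𝓝 (e y)] Z := by
  obtain ⟨χ, hχ, -⟩ := (SmoothBumpFunction.nhds_basis_support (I := 𝓡 n)
    (e.open_source.mem_nhds hy)).mem_iff.1 Filter.univ_mem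
  refine ⟨(χ : M → ℝ) • fieldOfCoord e Z, ?_, ?_⟩
  · refine ContMDiffOn.smul_section_of_tsupport (u := e.source) χ.contMDiff.contMDiffOn
      e.open_source hχ fun x hx ↦ ?_
    exact (isSmoothFieldAt_fieldOfCoord he hx hZ.contDiffAt).contMDiffWithinAt
  · refine Filter.EventuallyEq.trans (coordField_congr hy ?_)
      (coordField_fieldOfCoord_eventuallyEq he hy Z)
    filter_upwards [χ.eventuallyEq_one] with x hx
    simp [hx]

lemma IsSmoothFieldAt.isMDiffFieldAt {Y : Π x : M, TangentSpace (𝓡 n) x} (h : IsSmoothFieldAt Y y) :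
    IsMDiffFieldAt Y y :=
  ContMDiffAt.mdifferentiableAt h (by simp)

/-- The Christoffel symbols of a smooth connection are smooth. As smoothness of the connection is a
statement about globally defined vector fields, the coordinate fields have to be cut off first. -/
lemma contDiffOn_of_hasChristoffelAt [T2Space M] (he : IsSmoothChart e)
    {cov : AffineConnection n M} (hcov : cov.ContMDiffCovariantDerivative ∞)
    {Γ : 𝔼 n → 𝔼 n →L[ℝ] 𝔼 n →L[ℝ] 𝔼 n} (hΓ : ∀ y ∈ e.source, HasChristoffelAt e cov y (Γ (e y))) :
    ContDiffOn ℝ ∞ Γ e.target := by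
  refine contDiffOn_clm_apply.2 fun v ↦ contDiffOn_clm_apply.2 fun w ↦ fun u hu ↦ ?_
  refine ContDiffAt.contDiffWithinAt ?_
  have hy := e.map_target hu
  obtain ⟨X, hX, hXv⟩ := exists_contMDiff_coordField_eventuallyEq he hy (contDiff_const (c := v))
  obtain ⟨Y, hY, hYw⟩ := exists_contMDiff_coordField_eventuallyEq he hy (contDiff_const (c := w))
  have h1 := hcov.contMDiff.contMDiff (σ := Y) (fun x _ ↦ (hY x).contMDiffWithinAt)
    |>.contMDiffAt (Filter.univ_mem (f := 𝓝 (e.symm u)))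
  have h2 : IsSmoothFieldAt (fun y ↦ cov Y y (X y)) (e.symm u) :=
    ContMDiffAt.clm_bundle_apply h1 (hX _)
  have h3 := contDiffAt_coordField he hy h2
  rw [e.right_inv hu] at h3 hXv hYw
  refine h3.congr_of_eventuallyEq ?_
  filter_upwards [hXv, hYw.eventuallyEq_nhds, e.open_target.mem_nhds hu] with z hz1 hz2 hz3
  have hz := e.map_target hz3
  have h4 := hΓ _ hz
  rw [e.right_inv hz3] at h4
  rw [h4.apply_eq he hz (hY _).isMDiffFieldAt (by rwa [e.right_inv hz3])]
  change _ = chartDeriv e (e.symm z) (cov Y (e.symm z) (X (e.symm z)))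
  rw [← hz1, coordField, he.inverse_chartDeriv hz]

end ChristoffelSmooth

/-! ### Curvature in charts -/

section CurvatureInCharts

variable {n : ℕ} {M : Type*} [TopologicalSpace M] [ChartedSpace (EuclideanSpace ℝ (Fin n)) M]
  [IsManifold (𝓡 n) ∞ M] {e : OpenPartialHomeomorph M (𝔼 n)} {y : M}
  {cov : AffineConnection n M} {Γ : 𝔼 n → 𝔼 n →L[ℝ] 𝔼 n →L[ℝ] 𝔼 n}

omit [IsManifold (𝓡 n) ∞ M] in
/-- The derivative of a function which is given near `y` by its expression in a chart. -/
lemma mvfderiv_of_eventuallyEq_comp (he : IsSmoothChart e) (hy : y ∈ e.source) {g : M → ℝ}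
    {f : 𝔼 n → ℝ} (hf : DifferentiableAt ℝ f (e y)) (hg : g =ᶠ[𝓝 y] f ∘ e)
    (v : TangentSpace (𝓡 n) y) :
    mvfderiv (𝓡 n) g y v = fderiv ℝ f (e y) (chartDeriv e y v) := by
  have h2 := mfderiv_comp y hf.mdifferentiableAt (he.mdifferentiable.mdifferentiableAt hy)
  rw [← hg.mfderiv_eq, mfderiv_eq_fderiv] at h2
  exact congrArg (fun L : 𝔼 n →L[ℝ] ℝ ↦ L v) h2

lemma isSmoothFieldAt_extend (v : TangentSpace (𝓡 n) y) :
    IsSmoothFieldAt (FiberBundle.extend (𝔼 n) v) y :=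
  FiberBundle.contMDiffAt_extend (𝓡 n) (𝔼 n) v

lemma eventually_isMDiffFieldAt_extend (v : TangentSpace (𝓡 n) y) :
    ∀ᶠ x in 𝓝 y, IsMDiffFieldAt (FiberBundle.extend (𝔼 n) v) x := by
  obtain ⟨s, hs, h⟩ := FiberBundle.exists_mdifferentiableOn_extend (𝓡 n) (𝔼 n) v
  filter_upwards [eventually_mem_nhds_iff.2 hs] with x hx using h.mdifferentiableAt hx

/-- The covariant derivative of vector fields, in a chart. -/
lemma coordField_along_eventuallyEq (hy : y ∈ e.source)
    (hΓ : ∀ y ∈ e.source, HasChristoffelAt e cov y (Γ (e y)))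
    (X : Π x : M, TangentSpace (𝓡 n) x) {Z : Π x : M, TangentSpace (𝓡 n) x}
    (hZ : ∀ᶠ x in 𝓝 y, IsMDiffFieldAt Z x) :
    coordField e (cov.along X Z) =ᶠ[𝓝 (e y)] fun u ↦
      fderiv ℝ (coordField e Z) u (coordField e X u) +
        Γ u (coordField e X u) (coordField e Z u) := by
  filter_upwards [(tendsto_symm hy).eventually hZ, e.open_target.mem_nhds (e.map_source hy)]
    with u h1 h2
  have h3 := hΓ _ (e.map_target h2) Z h1 (X (e.symm u))
  rw [e.right_inv h2] at h3
  exact h3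

/-- The curvature tensor, in a chart. -/
lemma chartDeriv_curvature (he : IsSmoothChart e) (hy : y ∈ e.source)
    (hΓ : ∀ y ∈ e.source, HasChristoffelAt e cov y (Γ (e y))) (hs : ContDiffOn ℝ ∞ Γ e.target)
    (u v w : TangentSpace (𝓡 n) y) :
    chartDeriv e y (cov.curvature y u v w) = localCurvature Γ (e y) (chartDeriv e y u)
      (chartDeriv e y v) (chartDeriv e y w) := by
  have hX' := isSmoothFieldAt_extend u
  have hY' := isSmoothFieldAt_extend v
  have hZ' := isSmoothFieldAt_extend w
  have hZe := eventually_isMDiffFieldAt_extend w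
  have hXu : FiberBundle.extend (𝔼 n) u y = u := FiberBundle.extend_apply_self _ _
  have hYv : FiberBundle.extend (𝔼 n) v y = v := FiberBundle.extend_apply_self _ _
  have hZw : FiberBundle.extend (𝔼 n) w y = w := FiberBundle.extend_apply_self _ _
  change chartDeriv e y (cov (cov.along _ _) y _ - cov (cov.along _ _) y _ -
    cov _ y (VectorField.mlieBracket (𝓡 n) _ _ y)) = _
  set X : Π x : M, TangentSpace (𝓡 n) x := FiberBundle.extend (𝔼 n) u
  set Y : Π x : M, TangentSpace (𝓡 n) x := FiberBundle.extend (𝔼 n) v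
  set Z : Π x : M, TangentSpace (𝓡 n) x := FiberBundle.extend (𝔼 n) w
  have hsΓ : DifferentiableAt ℝ Γ (e y) :=
    (hs.contDiffAt (e.open_target.mem_nhds (e.map_source hy))).differentiableAt (by simp)
  have hdX := differentiableAt_coordField he hy hX'.isMDiffFieldAt
  have hdY := differentiableAt_coordField he hy hY'.isMDiffFieldAt
  have hdZ := differentiableAt_coordField he hy hZ'.isMDiffFieldAt
  have hZ2 := contDiffAt_coordField he hy hZ'
  have hdZ2 : DifferentiableAt ℝ (fderiv ℝ (coordField e Z)) (e y) :=
    (hZ2.fderiv_right (m := ∞) (by norm_cast)).differentiableAt (by simp)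
  have hsymm : ∀ a b, fderiv ℝ (fderiv ℝ (coordField e Z)) (e y) a b =
      fderiv ℝ (fderiv ℝ (coordField e Z)) (e y) b a :=
    (hZ2.isSymmSndFDerivAt (by simp; norm_cast))
  -- the derivative of the expression of `∇_A Z` in the chart
  have key (A : Π x : M, TangentSpace (𝓡 n) x) (hA : DifferentiableAt ℝ (coordField e A) (e y)) :
      IsMDiffFieldAt (cov.along A Z) y ∧ ∀ a : 𝔼 n,
      fderiv ℝ (coordField e (cov.along A Z)) (e y) a =
        fderiv ℝ (fderiv ℝ (coordField e Z)) (e y) a (coordField e A (e y)) +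
        fderiv ℝ (coordField e Z) (e y) (fderiv ℝ (coordField e A) (e y) a) +
        (fderiv ℝ Γ (e y) a (coordField e A (e y)) (coordField e Z (e y)) +
        Γ (e y) (fderiv ℝ (coordField e A) (e y) a) (coordField e Z (e y)) +
        Γ (e y) (coordField e A (e y)) (fderiv ℝ (coordField e Z) (e y) a)) := by
    have h1 := coordField_along_eventuallyEq hy hΓ A hZe
    have h2 := (hdZ2.hasFDerivAt.clm_apply hA.hasFDerivAt).add
      ((hsΓ.hasFDerivAt.clm_apply hA.hasFDerivAt).clm_apply hdZ.hasFDerivAt)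
    have h3 := h2.congr_of_eventuallyEq h1
    refine ⟨(isMDiffFieldAt_iff he hy).2 h3.differentiableAt, fun a ↦ ?_⟩
    rw [h3.fderiv]
    simp only [add_apply, ContinuousLinearMap.comp_apply, ContinuousLinearMap.flip_apply]
    abel
  rw [map_sub, map_sub, hΓ y hy _ (key Y hdY).1, hΓ y hy _ (key X hdX).1,
    hΓ y hy Z hZ'.isMDiffFieldAt, (key Y hdY).2, (key X hdX).2,
    chartDeriv_mlieBracket he hy hX'.isMDiffFieldAt hY'.isMDiffFieldAt,
    ← coordField_apply hy (cov.along Y Z), ← coordField_apply hy (cov.along X Z),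
    (coordField_along_eventuallyEq hy hΓ Y hZe).eq_of_nhds,
    (coordField_along_eventuallyEq hy hΓ X hZe).eq_of_nhds, localCurvature_apply,
    coordField_apply hy, coordField_apply hy, coordField_apply hy, hXu, hYv, hZw,
    hsymm (chartDeriv e y v)]
  simp only [map_add, map_sub, sub_apply]
  abel

/-- The Ricci contraction, in a chart: the trace does not depend on the basis. -/
lemma ricci_eq_localRicci (he : IsSmoothChart e) (hy : y ∈ e.source)
    (hΓ : ∀ y ∈ e.source, HasChristoffelAt e cov y (Γ (e y))) (hs : ContDiffOn ℝ ∞ Γ e.target)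
    (u v : TangentSpace (𝓡 n) y) :
    cov.ricci y u v = localRicci Γ (e y) (chartDeriv e y u) (chartDeriv e y v) := by
  let L : 𝔼 n →L[ℝ] 𝔼 n := chartDeriv e y
  let L' : 𝔼 n →L[ℝ] 𝔼 n := (chartDeriv e y).inverse
  let A : 𝔼 n →L[ℝ] 𝔼 n := (localCurvature Γ (e y) (L u)).flip (L v)
  have h1 (z : 𝔼 n) : (cov.curvature y u z v : 𝔼 n) = L' ((A ∘L L) z) := by
    have h := chartDeriv_curvature he hy hΓ hs u z v
    have h2 := congrArg (chartDeriv e y).inverse h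
    rw [he.inverse_chartDeriv hy] at h2
    exact h2
  have h3 : cov.ricci y u v = ∑ i : Fin n, L' ((A ∘L L) (EuclideanSpace.single i 1)) i :=
    Finset.sum_congr rfl fun i _ ↦ congrArg (fun z : 𝔼 n ↦ z i) (h1 _)
  rw [h3, sum_comp_single_comm, localRicci_apply]
  refine Finset.sum_congr rfl fun i _ ↦ ?_
  have h4 : L (L' (EuclideanSpace.single i 1)) = EuclideanSpace.single i 1 :=
    he.chartDeriv_inverse hy _
  rw [ContinuousLinearMap.comp_apply, h4]
  rfl

lemma schouten_eq_localSchouten (he : IsSmoothChart e) (hy : y ∈ e.source)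
    (hΓ : ∀ y ∈ e.source, HasChristoffelAt e cov y (Γ (e y))) (hs : ContDiffOn ℝ ∞ Γ e.target)
    (u v : TangentSpace (𝓡 n) y) :
    cov.schouten y u v = localSchouten Γ (e y) (chartDeriv e y u) (chartDeriv e y v) := by
  rw [AffineConnection.schouten, localSchouten_apply, ricci_eq_localRicci he hy hΓ hs,
    ricci_eq_localRicci he hy hΓ hs]

lemma chartDeriv_weyl (he : IsSmoothChart e) (hy : y ∈ e.source)
    (hΓ : ∀ y ∈ e.source, HasChristoffelAt e cov y (Γ (e y))) (hs : ContDiffOn ℝ ∞ Γ e.target)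
    (u v w : TangentSpace (𝓡 n) y) :
    chartDeriv e y (cov.weyl y u v w) = localWeyl Γ (e y) (chartDeriv e y u)
      (chartDeriv e y v) (chartDeriv e y w) := by
  simp only [AffineConnection.weyl, AffineConnection.wedgeId, AffineConnection.bracket, map_add,
    map_neg, map_smul, chartDeriv_curvature he hy hΓ hs, schouten_eq_localSchouten he hy hΓ hs,
    localWeyl]
  abel

lemma cottonYork_eq_localCotton (he : IsSmoothChart e) (hy : y ∈ e.source)
    (hΓ : ∀ y ∈ e.source, HasChristoffelAt e cov y (Γ (e y))) (hs : ContDiffOn ℝ ∞ Γ e.target)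
    (u v w : TangentSpace (𝓡 n) y) :
    cov.cottonYork y u v w = localCotton Γ (e y) (chartDeriv e y u)
      (chartDeriv e y v) (chartDeriv e y w) := by
  have hX' := (isSmoothFieldAt_extend u).isMDiffFieldAt
  have hY' := (isSmoothFieldAt_extend v).isMDiffFieldAt
  have hZ' := (isSmoothFieldAt_extend w).isMDiffFieldAt
  have hXu : FiberBundle.extend (𝔼 n) u y = u := FiberBundle.extend_apply_self _ _
  have hYv : FiberBundle.extend (𝔼 n) v y = v := FiberBundle.extend_apply_self _ _
  have hZw : FiberBundle.extend (𝔼 n) w y = w := FiberBundle.extend_apply_self _ _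
  rw [AffineConnection.cottonYork, AffineConnection.dSchoutenField]
  set X : Π x : M, TangentSpace (𝓡 n) x := FiberBundle.extend (𝔼 n) u
  set Y : Π x : M, TangentSpace (𝓡 n) x := FiberBundle.extend (𝔼 n) v
  set Z : Π x : M, TangentSpace (𝓡 n) x := FiberBundle.extend (𝔼 n) w
  have hQ : DifferentiableAt ℝ (localSchouten Γ) (e y) :=
    ((contDiffOn_localSchouten e.open_target hs).contDiffAt
      (e.open_target.mem_nhds (e.map_source hy))).differentiableAt (by simp)
  have hdZ := differentiableAt_coordField he hy hZ'
  have key (A : Π x : M, TangentSpace (𝓡 n) x) (hA : DifferentiableAt ℝ (coordField e A) (e y))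
      (a : TangentSpace (𝓡 n) y) :
      mvfderiv (𝓡 n) (fun y ↦ cov.schouten y (A y) (Z y)) y a =
        fderiv ℝ (localSchouten Γ) (e y) (chartDeriv e y a) (chartDeriv e y (A y))
          (chartDeriv e y (Z y)) +
        localSchouten Γ (e y) (fderiv ℝ (coordField e A) (e y) (chartDeriv e y a))
          (chartDeriv e y (Z y)) +
        localSchouten Γ (e y) (chartDeriv e y (A y))
          (fderiv ℝ (coordField e Z) (e y) (chartDeriv e y a)) := by
    have h1 := (hQ.hasFDerivAt.clm_apply hA.hasFDerivAt).clm_apply hdZ.hasFDerivAt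
    rw [mvfderiv_of_eventuallyEq_comp he hy h1.differentiableAt, h1.fderiv]
    · simp only [add_apply, ContinuousLinearMap.comp_apply, ContinuousLinearMap.flip_apply,
        coordField_apply hy]
      abel
    · filter_upwards [e.open_source.mem_nhds hy] with z hz
      rw [schouten_eq_localSchouten he hz hΓ hs, Function.comp_apply, coordField_apply hz,
        coordField_apply hz]
  rw [key Y (differentiableAt_coordField he hy hY'), key X (differentiableAt_coordField he hy hX')]
  simp only [schouten_eq_localSchouten he hy hΓ hs, AffineConnection.along, hΓ y hy Z hZ',
    chartDeriv_mlieBracket he hy hX' hY', hXu, hYv, hZw, map_add, map_sub, sub_apply, localCotton]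
  abel

end CurvatureInCharts

/-! ### Smoothness of connections and of one-forms in charts -/

section SmoothInCharts

variable {n : ℕ} {M : Type*} [TopologicalSpace M] [ChartedSpace (EuclideanSpace ℝ (Fin n)) M]
  [IsManifold (𝓡 n) ∞ M] {e : OpenPartialHomeomorph M (𝔼 n)} {x y : M}

lemma isSmoothChart_chartAt (x : M) : IsSmoothChart (chartAt (𝔼 n) x) :=
  isSmoothChart_of_mem_atlas (chart_mem_atlas _ x)

lemma continuousLinearMapAt_eq_chartDeriv (hy : y ∈ (chartAt (𝔼 n) x).source)
    (v : TangentSpace (𝓡 n) y) :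
    (trivializationAt (𝔼 n) (TangentSpace (𝓡 n)) x).continuousLinearMapAt ℝ y v =
      chartDeriv (chartAt (𝔼 n) x) y v := by
  rw [TangentBundle.continuousLinearMapAt_trivializationAt hy]
  rfl

lemma symmL_eq_inverse_chartDeriv (hy : y ∈ (chartAt (𝔼 n) x).source) (v : 𝔼 n) :
    (trivializationAt (𝔼 n) (TangentSpace (𝓡 n)) x).symmL ℝ y v =
      (chartDeriv (chartAt (𝔼 n) x) y).inverse v := by
  apply (isSmoothChart_chartAt x).chartDeriv_injective hy
  rw [(isSmoothChart_chartAt x).chartDeriv_inverse hy, ← continuousLinearMapAt_eq_chartDeriv hy,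
    Trivialization.continuousLinearMapAt_symmL]
  simpa using hy

/-- A connection whose Christoffel symbols in the preferred charts are smooth is smooth. -/
lemma contMDiffCovariantDerivative_of_hasChristoffelAt {cov : AffineConnection n M}
    (h : ∀ x : M, ∃ Γ : 𝔼 n → 𝔼 n →L[ℝ] 𝔼 n →L[ℝ] 𝔼 n,
      ContDiffOn ℝ ∞ Γ (chartAt (𝔼 n) x).target ∧
      ∀ y ∈ (chartAt (𝔼 n) x).source,
        HasChristoffelAt (chartAt (𝔼 n) x) cov y (Γ (chartAt (𝔼 n) x y))) :
    cov.ContMDiffCovariantDerivative ∞ := by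
  refine ⟨⟨fun {Y} hY ↦ ?_⟩⟩
  rw [contMDiffOn_univ] at hY ⊢
  intro x
  have hY' (y : M) : IsSmoothFieldAt Y y := hY y
  obtain ⟨Γ, hs, hΓ⟩ := h x
  set e := chartAt (𝔼 n) x
  have he : IsSmoothChart e := isSmoothChart_chartAt x
  have hx : x ∈ e.source := mem_chart_source _ x
  rw [contMDiffAt_hom_bundle]
  refine ⟨contMDiffAt_id, ?_⟩
  have h1 : ContDiffAt ℝ ∞ (fun u ↦ fderiv ℝ (coordField e Y) u +
      (Γ u).flip (coordField e Y u)) (e x) := by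
    have h2 := contDiffAt_coordField he hx (hY' x)
    have h3 : ContDiffAt ℝ ∞ (fun u ↦ (Γ u).flip) (e x) :=
      (ContinuousLinearMap.flipₗᵢ ℝ (𝔼 n) (𝔼 n) (𝔼 n)).contDiff.contDiffAt.comp _
        (hs.contDiffAt (e.open_target.mem_nhds (e.map_source hx)))
    exact (h2.fderiv_right (by norm_cast)).add (h3.clm_apply h2)
  refine (h1.contMDiffAt.comp x (he.contMDiffAt hx)).congr_of_eventuallyEq ?_
  filter_upwards [e.open_source.mem_nhds hx] with y hy
  ext1 v
  change (trivializationAt (𝔼 n) (TangentSpace (𝓡 n)) x).continuousLinearMapAt ℝ y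
    (cov Y y ((trivializationAt (𝔼 n) (TangentSpace (𝓡 n)) x).symmL ℝ y v)) = _
  rw [continuousLinearMapAt_eq_chartDeriv hy, symmL_eq_inverse_chartDeriv hy,
    hΓ y hy Y (hY' y).isMDiffFieldAt, he.chartDeriv_inverse hy, ← coordField_apply hy]
  rfl

/-- A `1`-form with a smooth expression in a chart is smooth. -/
lemma contMDiffAt_oneForm (he : IsSmoothChart e) (hx : x ∈ e.source)
    {α : Π x : M, TangentSpace (𝓡 n) x →L[ℝ] ℝ} {γ : 𝔼 n → 𝔼 n →L[ℝ] ℝ}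
    (hγ : ContDiffAt ℝ ∞ γ (e x)) (hα : ∀ᶠ y in 𝓝 x, ∀ v, α y v = γ (e y) (chartDeriv e y v)) :
    ContMDiffAt (𝓡 n) ((𝓡 n).prod 𝓘(ℝ, EuclideanSpace ℝ (Fin n) →L[ℝ] ℝ)) ∞
      (fun x : M ↦ TotalSpace.mk' (EuclideanSpace ℝ (Fin n) →L[ℝ] ℝ)
        (E := fun x ↦ TangentSpace (𝓡 n) x →L[ℝ] ℝ) x (α x)) x := by
  set e₀ := chartAt (𝔼 n) x
  have he₀ : IsSmoothChart e₀ := isSmoothChart_chartAt x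
  have hx₀ : x ∈ e₀.source := mem_chart_source _ x
  rw [contMDiffAt_hom_bundle]
  refine ⟨contMDiffAt_id, ?_⟩
  have hT := contDiffAt_transition he₀ hx₀ he hx
  have h1 : ContDiffAt ℝ ∞ (fun u ↦ (γ ((e ∘ e₀.symm) u)).comp (fderiv ℝ (e ∘ e₀.symm) u))
      (e₀ x) := by
    refine ContDiffAt.clm_comp (ContDiffAt.comp _ ?_ hT) (hT.fderiv_right (by norm_cast))
    simpa [e₀.left_inv hx₀] using hγ
  refine (h1.contMDiffAt.comp x (he₀.contMDiffAt hx₀)).congr_of_eventuallyEq ?_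
  filter_upwards [e₀.open_source.mem_nhds hx₀, e.open_source.mem_nhds hx, hα] with y hy₀ hy h
  ext1 v
  change (trivializationAt ℝ (Bundle.Trivial M ℝ) x).linearMapAt ℝ y
    (α y ((trivializationAt (𝔼 n) (TangentSpace (𝓡 n)) x).symmL ℝ y v)) = _
  have h6 (a : ℝ) : (trivializationAt ℝ (Bundle.Trivial M ℝ) x).linearMapAt ℝ y a = a := by
    simp only [Trivial.fiberBundle_trivializationAt', Trivial.linearMapAt_trivialization,
      LinearMap.id_coe, id_eq]
  refine (h6 _).trans ?_
  rw [symmL_eq_inverse_chartDeriv hy₀, h, chartDeriv_change he₀ hy₀ he hy,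
    he₀.chartDeriv_inverse hy₀]
  simp [e₀.left_inv hy₀]

end SmoothInCharts

/-! ### The Levi-Civita connection of real projective space -/

/-- The symmetric bilinear map `(v, w) ↦ α(v) w + α(w) v`, the difference of two projectively
equivalent connections. -/
def projectiveChange {n : ℕ} (α : 𝔼 n →L[ℝ] ℝ) : 𝔼 n →L[ℝ] 𝔼 n →L[ℝ] 𝔼 n :=
  α.smulRight (ContinuousLinearMap.id ℝ (𝔼 n)) +
    (α.smulRight (ContinuousLinearMap.id ℝ (𝔼 n))).flip

@[simp] lemma projectiveChange_apply {n : ℕ} (α : 𝔼 n →L[ℝ] ℝ) (v w : 𝔼 n) :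
    projectiveChange α v w = α v • w + α w • v := by
  simp [projectiveChange]

namespace RealProjectiveSpace

variable {n : ℕ}

/-- The `1`-form `v ↦ -⟨s, v⟩ / |s|²` in the `i`-th affine chart, where `s` is the section
`affineLift i`. The Levi-Civita connection of the Fubini-Study metric differs from the flat
connection of the chart by the projective change with this form. -/
def fubiniStudyOneForm (i : Fin (n + 1)) (u : 𝔼 n) : 𝔼 n →L[ℝ] ℝ :=
  -(‖affineLift i u‖ ^ 2)⁻¹ • (innerForm n (affineLift i u)).comp (dAffineLift i)

lemma fubiniStudyOneForm_apply (i : Fin (n + 1)) (u v : 𝔼 n) :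
    fubiniStudyOneForm i u v =
      -(‖affineLift i u‖ ^ 2)⁻¹ * inner ℝ (affineLift i u) (dAffineLift i v) := by
  simp [fubiniStudyOneForm]

lemma contDiff_fubiniStudyOneForm (i : Fin (n + 1)) :
    ContDiff ℝ ∞ (fubiniStudyOneForm (n := n) i) := by
  have hs : ContDiff ℝ ∞ (affineLift (n := n) i) := (contDiff_affineLift i).of_le le_top
  refine contDiff_clm_apply_iff.2 fun v ↦ ?_
  simp only [fubiniStudyOneForm_apply]
  refine ContDiff.mul (ContDiff.neg (ContDiff.inv (hs.norm_sq ℝ) fun u ↦ ?_))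
    (hs.inner ℝ contDiff_const)
  exact pow_ne_zero 2 (norm_ne_zero_iff.2 (affineLift_ne_zero i u))

lemma isSmoothChart_affineChart (i : Fin (n + 1)) : IsSmoothChart (affineChart (n := n) i) :=
  isSmoothChart_of_mem_atlas ⟨i, rfl⟩

lemma dAffineLift_injective (i : Fin (n + 1)) : Function.Injective (dAffineLift (n := n) i) := by
  intro v w h
  ext k
  rw [← dAffineLift_succAbove i v, ← dAffineLift_succAbove i w, h]

/-- The transition map between two affine charts. -/
def transition (i j : Fin (n + 1)) (u : 𝔼 n) : 𝔼 n := affineChart j ((affineChart i).symm u)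

lemma contDiffAt_affineChart_transition (i j : Fin (n + 1)) {u : 𝔼 n} (hu : affineLift i u j ≠ 0) :
    ContDiffAt ℝ ∞ (transition i j) u :=
  (((contDiffOn_transition i j).contDiffAt ((isOpen_ne_fun
    ((EuclideanSpace.proj (𝕜 := ℝ) j).continuous.comp (contDiff_affineLift i).continuous)
      continuous_const).mem_nhds hu)).of_le le_top)

lemma hasFDerivAt_affineLift_apply (i j : Fin (n + 1)) (u : 𝔼 n) :
    HasFDerivAt (fun w ↦ affineLift i w j)
      ((EuclideanSpace.proj (𝕜 := ℝ) j).comp (dAffineLift i)) u :=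
  (EuclideanSpace.proj (𝕜 := ℝ) j).hasFDerivAt.comp u (hasFDerivAt_affineLift i u)

lemma eventually_affineLift_ne (i j : Fin (n + 1)) {u : 𝔼 n} (hu : affineLift i u j ≠ 0) :
    ∀ᶠ w in 𝓝 u, affineLift i w j ≠ 0 :=
  (hasFDerivAt_affineLift_apply i j u).continuousAt.eventually_ne hu

lemma smul_affineLift_transition (i j : Fin (n + 1)) {u : 𝔼 n} (hu : affineLift i u j ≠ 0) :
    affineLift i u j • affineLift j (transition i j u) = affineLift i u := by
  rw [transition, affineLift_transition i j u hu, smul_inv_smul₀ hu]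

/-- The derivative of the relation between the lifts of two affine charts. -/
lemma dAffineLift_fderiv_transition (i j : Fin (n + 1)) {u : 𝔼 n} (hu : affineLift i u j ≠ 0)
    (v : 𝔼 n) :
    affineLift i u j • dAffineLift j (fderiv ℝ (transition i j) u v) +
      dAffineLift i v j • affineLift j (transition i j u) = dAffineLift i v := by
  have h1 := (contDiffAt_affineChart_transition i j hu).differentiableAt (by simp) |>.hasFDerivAt
  have h2 := (hasFDerivAt_affineLift_apply i j u).smul
    ((hasFDerivAt_affineLift j (transition i j u)).comp u h1)
  have h3 : (fun w ↦ affineLift i w j) • (affineLift j ∘ transition i j) =ᶠ[𝓝 u] affineLift i := by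
    filter_upwards [eventually_affineLift_ne i j hu] with w hw
    exact smul_affineLift_transition i j hw
  exact congrArg (fun L ↦ L v) ((h2.congr_of_eventuallyEq h3.symm).unique
    (hasFDerivAt_affineLift i u))

/-- The transition maps between affine charts are projective maps: their second derivatives are
symmetric products of the first derivative with a `1`-form. -/
lemma fderiv_fderiv_transition (i j : Fin (n + 1)) {u : 𝔼 n} (hu : affineLift i u j ≠ 0)
    (v w : 𝔼 n) :
    affineLift i u j • fderiv ℝ (fderiv ℝ (transition i j)) u v w =
      -(dAffineLift i v j • fderiv ℝ (transition i j) u w +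
        dAffineLift i w j • fderiv ℝ (transition i j) u v) := by
  have hT := contDiffAt_affineChart_transition i j hu
  have h1 := hT.differentiableAt (by simp) |>.hasFDerivAt
  have h1' : HasFDerivAt (fderiv ℝ (transition i j)) _ u :=
    ((hT.fderiv_right (m := ∞) (by norm_cast)).differentiableAt (by simp)).hasFDerivAt
  have h1w : HasFDerivAt (fun u ↦ fderiv ℝ (transition i j) u w) _ u :=
    h1'.clm_apply (hasFDerivAt_const w u)
  have h2 := (hasFDerivAt_affineLift_apply i j u).smul
    ((dAffineLift j).hasFDerivAt.comp u h1w)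
  have h3 := ((hasFDerivAt_affineLift j (transition i j u)).comp u h1).const_smul
    (dAffineLift i w j)
  have h4 : (fun u ↦ affineLift i u j) • (dAffineLift j ∘ fun u ↦ fderiv ℝ (transition i j) u w) +
      dAffineLift i w j • (affineLift j ∘ transition i j) =ᶠ[𝓝 u] fun _ ↦ dAffineLift i w := by
    filter_upwards [eventually_affineLift_ne i j hu] with z hz
    exact dAffineLift_fderiv_transition i j hz w
  have h5 := congrArg (fun L ↦ L v) (((h2.add h3).congr_of_eventuallyEq h4.symm).unique
    (hasFDerivAt_const _ u))
  apply dAffineLift_injective j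
  simp only [add_apply, smul_apply, ContinuousLinearMap.comp_apply,
    ContinuousLinearMap.smulRight_apply, ContinuousLinearMap.flip_apply, zero_apply,
    PiLp.proj_apply, Function.comp_apply, map_zero, zero_add] at h5
  rw [map_smul, map_neg, map_add, map_smul, map_smul, eq_neg_iff_add_eq_zero, ← h5]
  abel

/-- The forms of two affine charts differ exactly by the `1`-form of the transition map. -/
lemma fubiniStudyOneForm_transition (i j : Fin (n + 1)) {u : 𝔼 n} (hu : affineLift i u j ≠ 0)
    (v : 𝔼 n) :
    fubiniStudyOneForm j (transition i j u) (fderiv ℝ (transition i j) u v) =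
      fubiniStudyOneForm i u v + (affineLift i u j)⁻¹ * dAffineLift i v j := by
  have hs := smul_affineLift_transition i j hu
  have hd := dAffineLift_fderiv_transition i j hu v
  have hN : ‖affineLift j (transition i j u)‖ ≠ 0 :=
    norm_ne_zero_iff.2 (affineLift_ne_zero j _)
  rw [fubiniStudyOneForm_apply, fubiniStudyOneForm_apply, ← hs, ← hd]
  simp only [affineLift_same, PiLp.add_apply, PiLp.smul_apply, dAffineLift_same, smul_eq_mul,
    mul_one, mul_zero, zero_add, norm_smul, mul_pow, Real.norm_eq_abs, sq_abs, inner_add_right,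
    real_inner_smul_left, real_inner_smul_right, real_inner_self_eq_norm_sq]
  field_simp
  ring

/-- The expression of the Fubini-Study metric in the `i`-th affine chart. -/
def localFubiniStudy (i : Fin (n + 1)) (u : 𝔼 n) : 𝔼 n →L[ℝ] 𝔼 n →L[ℝ] ℝ :=
  (fubiniStudyForm (affineLift i u)).bilinearComp (dAffineLift i) (dAffineLift i)

lemma localFubiniStudy_apply (i : Fin (n + 1)) (u v w : 𝔼 n) : localFubiniStudy i u v w =
    fubiniStudyForm (affineLift i u) (dAffineLift i v) (dAffineLift i w) := rfl

lemma affineLift_affineChart_ne {i j : Fin (n + 1)} {p : RealProjectiveSpace n}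
    (hi : p ∈ affineDomain i) (hj : p ∈ affineDomain j) : affineLift i (affineChart i p) j ≠ 0 := by
  rw [← (affineChart i).left_inv hi] at hj
  exact (proj_mem_affineDomain j ⟨affineLift i _, affineLift_ne_zero i _⟩).1 hj

lemma localFubiniStudy_transition (i j : Fin (n + 1)) {u : 𝔼 n} (hu : affineLift i u j ≠ 0)
    (v w : 𝔼 n) :
    localFubiniStudy j (transition i j u) (fderiv ℝ (transition i j) u v)
      (fderiv ℝ (transition i j) u w) = localFubiniStudy i u v w := by
  rw [localFubiniStudy_apply, localFubiniStudy_apply, ← smul_affineLift_transition i j hu,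
    ← dAffineLift_fderiv_transition i j hu v,
    ← dAffineLift_fderiv_transition i j hu w, fubiniStudyForm_change _ _ _ (affineLift_ne_zero _ _)]
  simpa using hu

/-- Tangent spaces are identified with `ℝⁿ` through the preferred chart at their base point. -/
lemma chartDeriv_chartAt_self (p : RealProjectiveSpace n) (v : TangentSpace (𝓡 n) p) :
    chartDeriv (affineChart (chartIndex p)) p v = v := by
  have h : mfderiv (𝓡 n) (𝓡 n) (extChartAt (𝓡 n) p) p = _ := mfderiv_extChartAt_self
  exact congrArg (fun L : 𝔼 n →L[ℝ] 𝔼 n ↦ L v) h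

/-- The Fubini-Study inner product, in any affine chart. -/
lemma fubiniStudyInner_eq {i : Fin (n + 1)} {p : RealProjectiveSpace n} (hp : p ∈ affineDomain i)
    (v w : TangentSpace (𝓡 n) p) :
    fubiniStudyInner p v w = localFubiniStudy i (affineChart i p)
      (chartDeriv (affineChart i) p v) (chartDeriv (affineChart i) p w) := by
  set j := chartIndex p
  have hj : p ∈ affineDomain j := mem_affineDomain_chartIndex p
  have hne := affineLift_affineChart_ne hp hj
  rw [← localFubiniStudy_transition i j hne]
  have h1 (v : TangentSpace (𝓡 n) p) : fderiv ℝ (transition i j) (affineChart i p)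
      (chartDeriv (affineChart i) p v) = v := by
    exact (chartDeriv_change (isSmoothChart_affineChart i) hp (isSmoothChart_affineChart j) hj
      v).symm.trans (chartDeriv_chartAt_self p v)
  have h2 : transition i j (affineChart i p) = affineChart j p := by
    rw [transition, (affineChart i).left_inv hp]
  rw [h1, h1, h2]
  rfl

/-- The metric is parallel, in an affine chart, for the connection with Christoffel symbols
`projectiveChange (fubiniStudyOneForm i)`. -/
lemma fderiv_localFubiniStudy (i : Fin (n + 1)) (u v a b : 𝔼 n) :
    DifferentiableAt ℝ (localFubiniStudy i) u ∧
    fderiv ℝ (localFubiniStudy i) u v a b =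
      localFubiniStudy i u (projectiveChange (fubiniStudyOneForm i u) v a) b +
        localFubiniStudy i u a (projectiveChange (fubiniStudyOneForm i u) v b) := by
  have hd : DifferentiableAt ℝ (localFubiniStudy i) u := by
    have h2 : ContDiff ℝ ∞ (localFubiniStudy (n := n) i) := by
      refine contDiff_clm_apply_iff.2 fun a ↦ contDiff_clm_apply_iff.2 fun b ↦ ?_
      have h3 := contDiffOn_clm_apply.1 (contDiffOn_clm_apply.1
        (contDiffOn_fubiniStudyForm (n := n)) (dAffineLift i a)) (dAffineLift i b)
      exact ((h3.comp_contDiff (contDiff_affineLift i) fun u ↦ affineLift_ne_zero _ u)).of_le le_top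
    exact h2.differentiable (by simp) u
  refine ⟨hd, ?_⟩
  have hs := hasFDerivAt_affineLift i u
  have hN0 : ‖affineLift i u‖ ≠ 0 := norm_ne_zero_iff.2 (affineLift_ne_zero i _)
  have h2 : inner ℝ (affineLift i u) (affineLift i u) ≠ 0 := by simpa using affineLift_ne_zero i u
  have hin (c : 𝔼 (n + 1)) : HasFDerivAt (fun u ↦ inner ℝ (affineLift i u) c)
      ((innerForm n c).comp (dAffineLift i)) u := by
    have := ((innerForm n c).hasFDerivAt).comp u hs
    refine this.congr_of_eventuallyEq (Filter.Eventually.of_forall fun z ↦ ?_)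
    simp [real_inner_comm]
  have hNN : HasFDerivAt (fun u ↦ inner ℝ (affineLift i u) (affineLift i u)) _ u :=
    hs.inner ℝ hs
  have hG : (fun u ↦ localFubiniStudy i u a b) = fun u ↦
      (inner ℝ (affineLift i u) (affineLift i u))⁻¹ * inner ℝ (dAffineLift i a) (dAffineLift i b) -
      ((inner ℝ (affineLift i u) (affineLift i u))⁻¹ * (inner ℝ (affineLift i u) (affineLift i u))⁻¹) *
        (inner ℝ (affineLift i u) (dAffineLift i a) *
        inner ℝ (affineLift i u) (dAffineLift i b)) := by
    ext u
    rw [localFubiniStudy_apply, fubiniStudyForm_apply, real_inner_self_eq_norm_sq, ← mul_inv]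
    ring
  have hinv := (hasDerivAt_inv h2).comp_hasFDerivAt u hNN
  have hG' := (hinv.mul_const (inner ℝ (dAffineLift i a) (dAffineLift i b))).sub
    ((hinv.mul hinv).mul ((hin (dAffineLift i a)).mul (hin (dAffineLift i b))))
  have hL : HasFDerivAt (fun u ↦ localFubiniStudy i u a b) _ u :=
    (hd.hasFDerivAt.clm_apply (hasFDerivAt_const a u)).clm_apply (hasFDerivAt_const b u)
  rw [hG] at hL
  have h5 := congrArg (fun L ↦ L v) (hL.unique hG')
  simp [Function.comp_def] at h5
  rw [h5]
  simp only [projectiveChange_apply, map_add, map_smul, add_apply, smul_apply,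
    fubiniStudyOneForm_apply, smul_eq_mul]
  have hf (a b : 𝔼 n) : localFubiniStudy i u a b = (‖affineLift i u‖ ^ 2)⁻¹ *
    inner ℝ (dAffineLift i a) (dAffineLift i b) - (‖affineLift i u‖ ^ 4)⁻¹ *
      (inner ℝ (affineLift i u) (dAffineLift i a) * inner ℝ (affineLift i u) (dAffineLift i b)) :=
    fubiniStudyForm_apply _ _ _
  simp only [hf]
  rw [real_inner_comm (dAffineLift i v) (dAffineLift i a),
    real_inner_comm (affineLift i u) (dAffineLift i v),
    real_inner_comm (dAffineLift i v) (dAffineLift i b)]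
  field_simp
  ring

end RealProjectiveSpace

namespace RealProjectiveSpace

/-- The Levi-Civita connection of the Fubini-Study metric, defined at each point by its
Christoffel symbols in the preferred affine chart. -/
def leviCivita (n : ℕ) : AffineConnection n (RealProjectiveSpace n) where
  toFun Y p := chartConnection (affineChart (chartIndex p))
    (fun u ↦ projectiveChange (fubiniStudyOneForm (chartIndex p) u)) Y p
  isCovariantDerivativeOnUniv :=
    { add := fun {_ _ p} hσ hσ' _ ↦ (isCovariantDerivativeOn_chartConnection
        (isSmoothChart_affineChart (chartIndex p)) _).add hσ hσ' (mem_affineDomain_chartIndex p)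
      leibniz := fun {_ _ p} hσ hg _ ↦ (isCovariantDerivativeOn_chartConnection
        (isSmoothChart_affineChart (chartIndex p)) _).leibniz hσ hg
        (mem_affineDomain_chartIndex p) }

variable {n : ℕ}

lemma leviCivita_apply (Y : Π p : RealProjectiveSpace n, TangentSpace (𝓡 n) p)
    (p : RealProjectiveSpace n) : leviCivita n Y p = chartConnection (affineChart (chartIndex p))
      (fun u ↦ projectiveChange (fubiniStudyOneForm (chartIndex p) u)) Y p := rfl

/-- The Christoffel symbols of the Levi-Civita connection in all affine charts. -/
lemma hasChristoffelAt_leviCivita {i : Fin (n + 1)} {p : RealProjectiveSpace n}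
    (hp : p ∈ affineDomain i) : HasChristoffelAt (affineChart i) (leviCivita n) p
      (projectiveChange (fubiniStudyOneForm i (affineChart i p))) := by
  set j := chartIndex p with hj'
  have hj : p ∈ affineDomain j := mem_affineDomain_chartIndex p
  have h : HasChristoffelAt (affineChart j) (leviCivita n) p
      (projectiveChange (fubiniStudyOneForm j (affineChart j p))) := by
    intro Y hY v
    rw [leviCivita_apply, chartDeriv_chartConnection (isSmoothChart_affineChart j) hj]
  have hne := affineLift_affineChart_ne hj hp
  refine h.change (isSmoothChart_affineChart j) hj (isSmoothChart_affineChart i) hp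
    (T := transition j i)
    (Filter.Eventually.of_forall fun _ ↦ by rw [Function.comp_apply, transition]) fun v w ↦ ?_
  have hp' : affineChart i p = transition j i (affineChart j p) := by
    rw [transition, (affineChart j).left_inv hj]
  have h2 := fderiv_fderiv_transition j i hne v w
  rw [← eq_inv_smul_iff₀ hne] at h2
  rw [hp', projectiveChange_apply, fubiniStudyOneForm_transition j i hne,
    fubiniStudyOneForm_transition j i hne, h2, projectiveChange_apply, map_add, map_smul, map_smul]
  module

lemma contMDiffCovariantDerivative_leviCivita :
    (leviCivita n).ContMDiffCovariantDerivative ∞ := by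
  refine contMDiffCovariantDerivative_of_hasChristoffelAt fun p ↦
    ⟨fun u ↦ projectiveChange (fubiniStudyOneForm (chartIndex p) u), ?_, fun q hq ↦
      hasChristoffelAt_leviCivita hq⟩
  refine ContDiff.contDiffOn ?_
  refine contDiff_clm_apply_iff.2 fun v ↦ contDiff_clm_apply_iff.2 fun w ↦ ?_
  simp only [projectiveChange_apply]
  have h (v : 𝔼 n) : ContDiff ℝ ∞ fun u ↦ fubiniStudyOneForm (chartIndex p) u v :=
    (contDiff_fubiniStudyOneForm _).clm_apply contDiff_const
  exact ((h v).smul contDiff_const).add ((h w).smul contDiff_const)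

lemma inner_eq_fubiniStudyInner (p : RealProjectiveSpace n) (v w : TangentSpace (𝓡 n) p) :
    inner ℝ v w = fubiniStudyInner p v w := rfl

lemma isLeviCivita_leviCivita : (leviCivita n).IsLeviCivita := by
  refine ⟨torsion_eq_zero_of_symmetric fun p ↦ ⟨_, isSmoothChart_affineChart (chartIndex p),
    mem_affineDomain_chartIndex p, _, hasChristoffelAt_leviCivita (mem_affineDomain_chartIndex p),
    fun v w ↦ by simp [add_comm]⟩, ?_⟩
  refine (CovariantDerivative.isMetricCompatible_iff _).2 fun {p X σ τ} _ hσ hτ ↦ ?_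
  set i := chartIndex p
  have hp : p ∈ affineDomain i := mem_affineDomain_chartIndex p
  have he := isSmoothChart_affineChart (n := n) i
  have hdσ := differentiableAt_coordField he hp hσ
  have hdτ := differentiableAt_coordField he hp hτ
  have hd := (fderiv_localFubiniStudy i (affineChart i p) 0 0 0).1
  have h1 := (hd.hasFDerivAt.clm_apply hdσ.hasFDerivAt).clm_apply hdτ.hasFDerivAt
  have h2 : (fun q ↦ fubiniStudyInner q (σ q) (τ q)) =ᶠ[𝓝 p]
      (fun u ↦ localFubiniStudy i u (coordField (affineChart i) σ u)
        (coordField (affineChart i) τ u)) ∘ affineChart i := by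
    filter_upwards [(affineChart i).open_source.mem_nhds hp] with q hq
    rw [fubiniStudyInner_eq hq, Function.comp_apply, coordField_apply hq, coordField_apply hq]
  have h3 := mvfderiv_of_eventuallyEq_comp he hp h1.differentiableAt h2 (X p)
  simp only [inner_eq_fubiniStudyInner]
  refine h3.trans ?_
  rw [h1.fderiv, fubiniStudyInner_eq hp, fubiniStudyInner_eq hp,
    hasChristoffelAt_leviCivita hp σ hσ, hasChristoffelAt_leviCivita hp τ hτ]
  simp only [add_apply, ContinuousLinearMap.comp_apply, ContinuousLinearMap.flip_apply, map_add,
    coordField_apply (e := affineChart i) hp]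
  rw [(fderiv_localFubiniStudy i _ _ _ _).2]
  abel

/-- Real projective space is Hausdorff: the orthogonal projection onto a line depends continuously
on the line and determines it. -/
instance instT2Space : T2Space (RealProjectiveSpace n) := by
  let F : RealProjectiveSpace n → Fin (n + 1) → Fin (n + 1) → ℝ :=
    Projectivization.lift (fun v j k ↦ v.1 j * v.1 k / ‖v.1‖ ^ 2) (by
      rintro ⟨v, hv⟩ ⟨w, hw⟩ t rfl
      ext j k
      have ht : t ≠ 0 := by rintro rfl; simp at hv
      have : ‖w‖ ≠ 0 := norm_ne_zero_iff.2 hw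
      simp only [PiLp.smul_apply, smul_eq_mul, norm_smul, mul_pow, Real.norm_eq_abs, sq_abs]
      field_simp)
  have hF (v : {v : 𝔼 (n + 1) // v ≠ 0}) (j k : Fin (n + 1)) :
      F (proj v) j k = v.1 j * v.1 k / ‖v.1‖ ^ 2 := rfl
  refine T2Space.of_injective_continuous (f := F) (fun p q h ↦ ?_) ?_
  · obtain ⟨v, rfl⟩ := isQuotientMap_proj.surjective p
    obtain ⟨w, rfl⟩ := isQuotientMap_proj.surjective q
    obtain ⟨j, hj⟩ : ∃ j, v.1 j ≠ 0 := by
      by_contra! h0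
      exact v.2 (PiLp.ext h0)
    have hv : ‖v.1‖ ≠ 0 := norm_ne_zero_iff.2 v.2
    have hw : ‖w.1‖ ≠ 0 := norm_ne_zero_iff.2 w.2
    have h1 (k : Fin (n + 1)) : v.1 j * v.1 k / ‖v.1‖ ^ 2 = w.1 j * w.1 k / ‖w.1‖ ^ 2 := by
      rw [← hF, ← hF, h]
    have hwj : w.1 j ≠ 0 := by
      intro h0
      have := h1 j
      rw [h0, zero_mul, zero_div, div_eq_zero_iff] at this
      exact this.elim (mul_ne_zero hj hj) (pow_ne_zero 2 hv)
    have hc : w.1 j / ‖w.1‖ ^ 2 / (v.1 j / ‖v.1‖ ^ 2) ≠ 0 := by positivity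
    refine (proj_eq_iff v w).2 ⟨Units.mk0 _ hc, PiLp.ext fun k ↦ ?_⟩
    have := h1 k
    simp only [Units.smul_def, Units.val_mk0, PiLp.smul_apply, smul_eq_mul]
    field_simp at this ⊢
    linarith
  · refine isQuotientMap_proj.continuous_iff.2 (continuous_pi fun j ↦ continuous_pi fun k ↦ ?_)
    change Continuous fun v : {v : 𝔼 (n + 1) // v ≠ 0} ↦ v.1 j * v.1 k / ‖v.1‖ ^ 2
    refine Continuous.div (by fun_prop) (by fun_prop) fun v ↦ ?_
    exact pow_ne_zero 2 (norm_ne_zero_iff.2 v.2)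

end RealProjectiveSpace

/-! ### Affine maps and projective flatness -/

section Affine

variable {n : ℕ} {M : Type*} [TopologicalSpace M] [ChartedSpace (EuclideanSpace ℝ (Fin n)) M]
  [IsManifold (𝓡 n) ∞ M] {e : OpenPartialHomeomorph M (𝔼 n)} {y : M}
  {N : Type*} [TopologicalSpace N] [ChartedSpace (EuclideanSpace ℝ (Fin n)) N]
  [IsManifold (𝓡 n) ∞ N] {e' : OpenPartialHomeomorph N (𝔼 n)}

omit [IsManifold (𝓡 n) ∞ M] in
lemma IsSmoothChart.trans (he : IsSmoothChart e) {ψ : OpenPartialHomeomorph (𝔼 n) (𝔼 n)}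
    (hψ : ContDiffOn ℝ ∞ ψ ψ.source) (hψ' : ContDiffOn ℝ ∞ ψ.symm ψ.target) :
    IsSmoothChart (e.trans ψ) where
  contMDiffOn := by
    refine ContMDiffOn.comp (t := ψ.source) hψ.contMDiffOn (he.contMDiffOn.mono ?_) ?_ <;>
    · rw [OpenPartialHomeomorph.trans_source]
      first | exact Set.inter_subset_left | exact Set.inter_subset_right
  contMDiffOn_symm := by
    refine ContMDiffOn.comp (g := e.symm) (f := ψ.symm) (t := e.target) he.contMDiffOn_symm
      (hψ'.contMDiffOn.mono ?_) ?_ <;>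
    · rw [OpenPartialHomeomorph.trans_target]
      first | exact Set.inter_subset_left | exact Set.inter_subset_right

/-- A diffeomorphism which identifies charts in which two connections have the same Christoffel
symbols is affine. -/
lemma isAffineOn_of_hasChristoffelAt (he : IsSmoothChart e) (he' : IsSmoothChart e')
    {cov : AffineConnection n M} {cov' : AffineConnection n N} {φ : OpenPartialHomeomorph M N}
    (hφ : φ.MDifferentiable (𝓡 n) (𝓡 n)) (hs : φ.source ⊆ e.source)
    (hs' : ∀ y ∈ φ.source, φ y ∈ e'.source) (hcomp : ∀ y ∈ φ.source, e' (φ y) = e y)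
    (hG : ∀ y ∈ φ.source, ∃ G, HasChristoffelAt e cov y G ∧ HasChristoffelAt e' cov' (φ y) G) :
    cov.IsAffineOn cov' φ := by
  intro Y y hy hY v
  have hd {z : M} (hz : z ∈ φ.source) (w : TangentSpace (𝓡 n) z) :
      chartDeriv e' (φ z) (mfderiv (𝓡 n) (𝓡 n) φ z w) = chartDeriv e z w := by
    have h1 := mfderiv_comp z (he'.mdifferentiable.mdifferentiableAt (hs' z hz))
      (hφ.mdifferentiableAt hz)
    have h2 : e' ∘ φ =ᶠ[𝓝 z] e := by
      filter_upwards [φ.open_source.mem_nhds hz] with t ht using hcomp t ht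
    rw [h2.mfderiv_eq] at h1
    exact (congrArg (fun L : 𝔼 n →L[ℝ] 𝔼 n ↦ L w) h1).symm
  have hpull {z : M} (hz : z ∈ φ.source) :
      chartDeriv e z (VectorField.mpullback (𝓡 n) (𝓡 n) φ Y z) = chartDeriv e' (φ z) (Y (φ z)) := by
    have hinv : (mfderiv (𝓡 n) (𝓡 n) φ z).IsInvertible := ⟨hφ.mfderiv hz, rfl⟩
    rw [VectorField.mpullback_apply, ← hd hz, hinv.self_apply_inverse]
  have hcoord : coordField e (VectorField.mpullback (𝓡 n) (𝓡 n) φ Y) =ᶠ[𝓝 (e y)]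
      coordField e' Y := by
    filter_upwards [(tendsto_symm (hs hy)).eventually (φ.open_source.mem_nhds hy),
      e.open_target.mem_nhds (e.map_source (hs hy))] with u h1 h2
    rw [coordField, hpull h1, ← coordField_apply (hs' _ h1), hcomp _ h1, e.right_inv h2]
  have hdY := differentiableAt_coordField he' (hs' y hy) hY
  rw [hcomp y hy] at hdY
  have hpd : IsMDiffFieldAt (VectorField.mpullback (𝓡 n) (𝓡 n) φ Y) y :=
    (isMDiffFieldAt_iff he (hs hy)).2 (hdY.congr_of_eventuallyEq hcoord)
  obtain ⟨G, h1, h2⟩ := hG y hy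
  apply he'.chartDeriv_injective (hs' y hy)
  rw [hd hy, h1 _ hpd, h2 _ hY, hd hy, hcoord.fderiv_eq, hpull hy, hcomp y hy]

/-- In suitable coordinates, a torsion-free connection with `W = 0` and `C = 0` is projectively
equivalent to the flat connection. -/
lemma exists_projectivelyFlat_chart [T2Space M] {cov : AffineConnection n M}
    (hsmooth : cov.ContMDiffCovariantDerivative ∞) (htorsion : cov.torsion = 0)
    (hflat : (3 ≤ n ∧ ∀ x u v w, cov.weyl x u v w = 0) ∨
      (n = 2 ∧ ∀ x u v w, cov.cottonYork x u v w = 0)) (x : M) :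
    ∃ e : OpenPartialHomeomorph M (𝔼 n), IsSmoothChart e ∧ x ∈ e.source ∧
      ∃ β : 𝔼 n → 𝔼 n →L[ℝ] ℝ, ContDiffOn ℝ ∞ β e.target ∧
        ∀ y ∈ e.source, HasChristoffelAt e cov y (projectiveChange (β (e y))) := by
  set e := chartAt (𝔼 n) x
  have he : IsSmoothChart e := isSmoothChart_chartAt x
  have hx : x ∈ e.source := mem_chart_source _ x
  obtain ⟨Γ, hΓ⟩ := exists_hasChristoffelAt he cov
  have hs := contDiffOn_of_hasChristoffelAt he hsmooth hΓ
  have hΓu {u : 𝔼 n} (hu : u ∈ e.target) : HasChristoffelAt e cov (e.symm u) (Γ u) := by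
    have := hΓ _ (e.map_target hu)
    rwa [e.right_inv hu] at this
  have hsymm : ∀ u ∈ e.target, ∀ v w, Γ u v w = Γ u w v := fun u hu v w ↦
    (hΓu hu).symmetric_of_torsion_eq_zero he (e.map_target hu) htorsion v w
  have hWC : (∀ u ∈ e.target, ∀ a b c, localWeyl Γ u a b c = 0) ∧
      ∀ u ∈ e.target, ∀ a b c, localCotton Γ u a b c = 0 := by
    rcases hflat with ⟨hn, hW⟩ | ⟨rfl, hC⟩
    · have hW' : ∀ u ∈ e.target, ∀ a b c, localWeyl Γ u a b c = 0 := by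
        intro u hu a b c
        have h := chartDeriv_weyl he (e.map_target hu) hΓ hs ((chartDeriv e _).inverse a)
          ((chartDeriv e _).inverse b) ((chartDeriv e _).inverse c)
        simpa only [hW, map_zero, he.chartDeriv_inverse (e.map_target hu), e.right_inv hu,
          eq_comm (a := (0 : 𝔼 n))] using h
      exact ⟨hW', fun u hu a b c ↦ localCotton_eq_zero hn e.open_target hs hsymm hW' hu a b c⟩
    · refine ⟨fun u _ a b c ↦ localWeyl_eq_zero_of_two Γ u a b c, fun u hu a b c ↦ ?_⟩
      have h := cottonYork_eq_localCotton he (e.map_target hu) hΓ hs ((chartDeriv e _).inverse a)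
        ((chartDeriv e _).inverse b) ((chartDeriv e _).inverse c)
      simpa only [hC, he.chartDeriv_inverse (e.map_target hu), e.right_inv hu,
        eq_comm (a := (0 : ℝ))] using h
  obtain ⟨ψ, hxψ, hψs, hψ, hψ', β, hβ, hD⟩ := exists_projective_coordinates e.open_target hs hsymm
    hWC.1 hWC.2 (e.map_source hx)
  have he₁ := he.trans hψ hψ'
  refine ⟨e.trans ψ, he₁, ⟨hx, hxψ⟩, fun z ↦ (β (ψ.symm z)).comp (fderiv ℝ ψ.symm z), ?_, ?_⟩
  · refine ContDiffOn.mono (s := ψ.target) ?_ (by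
      rw [OpenPartialHomeomorph.trans_target]; exact Set.inter_subset_left)
    exact (hβ.comp hψ' ψ.mapsTo_symm).clm_comp (hψ'.fderiv_of_isOpen ψ.open_target (by norm_cast))
  · rintro y ⟨hy, hyψ⟩
    have hyψ' : e y ∈ ψ.source := hyψ
    refine (hΓ y hy).change he hy he₁ ⟨hy, hyψ⟩ (T := ψ) ?_ fun v w ↦ ?_
    · filter_upwards [e.open_target.mem_nhds (e.map_source hy)] with u hu
      simp [e.right_inv hu]
    · have h1 : DifferentiableAt ℝ ψ (e y) :=
        (hψ.contDiffAt (ψ.open_source.mem_nhds hyψ')).differentiableAt (by simp)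
      have h2 : DifferentiableAt ℝ ψ.symm (ψ (e y)) :=
        (hψ'.contDiffAt (ψ.open_target.mem_nhds (ψ.map_source hyψ'))).differentiableAt (by simp)
      have h3 : ψ.symm ∘ ψ =ᶠ[𝓝 (e y)] id := by
        filter_upwards [ψ.open_source.mem_nhds hyψ'] with u hu using ψ.left_inv hu
      have h4 := fderiv_comp (e y) h2 h1
      rw [h3.fderiv_eq, fderiv_id] at h4
      have h5 (v : 𝔼 n) : fderiv ℝ ψ.symm (ψ (e y)) (fderiv ℝ ψ (e y) v) = v :=
        (congrArg (fun L : 𝔼 n →L[ℝ] 𝔼 n ↦ L v) h4).symm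
      rw [hD _ hyψ', projectiveChange_apply]
      simp only [OpenPartialHomeomorph.coe_trans, Function.comp_apply,
        ContinuousLinearMap.comp_apply, h5, ψ.left_inv hyψ']
      abel

end Affine

namespace RealProjectiveSpace

variable {n : ℕ}

/-- A `1`-form which is given in an affine chart near a point extends to a smooth `1`-form on the
projective space, after restriction to a smaller neighbourhood of that point. -/
lemma exists_contMDiff_oneForm_eq (i : Fin (n + 1)) {z : 𝔼 n} {Ω : Set (EuclideanSpace ℝ (Fin n))}
    (hΩ : IsOpen Ω) (hz : z ∈ Ω) {γ : 𝔼 n → 𝔼 n →L[ℝ] ℝ} (hγ : ContDiffOn ℝ ∞ γ Ω) :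
    ∃ α : Π p : RealProjectiveSpace n, TangentSpace (𝓡 n) p →L[ℝ] ℝ,
      ContMDiff (𝓡 n) ((𝓡 n).prod 𝓘(ℝ, EuclideanSpace ℝ (Fin n) →L[ℝ] ℝ)) ∞
        (fun p : RealProjectiveSpace n ↦ TotalSpace.mk' (EuclideanSpace ℝ (Fin n) →L[ℝ] ℝ)
          (E := fun p ↦ TangentSpace (𝓡 n) p →L[ℝ] ℝ) p (α p)) ∧
      ∃ V : Set (EuclideanSpace ℝ (Fin n)), IsOpen V ∧ z ∈ V ∧
        ∀ p ∈ affineDomain i, affineChart i p ∈ V → ∀ v : TangentSpace (𝓡 n) p,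
          α p v = γ (affineChart i p) (chartDeriv (affineChart i) p v) := by
  classical
  -- multiply by a bump function in the chart and extend by zero
  obtain ⟨r, hr, hrΩ⟩ := Metric.nhds_basis_closedBall.mem_iff.1 (hΩ.mem_nhds hz)
  let χ : ContDiffBump z := ⟨r / 2, r, by positivity, by linarith⟩
  have hχ0 {u : 𝔼 n} (hu : u ∉ Metric.closedBall z r) : χ u = 0 :=
    χ.zero_of_le_dist (not_le.1 hu).le
  have hsm (u : 𝔼 n) : ContDiffAt ℝ ∞ (fun u ↦ χ u • γ u) u := by
    by_cases hu : u ∈ Metric.closedBall z r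
    · exact χ.contDiff.contDiffAt.smul (hγ.contDiffAt (hΩ.mem_nhds (hrΩ hu)))
    · refine (contDiffAt_const (c := 0)).congr_of_eventuallyEq ?_
      filter_upwards [Metric.isClosed_closedBall.isOpen_compl.mem_nhds hu] with t ht
      rw [hχ0 ht, zero_smul]
  refine ⟨fun p ↦ if p ∈ affineDomain i then
    (χ (affineChart i p) • γ (affineChart i p)).comp (chartDeriv (affineChart i) p) else 0,
    fun p ↦ ?_, Metric.ball z (r / 2), Metric.isOpen_ball, Metric.mem_ball_self (by positivity),
    fun p hp hpV v ↦ ?_⟩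
  · by_cases hp : p ∈ affineDomain i
    · refine contMDiffAt_oneForm (isSmoothChart_affineChart i) hp (hsm _) ?_
      filter_upwards [(isOpen_affineDomain i).mem_nhds hp] with q hq v
      rw [if_pos hq]
      rfl
    · -- the support of the form is compact, hence closed
      have hK : IsClosed ((affineChart i).symm '' Metric.closedBall z r) :=
        ((isCompact_closedBall z r).image_of_continuousOn
          ((affineChart i).continuousOn_symm.mono (Set.subset_univ _))).isClosed
      have hpK : p ∉ (affineChart i).symm '' Metric.closedBall z r := by
        rintro ⟨u, -, rfl⟩
        exact hp ((affineChart i).map_target (Set.mem_univ u))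
      refine contMDiffAt_oneForm (isSmoothChart_chartAt p) (mem_chart_source _ p)
        (γ := 0) contDiffAt_const ?_
      filter_upwards [hK.isOpen_compl.mem_nhds hpK] with q hq v
      by_cases hqi : q ∈ affineDomain i
      · have : affineChart i q ∉ Metric.closedBall z r := fun h ↦
          hq ⟨_, h, (affineChart i).left_inv hqi⟩
        rw [if_pos hqi, hχ0 this, zero_smul]
        rfl
      · rw [if_neg hqi]
        rfl
  · have h1 : χ (affineChart i p) = 1 :=
      χ.one_of_mem_closedBall (Metric.ball_subset_closedBall hpV)
    dsimp only
    rw [if_pos hp, h1, one_smul]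
    rfl

/-- The connection projectively equivalent to the Levi-Civita connection of the Fubini-Study metric
which differs from it by the `1`-form `α`. Tangent spaces of the projective space are copies of `ℝⁿ`,
so that `projectiveChange` applies to `α p`. -/
def projectiveDeformation (α : Π p : RealProjectiveSpace n, TangentSpace (𝓡 n) p →L[ℝ] ℝ) :
    AffineConnection n (RealProjectiveSpace n) :=
  (leviCivita n).addOneForm fun p ↦
    (projectiveChange (α p : 𝔼 n →L[ℝ] ℝ) : 𝔼 n →L[ℝ] 𝔼 n →L[ℝ] 𝔼 n)

lemma projectiveDeformation_apply
    (α : Π p : RealProjectiveSpace n, TangentSpace (𝓡 n) p →L[ℝ] ℝ)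
    (Y : Π p : RealProjectiveSpace n, TangentSpace (𝓡 n) p) (p : RealProjectiveSpace n)
    (v : TangentSpace (𝓡 n) p) : projectiveDeformation α Y p v =
      leviCivita n Y p v + (α p v • Y p + α p (Y p) • v) := by
  have h := projectiveChange_apply (α p : 𝔼 n →L[ℝ] ℝ) (Y p) v
  rw [add_comm] at h
  exact congrArg (fun w ↦ leviCivita n Y p v + w) h

end RealProjectiveSpace

end

theorem mainTheorem1 (n : ℕ) {M : Type*} [TopologicalSpace M] [T2Space M]
    [ChartedSpace (EuclideanSpace ℝ (Fin n)) M] [IsManifold (𝓡 n) ∞ M]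
    (cov : AffineConnection n M) (hsmooth : cov.ContMDiffCovariantDerivative ∞)
    (htorsion : cov.torsion = 0)
    (hflat : (3 ≤ n ∧ ∀ x u v w, cov.weyl x u v w = 0) ∨
      (n = 2 ∧ ∀ x u v w, cov.cottonYork x u v w = 0)) :
    ∃ lc : AffineConnection n (RealProjectiveSpace n),
      lc.ContMDiffCovariantDerivative ∞ ∧ lc.IsLeviCivita ∧
      ∀ x : M, ∃ φ : OpenPartialHomeomorph M (RealProjectiveSpace n), x ∈ φ.source ∧
        ContMDiffOn (𝓡 n) (𝓡 n) ∞ φ φ.source ∧ ContMDiffOn (𝓡 n) (𝓡 n) ∞ φ.symm φ.target ∧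
        ∃ cov' : AffineConnection n (RealProjectiveSpace n),
          lc.ProjectivelyEquivalent cov' ∧ cov.IsAffineOn cov' φ := by
  refine ⟨RealProjectiveSpace.leviCivita n,
    RealProjectiveSpace.contMDiffCovariantDerivative_leviCivita,
    RealProjectiveSpace.isLeviCivita_leviCivita, fun x ↦ ?_⟩
  obtain ⟨e, he, hx, β, hβ, hcov⟩ := exists_projectivelyFlat_chart hsmooth htorsion hflat x
  set e' := RealProjectiveSpace.affineChart (n := n) 0
  have he' : IsSmoothChart e' := RealProjectiveSpace.isSmoothChart_affineChart 0
  -- the difference of the projective changes for the two connections, extended to `ℝPⁿ`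
  obtain ⟨α, hα, V, hV, hxV, hαV⟩ := RealProjectiveSpace.exists_contMDiff_oneForm_eq 0
    e.open_target (e.map_source hx)
    (hβ.sub (RealProjectiveSpace.contDiff_fubiniStudyOneForm 0).contDiffOn)
  -- the map which identifies `e` with `e'`, over the set `V` where `α` is the difference
  set φ := (e.trans (e'.symm.restrOpen V hV))
  have hsource : ∀ y ∈ φ.source, y ∈ e.source ∧ e y ∈ V := by
    rintro y ⟨h1, h2⟩
    exact ⟨h1, h2.2⟩
  have htarget : ∀ p ∈ φ.target, p ∈ e'.source ∧ e' p ∈ e.target := by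
    rintro p ⟨h1, h2⟩
    exact ⟨by simpa using h1.1, h2⟩
  have hφs : ContMDiffOn (𝓡 n) (𝓡 n) ∞ φ φ.source :=
    ContMDiffOn.comp (t := e'.target) he'.contMDiffOn_symm
      (he.contMDiffOn.mono fun y hy ↦ (hsource y hy).1) fun y _ ↦ Set.mem_univ _
  have hφs' : ContMDiffOn (𝓡 n) (𝓡 n) ∞ φ.symm φ.target :=
    ContMDiffOn.comp (g := e.symm) (f := e') (t := e.target) he.contMDiffOn_symm
      (he'.contMDiffOn.mono fun p hp ↦ (htarget p hp).1) fun p hp ↦ (htarget p hp).2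
  refine ⟨φ, ⟨hx, Set.mem_univ _, hxV⟩, hφs, hφs',
    RealProjectiveSpace.projectiveDeformation α, ⟨α, hα, fun Y p _ v ↦
      RealProjectiveSpace.projectiveDeformation_apply α Y p v⟩, ?_⟩
  have hcomp (y : M) : e' (φ y) = e y := e'.right_inv (Set.mem_univ _)
  have hdom (y : M) : φ y ∈ e'.source := e'.map_target (Set.mem_univ (e y))
  refine isAffineOn_of_hasChristoffelAt he he'
    ⟨hφs.mdifferentiableOn (by simp), hφs'.mdifferentiableOn (by simp)⟩
    (fun y hy ↦ (hsource y hy).1) (fun y _ ↦ hdom y) (fun y _ ↦ hcomp y)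
    fun y hy ↦ ⟨_, hcov y (hsource y hy).1, fun Y hY v ↦ ?_⟩
  have hα' := hαV (φ y) (hdom y) (by rw [hcomp]; exact (hsource y hy).2)
  rw [RealProjectiveSpace.projectiveDeformation_apply, map_add, map_add, map_smul, map_smul,
    RealProjectiveSpace.hasChristoffelAt_leviCivita (hdom y) Y hY, hα', hα', hcomp,
    projectiveChange_apply, projectiveChange_apply]
  simp only [sub_apply]
  module
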